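/- Let $\mathbb S$ be a commutative semiring in which every positive integer is invertible. **Resource calculus.** Resource terms and resource monomials are given by $s ::= x \mid \lambda x.s \mid \langle s\rangle \bar t$ and $\bar t ::= [s_1,\dots,s_n]$ ($n\ge 0$), where $x$ ranges over a fixed countably infinite set of variables, terms are taken up to $\alpha$-equivalence and monomials are finite multisets of terms. An expression is a term or a monomial; finite sums of expressions have coefficients in $\mathbb N$, and the constructors are extended to sums by linearity. The reduction $\to_\partial$, from expressions to finite sums, is the contextual closure of $\langle\lambda x.s\rangle[t_1,\dots,t_n]\to_\partial s\langle [t_1,\dots,t_n]/x\rangle$, where the multilinear substitution on the right is $\sum_{f} s[t_{f(1)}/x_1,\dots,t_{f(n)}/x_n]$, the sum being over all permutations $f$ of $\{1,\dots,n\}$, if $x$ has exactly $n$ free occurrences $x_1,\dots,x_n$ in $s$, and $0$ otherwise. It is extended to finite sums by reducing at least one summand and, for each of the others, performing at most one step. An expression is normal if it does not reduce, and $\mathrm{NF}(e)$ is the finite sum of normal expressions to which $e$ reduces (in any number of steps). Write $e\ge e'$ if $e'$ is obtained from $e$ by finitely many steps, each going from an expression to an element of the support of one of its $\to_\partial$-reducts.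 A vector is a family $\sigma=(\sigma_e)_e$ of elements of $\mathbb S$ indexed by terms (resp. by monomials), also written $\sum_e\sigma_e\cdot e$. A family of vectors is summable if, for each $e$, only finitely many members have a non-zero coefficient on $e$; its sum is then taken coefficientwise. A vector is normalizable if the set of all free variables of the elements of its support is finite and the family of the $\mathrm{NF}(e)$, for $e$ in its support, is summable (each $e'$ occurs in $\mathrm{NF}(e)$ for finitely many such $e$). Then $\mathrm{NF}(\sigma)=\sum_e \sigma_e\cdot \mathrm{NF}(e)$. Write $\sigma{\restriction_{\mathcal N}}$ for the projection of $\sigma$ on the set $\mathcal N$ of normal terms. **Algebraic terms.** Raw terms are given by $M,N ::= x\mid \lambda x.M\mid (M)N\mid 0\mid a\cdot M\mid M+N$ with $a\in\mathbb S$, up to $\alpha$-equivalence. Algebraic terms are raw terms modulo the least compatible equivalence such that $\lambda x.0= 0$, $\lambda x.(a\cdot M)= a\cdot\lambda x.M$, $\lambda x.(M+N)= \lambda x.M+\lambda x.N$, $(0)P= 0$, $(a\cdot M)P= a\cdot (M)P$ and $(M+N)P= (M)P+(N)P$ (no other semimodule equation is imposed). Each algebraic term has a unique canonical representative, in the grammar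 $M ::= S\mid 0\mid a\cdot M\mid M+N$, $S ::= x\mid\lambda x.S\mid (S)M$; algebraic terms are identified with it. The Taylor expansion $T(M)$ is the vector of resource terms defined by $T(x)=x$, $T(\lambda x.M)=\lambda x.T(M)$, $T((M)N)=\langle T(M)\rangle T(N)^!$, $T(0)=0$, $T(a\cdot M)=a\cdot T(M)$, $T(M+N)=T(M)+T(N)$, where the constructors are extended to vectors by (infinite) multilinearity and $\sigma^!=\sum_{n\in\mathbb N}\frac1{n!}\cdot[\sigma,\dots,\sigma]$ ($n$ copies of $\sigma$). The Taylor support $\mathcal T(M)$ is the set of resource terms defined by $\mathcal T(x)=\{x\}$, $\mathcal T(\lambda x.M)=\{\lambda x.s\mid s\in\mathcal T(M)\}$, $\mathcal T((M)N)=\{\langle s\rangle[t_1,\dots,t_n]\mid s\in\mathcal T(M),\ n\ge0,\ t_i\in\mathcal T(N)\}$, $\mathcal T(0)=\emptyset$, $\mathcal T(a\cdot M)=\mathcal T(M)$, $\mathcal T(M+N)=\mathcal T(M)\cup\mathcal T(N)$. The term $M$ is *Taylor normalizable* if the set of all free variables of the elements of $\mathcal T(M)$ is finite and, for every normal resource term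 $e$, $\{s\in\mathcal T(M)\mid s\ge e\}$ is finite. The (parallel) left reduct $L(M)$ is defined on canonical representatives by $L(\lambda x.S)=\lambda x.L(S)$, $L((x)M_1\cdots M_n)=(x)L(M_1)\cdots L(M_n)$, $L((\lambda x.S)M_0M_1\cdots M_n)=(S[M_0/x])M_1\cdots M_n$, $L(0)=0$, $L(a\cdot M)=a\cdot L(M)$, $L(M+N)=L(M)+L(N)$. **Theorem.** Let $M$ be a Taylor normalizable algebraic term. Then the vector $T(M)$ is normalizable and the sequence $\bigl(T(L^k(M)){\restriction_{\mathcal N}}\bigr)_{k\in\mathbb N}$ converges to $\mathrm{NF}(T(M))$ in $\mathbb S^{\mathcal N}$, coefficientwise: for every $s\in\mathcal N$ there is $k_0$ such that $T(L^k(M))_s=\mathrm{NF}(T(M))_s$ for all $k\ge k_0$. -/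

import Mathlib

universe u v

/-! ## Vectors and summability -/

namespace Vec

variable {S : Type u} [CommSemiring S] {X Y I : Type*}

/-- The basis vector `x`. -/
noncomputable def basis (S : Type u) [CommSemiring S] {X : Type*} (x : X) : X → S :=
  open Classical in fun y => if y = x then 1 else 0

/-- A family of vectors is summable when each coordinate is nonzero in finitely many members. -/
def Summable (ξ : I → X → S) : Prop :=
  ∀ x, {i | ξ i x ≠ 0}.Finite

/-- The pointwise sum of a family of vectors (meaningful for summable families). -/
noncomputable def vsum (ξ : I → X → S) : X → S :=
  fun x => ∑ᶠ i, ξ i x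

/-- A finite sum of elements of `X` (a finite multiset) seen as a vector, its multiplicities
being mapped to `S` by the unique semiring morphism `ℕ → S`. -/
noncomputable def ofSum (S : Type u) [CommSemiring S] {X : Type*} (m : Multiset X) : X → S :=
  open Classical in fun x => (m.count x : S)

/-- Convergence of a sequence of vectors: every coordinate is eventually constant, equal to the
coordinate of the limit (product topology, with `S` discrete). -/
def ConvergesTo (ξ : ℕ → X → S) (ξ' : X → S) : Prop :=
  ∀ x, ∃ n₀, ∀ n ≥ n₀, ξ n x = ξ' x

end Vec

/-- The dual of a structure (a set of subsets of `X`). -/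
def dualStructure {X : Type*} (F : Set (Set X)) : Set (Set X) :=
  {E' | ∀ E ∈ F, (E ∩ E').Finite}

/-- Every positive integer has a multiplicative inverse in `S`. -/
def HasFractions (S : Type u) [CommSemiring S] : Prop :=
  ∀ n : ℕ, n ≠ 0 → IsUnit (n : S)

/-! ## Resource expressions

Terms up to α-equivalence are represented with de Bruijn indices: a variable `var n` under `d`
abstractions is bound when `n < d`, and is the free variable number `n - d` otherwise. -/

/-- Resource expressions are resource terms or resource monomials. -/
inductive Kind : Type
  | term
  | mono

/-- Resource expressions before the quotient by permutativity of monomials. -/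
inductive RawExpr : Kind → Type
  | var : ℕ → RawExpr .term
  | lam : RawExpr .term → RawExpr .term
  | app : RawExpr .term → RawExpr .mono → RawExpr .term
  | nil : RawExpr .mono
  | cons : RawExpr .term → RawExpr .mono → RawExpr .mono

/-- Equality up to permutation of the elements of monomials, at any depth. -/
inductive RawExpr.Perm : {k : Kind} → RawExpr k → RawExpr k → Prop
  | refl {k : Kind} (e : RawExpr k) : Perm e e
  | symm {k : Kind} {e e' : RawExpr k} : Perm e e' → Perm e' e
  | trans {k : Kind} {e e' e'' : RawExpr k} : Perm e e' → Perm e' e'' → Perm e e''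
  | lam {s s' : RawExpr .term} : Perm s s' → Perm (.lam s) (.lam s')
  | app {s s' : RawExpr .term} {t t' : RawExpr .mono} :
      Perm s s' → Perm t t' → Perm (.app s t) (.app s' t')
  | cons {s s' : RawExpr .term} {t t' : RawExpr .mono} :
      Perm s s' → Perm t t' → Perm (.cons s t) (.cons s' t')
  | swap (s s' : RawExpr .term) (t : RawExpr .mono) :
      Perm (.cons s (.cons s' t)) (.cons s' (.cons s t))

instance RawExpr.setoid (k : Kind) : Setoid (RawExpr k) where
  r := RawExpr.Perm
  iseqv := ⟨.refl, .symm, .trans⟩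

/-- Resource expressions: resource terms for `k = .term`, resource monomials for `k = .mono`. -/
def ResExpr (k : Kind) : Type := Quotient (RawExpr.setoid k)

namespace ResExpr

/-- The variable `n`. -/
def var (n : ℕ) : ResExpr .term := Quotient.mk _ (.var n)

/-- The abstraction `λ s`. -/
def lam : ResExpr .term → ResExpr .term :=
  Quotient.map RawExpr.lam fun _ _ h => RawExpr.Perm.lam h

/-- The application `⟨s⟩ t` of a resource term to a monomial. -/
def app : ResExpr .term → ResExpr .mono → ResExpr .term :=
  Quotient.map₂ RawExpr.app fun _ _ h _ _ h' => RawExpr.Perm.app h h'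

/-- The empty monomial. -/
def nil : ResExpr .mono := Quotient.mk _ .nil

/-- The monomial `[s] · t`. -/
def cons : ResExpr .term → ResExpr .mono → ResExpr .mono :=
  Quotient.map₂ RawExpr.cons fun _ _ h _ _ h' => RawExpr.Perm.cons h h'

theorem cons_swap (s s' : ResExpr .term) (t : ResExpr .mono) :
    cons s (cons s' t) = cons s' (cons s t) := by
  induction s using Quotient.inductionOn
  induction s' using Quotient.inductionOn
  induction t using Quotient.inductionOn
  exact Quotient.sound (RawExpr.Perm.swap _ _ _)

/-- The data defining a function by induction on resource expressions: one operation for each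
constructor, compatible with permutativity. -/
structure FoldData (C : Kind → Type v) where
  var : ℕ → C .term
  lam : C .term → C .term
  app : C .term → C .mono → C .term
  nil : C .mono
  cons : C .term → C .mono → C .mono
  swap : ∀ a a' b, cons a (cons a' b) = cons a' (cons a b)

end ResExpr

/-- Iteration on raw expressions. -/
def RawExpr.fold {C : Kind → Type v} (F : ResExpr.FoldData C) : {k : Kind} → RawExpr k → C k
  | _, .var n => F.var n
  | _, .lam s => F.lam (fold F s)
  | _, .app s t => F.app (fold F s) (fold F t)
  | _, .nil => F.nil
  | _, .cons s t => F.cons (fold F s) (fold F t)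

theorem RawExpr.Perm.fold_eq {C : Kind → Type v} (F : ResExpr.FoldData C) {k : Kind}
    {e e' : RawExpr k} (h : RawExpr.Perm e e') : e.fold F = e'.fold F := by
  induction h with
  | refl => rfl
  | symm _ ih => exact ih.symm
  | trans _ _ ih ih' => exact ih.trans ih'
  | lam _ ih => simp only [RawExpr.fold, ih]
  | app _ _ ih ih' => simp only [RawExpr.fold, ih, ih']
  | cons _ _ ih ih' => simp only [RawExpr.fold, ih, ih']
  | swap => exact F.swap _ _ _

namespace ResExpr

/-- Iteration on resource expressions. It satisfies the five recursion equations given by the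
fields of `F`, definitionally on representatives. -/
def fold {C : Kind → Type v} (F : FoldData C) {k : Kind} (e : ResExpr k) : C k :=
  Quotient.lift (RawExpr.fold F) (fun _ _ h => RawExpr.Perm.fold_eq F h) e

/-- The monomial `[s₁, …, sₙ]`. -/
def ofList : List (ResExpr .term) → ResExpr .mono
  | [] => nil
  | s :: l => cons s (ofList l)

/-- The elements of an expression: the multiset `{s₁, …, sₙ}` for a monomial `[s₁, …, sₙ]`,
and the singleton `{s}` for a term `s`. -/
def elems {k : Kind} (e : ResExpr k) : Multiset (ResExpr .term) :=
  (fold (C := fun k => ResExpr k × Multiset (ResExpr .term))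
    { var := fun n => (var n, {var n})
      lam := fun a => (lam a.1, {lam a.1})
      app := fun a b => (app a.1 b.1, {app a.1 b.1})
      nil := (nil, 0)
      cons := fun a b => (cons a.1 b.1, a.1 ::ₘ b.2)
      swap := fun _ _ _ => Prod.ext (cons_swap _ _ _) (Multiset.cons_swap _ _ _) } e).2

/-- The set of free variables. -/
def fv {k : Kind} (e : ResExpr k) : Set ℕ :=
  fold (C := fun _ => Set ℕ)
    { var := fun n => {n}
      lam := fun a => {n | n + 1 ∈ a}
      app := fun a b => a ∪ b
      nil := ∅
      cons := fun a b => a ∪ b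
      swap := fun a a' b => Set.union_left_comm a a' b } e

/-- Renaming making room for a fresh variable `c`: variables `≥ c` are incremented. -/
def shift {k : Kind} (e : ResExpr k) (c : ℕ) : ResExpr k :=
  fold (C := fun k => ℕ → ResExpr k)
    { var := fun n c => if n < c then var n else var (n + 1)
      lam := fun a c => lam (a (c + 1))
      app := fun a b c => app (a c) (b c)
      nil := fun _ => nil
      cons := fun a b c => cons (a c) (b c)
      swap := fun _ _ _ => funext fun _ => cons_swap _ _ _ } e c

/-- Distributing a multiset among three recipients does not depend on their order. -/
theorem antidiagonal_bind_left_comm {α β : Type*} (u : Multiset α)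
    (F : Multiset α → Multiset α → Multiset α → Multiset β) :
    (u.antidiagonal.bind fun p => p.2.antidiagonal.bind fun q => F p.1 q.1 q.2) =
      u.antidiagonal.bind fun p => p.2.antidiagonal.bind fun q => F q.1 p.1 q.2 := by
  induction u using Multiset.induction_on generalizing F with
  | empty => simp
  | cons a u ih =>
    have h1 := ih fun x y z => F (a ::ₘ x) y z
    have h2 := ih fun x y z => F x (a ::ₘ y) z
    have h3 := ih fun x y z => F x y (a ::ₘ z)
    simp only [Multiset.antidiagonal_cons, Multiset.add_bind, Multiset.bind_map, Prod.map_fst,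
      Prod.map_snd, id, Multiset.bind_add]
    rw [h1, h2, h3]
    abel

/-- Multilinear substitution: `s.lsubst d u` is the finite sum of all the expressions obtained by
substituting the elements of `u` for the free occurrences of the variable `d` in `s`, one element
for each occurrence, in all possible ways; it is `0` when the number of occurrences of `d` in `s`
differs from the cardinality of `u`. Since the variable `d` disappears, variables `> d` are
decremented. In applications and monomials, `u` is partitioned among the components in all
possible ways, `Multiset.antidiagonal` enumerating the partitions into two parts with their
multiplicities.

Finite sums of expressions are represented by finite multisets, hence the sum of the elements of
`u` is `u` itself and `0` is the null sum. -/
def lsubst {k : Kind} (e : ResExpr k) (d : ℕ) (u : Multiset (ResExpr .term)) :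
    Multiset (ResExpr k) :=
  fold (C := fun k => ℕ → Multiset (ResExpr .term) → Multiset (ResExpr k))
    { var := fun n d u =>
        if n = d then (if u.card = 1 then u else 0)
        else if u.card = 0 then {if n < d then var n else var (n - 1)} else 0
      lam := fun a d u => (a (d + 1) (u.map fun s => s.shift 0)).map lam
      app := fun a b d u => u.antidiagonal.bind fun p =>
        (a d p.1).bind fun s => (b d p.2).map fun t => app s t
      nil := fun _ u => if u.card = 0 then {nil} else 0
      cons := fun a b d u => u.antidiagonal.bind fun p =>
        (a d p.1).bind fun s => (b d p.2).map fun t => cons s t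
      swap := by
        intro a a' b
        funext d u
        have h := antidiagonal_bind_left_comm u fun x y z =>
          (a d x).bind fun s => (a' d y).bind fun s' => (b d z).map fun t => cons s (cons s' t)
        convert h using 1
        · refine Multiset.bind_congr fun p _ => ?_
          simp only [Multiset.map_bind, Multiset.map_map, Function.comp_def]
          rw [Multiset.bind_bind]
        · refine Multiset.bind_congr fun p _ => ?_
          simp only [Multiset.map_bind, Multiset.map_map, Function.comp_def]
          rw [Multiset.bind_bind]
          refine Multiset.bind_congr fun q _ => ?_
          rw [Multiset.bind_bind]
          refine Multiset.bind_congr fun s _ => Multiset.bind_congr fun s' _ => ?_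
          simp only [cons_swap s s'] } e d u

/-! ## Resource reduction and normal forms -/

/-- Resource reduction, from expressions to finite sums of expressions. -/
inductive Red : {k : Kind} → ResExpr k → Multiset (ResExpr k) → Prop
  | beta (s : ResExpr .term) (t : ResExpr .mono) : Red (app (lam s) t) (s.lsubst 0 t.elems)
  | lam {s : ResExpr .term} {σ : Multiset (ResExpr .term)} : Red s σ → Red (lam s) (σ.map lam)
  | app_left {s : ResExpr .term} {σ : Multiset (ResExpr .term)} (t : ResExpr .mono) :
      Red s σ → Red (app s t) (σ.map fun s' => app s' t)
  | app_right (s : ResExpr .term) {t : ResExpr .mono} {τ : Multiset (ResExpr .mono)} :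
      Red t τ → Red (app s t) (τ.map fun t' => app s t')
  | cons {s : ResExpr .term} {σ : Multiset (ResExpr .term)} (t : ResExpr .mono) :
      Red s σ → Red (cons s t) (σ.map fun s' => cons s' t)

variable {k : Kind}

/-- Reduction of finite sums: at least one summand `e₀` is reduced, and each of the others is
either reduced or kept. The multiset `P` lists the pairs `(eᵢ, ε'ᵢ)` for the other summands. -/
def SumRed (ε ε' : Multiset (ResExpr k)) : Prop :=
  ∃ (e₀ : ResExpr k) (ε₀ : Multiset (ResExpr k))
    (P : Multiset (ResExpr k × Multiset (ResExpr k))),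
    Red e₀ ε₀ ∧ (∀ p ∈ P, p.2 = {p.1} ∨ Red p.1 p.2) ∧
      ε = e₀ ::ₘ P.map Prod.fst ∧ ε' = ε₀ + (P.map Prod.snd).sum

/-- Normal expressions: those that do not reduce. -/
def IsNormal (e : ResExpr k) : Prop := ∀ ε', ¬ Red e ε'

/-- The normal form of a finite sum of resource expressions: the sum of normal expressions it
reduces to. -/
noncomputable def nf (ε : Multiset (ResExpr k)) : Multiset (ResExpr k) :=
  open Classical in
  if h : ∃ ν, Relation.ReflTransGen SumRed ε ν ∧ ∀ e ∈ ν, IsNormal e then h.choose else 0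

/-- `e'` occurs in the result of a one step reduction of `e`. -/
def OneStepGenerates (e e' : ResExpr k) : Prop := ∃ ε', Red e ε' ∧ e' ∈ ε'

/-- The reflexive and transitive closure of `OneStepGenerates`. -/
def Generates : ResExpr k → ResExpr k → Prop := Relation.ReflTransGen OneStepGenerates

/-- The set of expressions that generate `e`. -/
def cone (e : ResExpr k) : Set (ResExpr k) := {e' | Generates e' e}

/-- The free variables of a set of expressions. -/
def setFv (E : Set (ResExpr k)) : Set ℕ := ⋃ e ∈ E, fv e

/-- The sets of resource expressions with finitely many free variables. -/
def resourceStructure (k : Kind) : Set (Set (ResExpr k)) := {E | (setFv E).Finite}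

/-- The finiteness structure of normalizable sets of resource expressions. -/
def normStructure (k : Kind) : Set (Set (ResExpr k)) :=
  dualStructure {C | ∃ e : ResExpr k, IsNormal e ∧ C = cone e} ∩ resourceStructure k

end ResExpr

/-! ## Resource vectors -/

namespace ResVec

variable {S : Type u} [CommSemiring S] {k : Kind}

open ResExpr

/-- `ε` is normalizable: it has finitely many free variables, and the family of the normal forms of
the elements of its support is summable, as a family of sums with coefficients in `ℕ`. -/
def Normalizable (ε : ResExpr k → S) : Prop :=
  (setFv (Function.support ε)).Finite ∧
    Vec.Summable fun e : Function.support ε => Vec.ofSum ℕ (nf {(e : ResExpr k)})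

/-- The normal form `∑ₑ εₑ · NF(e)` of a normalizable vector `ε`. -/
noncomputable def normalForm (ε : ResExpr k → S) : ResExpr k → S :=
  Vec.vsum fun e => ε e • Vec.ofSum S (nf {e})

/-- The projection of `ε` on normal expressions. Vectors of normal expressions are identified
with vectors whose coefficients on expressions that are not normal are zero. -/
noncomputable def normRestr (ε : ResExpr k → S) : ResExpr k → S :=
  open Classical in fun e => if IsNormal e then ε e else 0

/-- `λ σ`, by linearity. -/
noncomputable def lam (σ : ResExpr .term → S) : ResExpr .term → S :=
  Vec.vsum fun s => σ s • Vec.basis S (ResExpr.lam s)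

/-- `⟨σ⟩ τ`, by bilinearity. -/
noncomputable def app (σ : ResExpr .term → S) (τ : ResExpr .mono → S) : ResExpr .term → S :=
  Vec.vsum fun p : ResExpr .term × ResExpr .mono =>
    (σ p.1 * τ p.2) • Vec.basis S (ResExpr.app p.1 p.2)

/-- `σⁿ = [σ, …, σ]`, by `n`-linearity. -/
noncomputable def pow (σ : ResExpr .term → S) (n : ℕ) : ResExpr .mono → S :=
  Vec.vsum fun f : Fin n → ResExpr .term =>
    (∏ i, σ (f i)) • Vec.basis S (ResExpr.ofList (List.ofFn f))

/-- The promotion `∑ₙ (1 / n!) · σⁿ`. -/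
noncomputable def prom (σ : ResExpr .term → S) : ResExpr .mono → S :=
  Vec.vsum fun n : ℕ => Ring.inverse (n.factorial : S) • pow σ n

end ResVec

/-! ## Algebraic λ-terms -/

/-- Raw algebraic terms over `S`, up to α-equivalence (with de Bruijn indices). -/
inductive RawTerm (S : Type u) : Type u
  | var : ℕ → RawTerm S
  | lam : RawTerm S → RawTerm S
  | app : RawTerm S → RawTerm S → RawTerm S
  | zero : RawTerm S
  | smul : S → RawTerm S → RawTerm S
  | add : RawTerm S → RawTerm S → RawTerm S

namespace RawTerm

variable {S : Type u}

/-- Renaming making room for a fresh variable `c`: variables `≥ c` are incremented. -/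
def shift : RawTerm S → ℕ → RawTerm S
  | var n, c => if n < c then var n else var (n + 1)
  | lam M, c => lam (M.shift (c + 1))
  | app M N, c => app (M.shift c) (N.shift c)
  | zero, _ => zero
  | smul a M, c => smul a (M.shift c)
  | add M N, c => add (M.shift c) (N.shift c)

/-- Substitution of `P` for the variable `d`, variables `> d` being decremented. -/
def subst : RawTerm S → ℕ → RawTerm S → RawTerm S
  | var n, d, P => if n < d then var n else if n = d then P else var (n - 1)
  | lam M, d, P => lam (M.subst (d + 1) (P.shift 0))
  | app M N, d, P => app (M.subst d P) (N.subst d P)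
  | zero, _, _ => zero
  | smul a M, d, P => smul a (M.subst d P)
  | add M N, d, P => add (M.subst d P) (N.subst d P)

/-- Taylor expansion. -/
noncomputable def taylor [CommSemiring S] : RawTerm S → ResExpr .term → S
  | var n => Vec.basis S (ResExpr.var n)
  | lam M => ResVec.lam M.taylor
  | app M N => ResVec.app M.taylor (ResVec.prom N.taylor)
  | zero => 0
  | smul a M => a • M.taylor
  | add M N => M.taylor + N.taylor

/-- Taylor support. In the case of an application, the promotion of a set of terms is the set of
monomials whose elements are in this set. -/
def taylorSup : RawTerm S → Set (ResExpr .term)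
  | var n => {ResExpr.var n}
  | lam M => {u | ∃ s ∈ M.taylorSup, u = ResExpr.lam s}
  | app M N => {u | ∃ s ∈ M.taylorSup, ∃ t : ResExpr .mono,
      (∀ v ∈ t.elems, v ∈ N.taylorSup) ∧ u = ResExpr.app s t}
  | zero => ∅
  | smul _ M => M.taylorSup
  | add M N => M.taylorSup ∪ N.taylorSup

/-- The least compatible equivalence containing the linearity of abstraction and the linearity of
application in the function. -/
inductive CanEq : RawTerm S → RawTerm S → Prop
  | refl (M : RawTerm S) : CanEq M M
  | symm {M N : RawTerm S} : CanEq M N → CanEq N M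
  | trans {M N P : RawTerm S} : CanEq M N → CanEq N P → CanEq M P
  | lam {M M' : RawTerm S} : CanEq M M' → CanEq (lam M) (lam M')
  | app {M M' N N' : RawTerm S} : CanEq M M' → CanEq N N' → CanEq (app M N) (app M' N')
  | smul (a : S) {M M' : RawTerm S} : CanEq M M' → CanEq (smul a M) (smul a M')
  | add {M M' N N' : RawTerm S} : CanEq M M' → CanEq N N' → CanEq (add M N) (add M' N')
  | lam_zero : CanEq (lam zero) zero
  | lam_smul (a : S) (M : RawTerm S) : CanEq (lam (smul a M)) (smul a (lam M))
  | lam_add (M N : RawTerm S) : CanEq (lam (add M N)) (add (lam M) (lam N))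
  | app_zero (P : RawTerm S) : CanEq (app zero P) zero
  | app_smul (a : S) (M P : RawTerm S) : CanEq (app (smul a M) P) (smul a (app M P))
  | app_add (M N P : RawTerm S) : CanEq (app (add M N) P) (add (app M P) (app N P))

end RawTerm

/-- Algebraic λ-terms. -/
def AlgTerm (S : Type u) : Type u := Quot (RawTerm.CanEq (S := S))

/-- The two classes of canonical terms. -/
inductive CanonClass : Type
  | simple
  | general

/-- Simple canonical terms (for the class `.simple`) and canonical terms (for `.general`). -/
inductive Canon (S : Type u) : CanonClass → Type u
  | var : ℕ → Canon S .simple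
  | lam : Canon S .simple → Canon S .simple
  | app : Canon S .simple → Canon S .general → Canon S .simple
  | ofSimple : Canon S .simple → Canon S .general
  | zero : Canon S .general
  | smul : S → Canon S .general → Canon S .general
  | add : Canon S .general → Canon S .general → Canon S .general

namespace Canon

variable {S : Type u}

/-- Canonical terms are raw terms. -/
def toRaw : {c : CanonClass} → Canon S c → RawTerm S
  | _, var n => .var n
  | _, lam M => .lam M.toRaw
  | _, app M N => .app M.toRaw N.toRaw
  | _, ofSimple M => M.toRaw
  | _, zero => .zero
  | _, smul a M => .smul a M.toRaw
  | _, add M N => .add M.toRaw N.toRaw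

/-- Abstraction, distributed over sums. -/
def mkLam : Canon S .general → Canon S .general
  | ofSimple M => ofSimple (lam M)
  | zero => zero
  | smul a M => smul a M.mkLam
  | add M N => add M.mkLam N.mkLam

/-- Application, distributed over sums in function position. -/
def mkApp : Canon S .general → Canon S .general → Canon S .general
  | ofSimple M, P => ofSimple (app M P)
  | zero, _ => zero
  | smul a M, P => smul a (M.mkApp P)
  | add M N, P => add (M.mkApp P) (N.mkApp P)

/-- Whether a simple term is a variable applied to some arguments. -/
def headVar : {c : CanonClass} → Canon S c → Bool
  | _, var _ => true
  | _, app M _ => M.headVar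
  | _, _ => false

/-- The left reduct of a canonical term, as a representative of an algebraic term. -/
def leftReduct : {c : CanonClass} → Canon S c → RawTerm S
  | _, var n => .var n
  | _, lam M => .lam M.leftReduct
  | _, app (lam M) N => M.toRaw.subst 0 N.toRaw
  | _, app (var n) N => .app (.var n) N.leftReduct
  | _, app (app M P) N =>
      .app (app M P).leftReduct (if M.headVar then N.leftReduct else N.toRaw)
  | _, ofSimple M => M.leftReduct
  | _, zero => .zero
  | _, smul a M => .smul a M.leftReduct
  | _, add M N => .add M.leftReduct N.leftReduct

end Canon

namespace RawTerm

variable {S : Type u}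

/-- The canonical form of a raw term. -/
def canon : RawTerm S → Canon S .general
  | var n => .ofSimple (.var n)
  | lam M => M.canon.mkLam
  | app M N => M.canon.mkApp N.canon
  | zero => .zero
  | smul a M => .smul a M.canon
  | add M N => .add M.canon N.canon

theorem CanEq.canon_eq {M N : RawTerm S} (h : CanEq M N) : M.canon = N.canon := by
  induction h with
  | refl => rfl
  | symm _ ih => exact ih.symm
  | trans _ _ ih ih' => exact ih.trans ih'
  | _ => simp_all [canon, Canon.mkLam, Canon.mkApp]

end RawTerm

/-- A canonical term is its own canonical form. -/
theorem Canon.canon_toRaw {S : Type u} {c : CanonClass} (M : Canon S c) :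
    M.toRaw.canon = (match c, M with
      | .simple, M => Canon.ofSimple M
      | .general, M => M) := by
  induction M <;> simp_all [toRaw, RawTerm.canon, mkLam, mkApp]

namespace RawTerm

variable {S : Type u}

theorem canEq_mkLam : ∀ M : Canon S .general, CanEq M.mkLam.toRaw (lam M.toRaw)
  | .ofSimple M => by simpa only [Canon.mkLam, Canon.toRaw] using .refl _
  | .zero => by simpa only [Canon.mkLam, Canon.toRaw] using .symm .lam_zero
  | .smul a M => by
    simpa only [Canon.mkLam, Canon.toRaw] using
      .trans (.smul a (canEq_mkLam M)) (.symm (.lam_smul a _))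
  | .add M N => by
    simpa only [Canon.mkLam, Canon.toRaw] using
      .trans (.add (canEq_mkLam M) (canEq_mkLam N)) (.symm (.lam_add _ _))

theorem canEq_mkApp (P : Canon S .general) :
    ∀ M : Canon S .general, CanEq (M.mkApp P).toRaw (app M.toRaw P.toRaw)
  | .ofSimple M => by simpa only [Canon.mkApp, Canon.toRaw] using .refl _
  | .zero => by simpa only [Canon.mkApp, Canon.toRaw] using .symm (.app_zero _)
  | .smul a M => by
    simpa only [Canon.mkApp, Canon.toRaw] using
      .trans (.smul a (canEq_mkApp P M)) (.symm (.app_smul a _ _))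
  | .add M N => by
    simpa only [Canon.mkApp, Canon.toRaw] using
      .trans (.add (canEq_mkApp P M) (canEq_mkApp P N)) (.symm (.app_add _ _ _))

/-- Every raw term is equivalent to its canonical form. -/
theorem canEq_canon (M : RawTerm S) : CanEq M.canon.toRaw M := by
  induction M with
  | var n => exact .refl _
  | lam M ih => exact .trans (canEq_mkLam M.canon) (.lam ih)
  | app M N ih ih' => exact .trans (canEq_mkApp N.canon M.canon) (.app ih ih')
  | zero => exact .refl _
  | smul a M ih => exact .smul a ih
  | add M N ih ih' => exact .add ih ih'

end RawTerm

namespace AlgTerm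

variable {S : Type u}

/-- The algebraic term represented by a raw term. -/
def mk (M : RawTerm S) : AlgTerm S := Quot.mk _ M

/-- The canonical representative of an algebraic term. -/
def canonical (M : AlgTerm S) : Canon S .general :=
  Quot.lift RawTerm.canon (fun _ _ h => h.canon_eq) M

/-- The Taylor expansion of an algebraic term. -/
noncomputable def taylor [CommSemiring S] (M : AlgTerm S) : ResExpr .term → S :=
  M.canonical.toRaw.taylor

/-- The Taylor support of an algebraic term. -/
def taylorSup (M : AlgTerm S) : Set (ResExpr .term) := M.canonical.toRaw.taylorSup

/-- The (parallel) left reduct of an algebraic term. -/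
def leftReduct (M : AlgTerm S) : AlgTerm S := mk M.canonical.leftReduct

/-- Taylor normalizability. -/
def TaylorNormalizable (M : AlgTerm S) : Prop := M.taylorSup ∈ ResExpr.normStructure .term

end AlgTerm

/-! The proof transfers left reduction to resource terms and computes coefficientwise. A resource
term `s` has a parallel left reduct `left s`, a finite sum reachable from `s` by resource reduction
(`mred_left`). Either `s` is normal and fixed, or every summand is strictly smaller
(`left_eq_or_size_lt`). Hence more than `size s` left steps yield exactly the normal form of `s`
(`leftIter_eq_nform`).

The key identity is that Taylor expansion commutes with left reduction: the expansion of the left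
reduct of `M` is the sum of the `left s` weighted by the coefficients of `M`
(`Canon.taylor_leftReduct`). Iterating, the coefficient of a normal `e` in the expansion of the
`k`-th left reduct is a sum, over `s`, of the coefficient of `s` in `M` times the multiplicity of
`e` in the `k`-th left reduct of `s`. Only those `s` with `s ≥ e` matter. Taylor normalizability
leaves finitely many of them in the Taylor support, so once `k` exceeds their sizes every
multiplicity has become that of `e` in the normal form of `s`.

Three ingredients support this. First, resource normal forms are unique: local confluence holds by
reductions of expressions smaller than the source, so induction on size suffices (`Red.joinable`,
`Red.nform_eq`). It rests on the substitution lemma `lsubst_lsubst`.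

Second, infinite linear combinations can be transported and composed. A map from elements to finite
sums extends to all vectors when each output has finitely many inputs (`Finitary`), and such
extensions compose (`push_push`). For substitution and left reduction, finiteness follows from
bounding the weight of an input by a function of the weight of an output.

Third, substitution commutes with Taylor expansion (`taylor_subst`). Promotions are handled without
their coefficients: since positive integers are invertible, a promotion is the unique solution of a
differential equation (`IsExp.unique`), and to see that an operation preserves promotions it
suffices to compare finite sums. Promotions are moreover group-like
(`IsExp.mul_count_antidiagonal`), so that one copy of a promotion can be shared between the function
and the argument of an application. -/

/-- Resource terms. -/
abbrev ResTerm : Type := ResExpr .term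

/-- Resource monomials. -/
abbrev ResMono : Type := ResExpr .mono

namespace ResExpr

/-! ## Induction and inversion for resource expressions -/

theorem induction_on {P : ∀ {k : Kind}, ResExpr k → Prop} (hvar : ∀ n, P (var n))
    (hlam : ∀ s, P s → P (lam s)) (happ : ∀ s t, P s → P t → P (app s t)) (hnil : P nil)
    (hcons : ∀ s t, P s → P t → P (cons s t)) {k : Kind} (e : ResExpr k) : P e := by
  induction e using Quotient.inductionOn with
  | h a =>
    induction a with
    | var n => exact hvar n
    | lam a ih => exact hlam _ ih
    | app a b ih ih' => exact happ _ _ ih ih'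
    | nil => exact hnil
    | cons a b ih ih' => exact hcons _ _ ih ih'

theorem term_cases (e : ResTerm) :
    (∃ n, e = var n) ∨ (∃ s, e = lam s) ∨ ∃ s t, e = app s t := by
  induction e using Quotient.inductionOn with
  | h a =>
    cases a with
    | var n => exact .inl ⟨n, rfl⟩
    | lam a => exact .inr (.inl ⟨Quotient.mk _ a, rfl⟩)
    | app a b => exact .inr (.inr ⟨Quotient.mk _ a, Quotient.mk _ b, rfl⟩)

theorem mono_cases (e : ResMono) : e = nil ∨ ∃ s t, e = cons s t := by
  induction e using Quotient.inductionOn with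
  | h a =>
    cases a with
    | nil => exact .inl rfl
    | cons a b => exact .inr ⟨Quotient.mk _ a, Quotient.mk _ b, rfl⟩

theorem mono_induction {P : ResMono → Prop} (hnil : P nil) (hcons : ∀ s t, P t → P (cons s t))
    (e : ResMono) : P e :=
  induction_on (P := fun {k} e => match k, e with
    | .term, _ => True
    | .mono, e => P e) (fun _ => trivial) (fun _ _ => trivial) (fun _ _ _ _ => trivial) hnil
    (fun s t _ h => hcons s t h) e

/-- The immediate subexpressions of a resource term. -/
inductive View : Type
  | var : ℕ → View
  | lam : ResTerm → View
  | app : ResTerm → ResMono → View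
  | none : View

/-- The data computing `view`. -/
def viewData : FoldData fun k => ResExpr k × View where
  var n := (var n, .var n)
  lam a := (lam a.1, .lam a.1)
  app a b := (app a.1 b.1, .app a.1 b.1)
  nil := (nil, .none)
  cons a b := (cons a.1 b.1, .none)
  swap _ _ _ := Prod.ext (cons_swap _ _ _) rfl

/-- Carrying a rebuilt copy turns iteration into primitive recursion; this identifies the copy with
the original. The same device serves for `elems` and `left`. -/
theorem fold_viewData_fst {k : Kind} (e : ResExpr k) : (fold viewData e).1 = e := by
  induction e using Quotient.inductionOn with
  | h a =>
    induction a with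
    | var n => rfl
    | nil => rfl
    | lam a ih => exact congrArg lam ih
    | app a b ih ih' => exact congrArg₂ app ih ih'
    | cons a b ih ih' => exact congrArg₂ cons ih ih'

/-- The head constructor of a resource term, with its arguments. -/
def view (e : ResTerm) : View := (fold viewData e).2

@[simp] theorem view_var (n : ℕ) : view (var n) = .var n := rfl

@[simp] theorem view_lam (s : ResTerm) : view (lam s) = .lam s := by
  -- With the rebuilt copy on the right, both sides agree definitionally on representatives.
  conv_rhs => rw [← fold_viewData_fst s]
  induction s using Quotient.inductionOn with
  | h a => rfl

@[simp] theorem view_app (s : ResTerm) (t : ResMono) : view (app s t) = .app s t := by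
  conv_rhs => rw [← fold_viewData_fst s, ← fold_viewData_fst t]
  induction s using Quotient.inductionOn
  induction t using Quotient.inductionOn
  rfl

@[simp] theorem lam_inj {s s' : ResTerm} : lam s = lam s' ↔ s = s' :=
  ⟨fun h => by simpa using congrArg view h, congrArg _⟩

@[simp] theorem app_inj {s s' : ResTerm} {t t' : ResMono} :
    app s t = app s' t' ↔ s = s' ∧ t = t' :=
  ⟨fun h => by simpa using congrArg view h, fun h => by rw [h.1, h.2]⟩

@[simp] theorem var_ne_lam (n : ℕ) (s : ResTerm) : var n ≠ lam s :=
  fun h => by simpa using congrArg view h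

@[simp] theorem var_ne_app (n : ℕ) (s : ResTerm) (t : ResMono) : var n ≠ app s t :=
  fun h => by simpa using congrArg view h

@[simp] theorem lam_ne_app (s' s : ResTerm) (t : ResMono) : lam s' ≠ app s t :=
  fun h => by simpa using congrArg view h

@[simp] theorem app_ne_lam (s' s : ResTerm) (t : ResMono) : app s t ≠ lam s' :=
  (lam_ne_app s' s t).symm

/-! ## Monomials as multisets -/

/-- The data computing `elems`. -/
def elemsData : FoldData fun k => ResExpr k × Multiset ResTerm where
  var n := (var n, {var n})
  lam a := (lam a.1, {lam a.1})
  app a b := (app a.1 b.1, {app a.1 b.1})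
  nil := (nil, 0)
  cons a b := (cons a.1 b.1, a.1 ::ₘ b.2)
  swap _ _ _ := Prod.ext (cons_swap _ _ _) (Multiset.cons_swap _ _ _)

theorem fold_elemsData_fst {k : Kind} (e : ResExpr k) : (fold elemsData e).1 = e := by
  induction e using Quotient.inductionOn with
  | h a =>
    induction a with
    | var n => rfl
    | nil => rfl
    | lam a ih => exact congrArg lam ih
    | app a b ih ih' => exact congrArg₂ app ih ih'
    | cons a b ih ih' => exact congrArg₂ cons ih ih'

@[simp] theorem elems_nil : elems nil = 0 := rfl

@[simp] theorem elems_cons (s : ResTerm) (t : ResMono) : elems (cons s t) = s ::ₘ elems t := by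
  conv_rhs => rw [← fold_elemsData_fst s]
  induction s using Quotient.inductionOn
  induction t using Quotient.inductionOn
  rfl

instance : LeftCommutative cons := ⟨cons_swap⟩

/-- The monomial with given elements. -/
def ofMultiset (m : Multiset ResTerm) : ResMono := m.foldr cons nil

@[simp] theorem ofMultiset_zero : ofMultiset 0 = nil := rfl

@[simp] theorem ofMultiset_cons (s : ResTerm) (m : Multiset ResTerm) :
    ofMultiset (s ::ₘ m) = cons s (ofMultiset m) := Multiset.foldr_cons _ _ _ _

@[simp] theorem elems_ofMultiset (m : Multiset ResTerm) : elems (ofMultiset m) = m := by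
  induction m using Multiset.induction_on with
  | empty => rfl
  | cons a m ih => simp [ih]

@[simp] theorem ofMultiset_elems (t : ResMono) : ofMultiset (elems t) = t := by
  induction t using mono_induction with
  | hnil => rfl
  | hcons s t ih => simp [ih]

/-- Monomials are finite multisets of terms. -/
def monoEquiv : ResMono ≃ Multiset ResTerm where
  toFun t := elems t
  invFun := ofMultiset
  left_inv := ofMultiset_elems
  right_inv := elems_ofMultiset

theorem elems_injective : Function.Injective (elems : ResMono → Multiset ResTerm) :=
  monoEquiv.injective

theorem ofMultiset_injective : Function.Injective ofMultiset := monoEquiv.symm.injective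

theorem ofList_eq (l : List ResTerm) : ofList l = ofMultiset l := by
  induction l with
  | nil => rfl
  | cons a l ih => rw [ofList, ih, ← Multiset.cons_coe, ofMultiset_cons]

/-! ## Equations for the operations defined by iteration -/

section Equations

variable (s : ResTerm) (t : ResMono) (c d n : ℕ) (u : Multiset ResTerm)

@[simp] theorem shift_var : shift (var n) c = if n < c then var n else var (n + 1) := rfl

@[simp] theorem shift_lam : shift (lam s) c = lam (shift s (c + 1)) := by
  induction s using Quotient.inductionOn
  rfl

@[simp] theorem shift_app : shift (app s t) c = app (shift s c) (shift t c) := by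
  induction s using Quotient.inductionOn
  induction t using Quotient.inductionOn
  rfl

@[simp] theorem shift_nil : shift nil c = nil := rfl

@[simp] theorem shift_cons : shift (cons s t) c = cons (shift s c) (shift t c) := by
  induction s using Quotient.inductionOn
  induction t using Quotient.inductionOn
  rfl

theorem elems_shift : (shift t c).elems = t.elems.map (shift · c) := by
  induction t using mono_induction with
  | hnil => rfl
  | hcons s t ih => simp [ih]

theorem lsubst_var : lsubst (var n) d u = if n = d then (if u.card = 1 then u else 0)
    else if u.card = 0 then {if n < d then var n else var (n - 1)} else 0 := rfl

theorem lsubst_lam :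
    lsubst (lam s) d u = (lsubst s (d + 1) (u.map fun s => s.shift 0)).map lam := by
  induction s using Quotient.inductionOn
  rfl

theorem lsubst_app : lsubst (app s t) d u = u.antidiagonal.bind fun p =>
    (lsubst s d p.1).bind fun s => (lsubst t d p.2).map fun t => app s t := by
  induction s using Quotient.inductionOn
  induction t using Quotient.inductionOn
  rfl

theorem lsubst_nil : lsubst nil d u = if u.card = 0 then {nil} else 0 := rfl

theorem lsubst_cons : lsubst (cons s t) d u = u.antidiagonal.bind fun p =>
    (lsubst s d p.1).bind fun s => (lsubst t d p.2).map fun t => cons s t := by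
  induction s using Quotient.inductionOn
  induction t using Quotient.inductionOn
  rfl

end Equations

/-! ## Size -/

/-- The number of variable occurrences, abstractions and applications. -/
def size {k : Kind} (e : ResExpr k) : ℕ :=
  fold (C := fun _ => ℕ)
    { var := fun _ => 1
      lam := fun a => a + 1
      app := fun a b => a + b + 1
      nil := 0
      cons := fun a b => a + b
      swap := fun a a' b => Nat.add_left_comm a a' b } e

section Size

variable (s : ResTerm) (t : ResMono) (n : ℕ)

@[simp] theorem size_var : size (var n) = 1 := rfl

@[simp] theorem size_lam : size (lam s) = size s + 1 := by
  induction s using Quotient.inductionOn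
  rfl

@[simp] theorem size_app : size (app s t) = size s + size t + 1 := by
  induction s using Quotient.inductionOn
  induction t using Quotient.inductionOn
  rfl

@[simp] theorem size_nil : size nil = 0 := rfl

@[simp] theorem size_cons : size (cons s t) = size s + size t := by
  induction s using Quotient.inductionOn
  induction t using Quotient.inductionOn
  rfl

theorem size_eq_sum : size t = (t.elems.map size).sum := by
  induction t using mono_induction with
  | hnil => rfl
  | hcons s t ih => simp [ih]

end Size

@[simp] theorem size_shift {k : Kind} (e : ResExpr k) (c : ℕ) : size (shift e c) = size e := by
  revert c
  apply induction_on (P := fun {k} e => ∀ c, size (shift e c) = size e)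
  · intro n c
    rw [shift_var]
    split_ifs <;> rfl
  all_goals simp +contextual

theorem mem_lsubst_bin {k l : Kind} {s : ResExpr k} {t : ResExpr l} {j : Kind} {d : ℕ}
    {f : ResExpr k → ResExpr l → ResExpr j} {u : Multiset ResTerm} {e : ResExpr j} :
    e ∈ (u.antidiagonal.bind fun p => (lsubst s d p.1).bind fun s => (lsubst t d p.2).map fun t =>
      f s t) ↔ ∃ u₁ u₂, u₁ + u₂ = u ∧ ∃ s' ∈ lsubst s d u₁, ∃ t' ∈ lsubst t d u₂, f s' t' = e := by
  simp only [Multiset.mem_bind, Multiset.mem_map, Prod.exists, Multiset.mem_antidiagonal]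

/-- Each of the `u.card` occurrences of the variable, of size one, gives way to one element of `u`,
and each element is used exactly once. The additive form avoids subtraction. -/
theorem size_of_mem_lsubst {k : Kind} (e : ResExpr k) : ∀ (d : ℕ) (u : Multiset ResTerm),
    ∀ e' ∈ lsubst e d u, size e' + u.card = size e + (u.map size).sum := by
  apply induction_on (P := fun {k} e => ∀ (d : ℕ) (u : Multiset ResTerm),
    ∀ e' ∈ lsubst e d u, size e' + u.card = size e + (u.map size).sum)
  · intro n d u e' he
    rw [lsubst_var] at he
    split_ifs at he with h1 h2 h3
    · obtain ⟨a, rfl⟩ := Multiset.card_eq_one.1 h2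
      simp_all [add_comm]
    · simp at he
    · simp_all
    · obtain rfl : u = 0 := by simpa using h3
      simp_all
    · simp at he
  · intro s ih d u e' he
    rw [lsubst_lam, Multiset.mem_map] at he
    obtain ⟨a, ha, rfl⟩ := he
    have h : size a + u.card = size s + (u.map size).sum := by simpa using ih _ _ _ ha
    rw [size_lam, size_lam]
    omega
  · intro s t ih ih' d u e' he
    rw [lsubst_app, mem_lsubst_bin] at he
    obtain ⟨u₁, u₂, rfl, s', hs, t', ht, rfl⟩ := he
    have h1 := ih _ _ _ hs
    have h2 := ih' _ _ _ ht
    simp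
    omega
  · intro d u e' he
    rw [lsubst_nil] at he
    split_ifs at he with h
    · obtain rfl : u = 0 := by simpa using h
      simp_all
    · simp at he
  · intro s t ih ih' d u e' he
    rw [lsubst_cons, mem_lsubst_bin] at he
    obtain ⟨u₁, u₂, rfl, s', hs, t', ht, rfl⟩ := he
    have h1 := ih _ _ _ hs
    have h2 := ih' _ _ _ ht
    simp
    omega


/-! ## Sums over the decompositions of a multiset in two parts -/

section Split

variable {α β γ δ : Type*}

/-- The sum of `F x y` over all the ways of writing `u` as `x + y`. -/
def split (u : Multiset α) (F : Multiset α → Multiset α → Multiset β) : Multiset β :=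
  u.antidiagonal.bind fun p => F p.1 p.2

theorem mem_split {u : Multiset α} {F : Multiset α → Multiset α → Multiset β} {b : β} :
    b ∈ split u F ↔ ∃ x y, x + y = u ∧ b ∈ F x y := by
  simp [split]

theorem split_congr {u : Multiset α} {F G : Multiset α → Multiset α → Multiset β}
    (h : ∀ x y, x + y = u → F x y = G x y) : split u F = split u G :=
  Multiset.bind_congr fun _ hp => h _ _ (Multiset.mem_antidiagonal.1 hp)

theorem split_zero (F : Multiset α → Multiset α → Multiset β) : split 0 F = F 0 0 := by
  simp [split]

theorem split_cons (a : α) (u : Multiset α) (F : Multiset α → Multiset α → Multiset β) :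
    split (a ::ₘ u) F = split u (fun x y => F x (a ::ₘ y)) + split u fun x y => F (a ::ₘ x) y := by
  simp [split, Multiset.bind_map]

theorem split_map (f : α → β) (u : Multiset α) (F : Multiset β → Multiset β → Multiset γ) :
    split (u.map f) F = split u fun x y => F (x.map f) (y.map f) := by
  induction u using Multiset.induction_on generalizing F with
  | empty => simp [split_zero]
  | cons a u ih => simp [split_cons, ih]

theorem split_eq_zero {u : Multiset α} {F : Multiset α → Multiset α → Multiset β}
    (h : ∀ x y, x + y = u → F x y = 0) : split u F = 0 := by
  rw [split_congr h]
  simp [split]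

theorem split_left_comm (u : Multiset α) (F : Multiset α → Multiset α → Multiset α → Multiset β) :
    split u (fun x v => split v fun y z => F x y z) =
      split u fun x v => split v fun y z => F y x z :=
  antidiagonal_bind_left_comm u F

theorem split_add (u : Multiset α) (F G : Multiset α → Multiset α → Multiset β) :
    (split u fun x y => F x y + G x y) = split u F + split u G :=
  Multiset.bind_add _ _ _

theorem split_comm (u : Multiset α) (F : Multiset α → Multiset α → Multiset β) :
    split u F = split u fun x y => F y x := by
  induction u using Multiset.induction_on generalizing F with
  | empty => simp [split_zero]
  | cons a u ih => rw [split_cons, split_cons, add_comm, ih, ih fun x y => F x (a ::ₘ y)]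

theorem split_assoc (u : Multiset α) (F : Multiset α → Multiset α → Multiset α → Multiset β) :
    split u (fun v z => split v fun x y => F x y z) =
      split u fun x v => split v fun y z => F x y z := by
  induction u using Multiset.induction_on generalizing F with
  | empty => simp [split_zero]
  | cons a u ih => simp only [split_cons, ih, split_add, add_assoc]

theorem split_exchange (u : Multiset α)
    (F : Multiset α → Multiset α → Multiset α → Multiset α → Multiset β) :
    split u (fun v w => split v fun x y => split w fun z t => F x y z t) =
      split u fun v w => split v fun x y => split w fun z t => F x z y t := by
  rw [split_assoc u fun x y w => split w fun z t => F x y z t,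
    split_assoc u fun x y w => split w fun z t => F x z y t]
  exact split_congr fun x v _ => split_left_comm v fun y z t => F x y z t

/-- Meant for a second component that cannot absorb anything, typically because the substituted
variable does not occur in it. -/
theorem split_eq_left {u : Multiset α} {F : Multiset α → Multiset α → Multiset β}
    (h : ∀ x y, y.card ≠ 0 → F x y = 0) : split u F = F u 0 := by
  induction u using Multiset.induction_on generalizing F with
  | empty => exact split_zero F
  | cons a u ih =>
    rw [split_cons, split_eq_zero fun x y _ => h _ _ (by simp), zero_add,
      ih fun x y hy => h _ _ hy]

theorem split_eq_right {u : Multiset α} {F : Multiset α → Multiset α → Multiset β}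
    (h : ∀ x y, x.card ≠ 0 → F x y = 0) : split u F = F 0 u := by
  rw [split_comm]
  exact split_eq_left fun x y hy => h y x hy

theorem split_bind (u : Multiset α) (F : Multiset α → Multiset α → Multiset β)
    (G : β → Multiset γ) : (split u F).bind G = split u fun x y => (F x y).bind G :=
  Multiset.bind_assoc

theorem map_split (u : Multiset α) (F : Multiset α → Multiset α → Multiset β)
    (g : β → γ) : (split u F).map g = split u fun x y => (F x y).map g :=
  Multiset.map_bind _ _ _

theorem bind_split (m : Multiset γ) (u : Multiset α)
    (F : γ → Multiset α → Multiset α → Multiset β) :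
    (m.bind fun c => split u (F c)) = split u fun x y => m.bind fun c => F c x y :=
  Multiset.bind_bind _ _

theorem split_split_comm (t : Multiset α) (u : Multiset γ)
    (F : Multiset α → Multiset α → Multiset γ → Multiset γ → Multiset β) :
    (split t fun x y => split u (F x y)) = split u fun z w => split t fun x y => F x y z w :=
  Multiset.bind_bind _ _

theorem bind_singleton_self (m : Multiset α) : (m.bind fun a => {a}) = m := by
  simpa using Multiset.bind_singleton m id

/-- The extension of a binary operation to finite sums, by bilinearity. -/
def bilin (f : α → β → γ) (A : Multiset α) (B : Multiset β) : Multiset γ :=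
  A.bind fun a => B.map (f a)

theorem mem_bilin {f : α → β → γ} {A : Multiset α} {B : Multiset β} {c : γ} :
    c ∈ bilin f A B ↔ ∃ a ∈ A, ∃ b ∈ B, f a b = c := by
  simp [bilin]

theorem bilin_bind {α' β' : Type*} (f : α → β → γ) (A : Multiset α') (g : α' → Multiset α)
    (B : Multiset β') (h : β' → Multiset β) :
    bilin f (A.bind g) (B.bind h) = A.bind fun a => B.bind fun b => bilin f (g a) (h b) := by
  simp only [bilin, Multiset.bind_assoc, Multiset.map_bind]
  refine Multiset.bind_congr fun a _ => ?_
  rw [Multiset.bind_bind]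

theorem bilin_split {α' β' : Type*} (f : α → β → γ) (u : Multiset α')
    (F : Multiset α' → Multiset α' → Multiset α) (v : Multiset β')
    (G : Multiset β' → Multiset β' → Multiset β) :
    bilin f (split u F) (split v G) =
      split u fun x y => split v fun z w => bilin f (F x y) (G z w) :=
  bilin_bind f _ _ _ _

theorem bilin_zero_left (f : α → β → γ) (B : Multiset β) : bilin f 0 B = 0 := by simp [bilin]

theorem bilin_zero_right (f : α → β → γ) (A : Multiset α) : bilin f A 0 = 0 := by simp [bilin]

theorem bilin_singleton (f : α → β → γ) (a : α) (b : β) : bilin f {a} {b} = {f a b} := by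
  simp [bilin]

theorem bind_bilin (f : α → β → γ) (A : Multiset α) (B : Multiset β) (h : γ → Multiset δ) :
    (bilin f A B).bind h = A.bind fun a => B.bind fun b => h (f a b) := by
  simp only [bilin, Multiset.bind_assoc, Multiset.bind_map]

theorem map_bilin (f : α → β → γ) (A : Multiset α) (B : Multiset β) (h : γ → δ) :
    (bilin f A B).map h = bilin (fun a b => h (f a b)) A B := by
  simp only [bilin, Multiset.map_bind, Multiset.map_map, Function.comp_def]

theorem bilin_map {α' β' : Type*} (f : α → β → γ) (A : Multiset α') (B : Multiset β')
    (g : α' → α) (h : β' → β) :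
    bilin f (A.map g) (B.map h) = bilin (fun a b => f (g a) (h b)) A B := by
  simp only [bilin, Multiset.bind_map, Multiset.map_map, Function.comp_def]

end Split

/-! ## Commutation of renamings and multilinear substitutions -/

theorem lsubst_app_eq_split (s : ResTerm) (t : ResMono) (d : ℕ) (u : Multiset ResTerm) :
    lsubst (app s t) d u = split u fun x y => bilin app (lsubst s d x) (lsubst t d y) :=
  lsubst_app s t d u

theorem lsubst_cons_eq_split (s : ResTerm) (t : ResMono) (d : ℕ) (u : Multiset ResTerm) :
    lsubst (cons s t) d u = split u fun x y => bilin cons (lsubst s d x) (lsubst t d y) :=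
  lsubst_cons s t d u

theorem lsubst_var_self (d : ℕ) (u : Multiset ResTerm) :
    lsubst (var d) d u = if u.card = 1 then u else 0 := by
  simp [lsubst_var]

theorem lsubst_var_ne {n d : ℕ} (h : n ≠ d) (u : Multiset ResTerm) :
    lsubst (var n) d u = if u.card = 0 then {if n < d then var n else var (n - 1)} else 0 := by
  simp [lsubst_var, h]

theorem shift_shift {k : Kind} (e : ResExpr k) : ∀ {c d : ℕ}, c ≤ d →
    shift (shift e d) c = shift (shift e c) (d + 1) := by
  apply induction_on (P := fun {k} e => ∀ {c d : ℕ}, c ≤ d →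
    shift (shift e d) c = shift (shift e c) (d + 1))
  · intro n c d h
    simp only [shift_var]
    split_ifs <;> simp only [shift_var] <;> split_ifs <;> first | rfl | omega
  · intro s ih c d h
    simp only [shift_lam]
    rw [ih (by omega)]
  · intro s t ih ih' c d h
    simp only [shift_app, ih h, ih' h]
  · intros; rfl
  · intro s t ih ih' c d h
    simp only [shift_cons, ih h, ih' h]

/-- After the shift, `c` has no occurrence, so only the empty multiset can be substituted, and the
decrement performed by the substitution undoes the shift. -/
theorem lsubst_shift_self {k : Kind} (e : ResExpr k) : ∀ (c : ℕ) (u : Multiset ResTerm),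
    lsubst (shift e c) c u = if u.card = 0 then {e} else 0 := by
  have bin : ∀ {k l j : Kind} (f : ResExpr k → ResExpr l → ResExpr j) (s : ResExpr k)
      (t : ResExpr l) (u : Multiset ResTerm),
      (split u fun x y => bilin f (if x.card = 0 then {s} else 0) (if y.card = 0 then {t} else 0)) =
        if u.card = 0 then {f s t} else 0 := by
    intro k l j f s t u
    rw [split_eq_right fun x y hx => by rw [if_neg hx, bilin_zero_left]]
    simp only [Multiset.card_zero, if_true]
    split_ifs <;> simp [bilin]
  apply induction_on (P := fun {k} e => ∀ (c : ℕ) (u : Multiset ResTerm),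
    lsubst (shift e c) c u = if u.card = 0 then {e} else 0)
  · intro n c u
    rw [shift_var]
    by_cases h : n < c
    · rw [if_pos h, lsubst_var_ne h.ne, if_pos h]
    · rw [if_neg h, lsubst_var_ne (show n + 1 ≠ c by omega), if_neg (show ¬ n + 1 < c by omega),
        Nat.add_sub_cancel]
  · intro s ih c u
    rw [shift_lam, lsubst_lam, ih]
    simp only [Multiset.card_map]
    split_ifs <;> simp
  · intro s t ih ih' c u
    rw [shift_app, lsubst_app_eq_split]
    simp only [ih, ih', bin]
  · intro c u
    exact lsubst_nil c u
  · intro s t ih ih' c u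
    rw [shift_cons, lsubst_cons_eq_split]
    simp only [ih, ih', bin]

/-- The fresh variable lies below the substituted one, whose index becomes `d + 1`. With `c = 0`,
this is what crossing an abstraction requires in the substitution lemma. -/
theorem map_shift_lsubst {k : Kind} (e : ResExpr k) : ∀ {c d : ℕ} (_ : c ≤ d)
    (u : Multiset ResTerm), (lsubst e d u).map (shift · c) =
      lsubst (shift e c) (d + 1) (u.map (shift · c)) := by
  apply induction_on (P := fun {k} e => ∀ {c d : ℕ} (_ : c ≤ d) (u : Multiset ResTerm),
    (lsubst e d u).map (shift · c) = lsubst (shift e c) (d + 1) (u.map (shift · c)))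
  · intro n c d h u
    rcases eq_or_ne n d with rfl | hn
    · rw [lsubst_var_self, shift_var, if_neg h.not_gt, lsubst_var_self]
      simp only [Multiset.card_map]
      split_ifs <;> simp
    · have : shift (var n) c = var (if n < c then n else n + 1) := by
        rw [shift_var]; split_ifs <;> rfl
      rw [lsubst_var_ne hn, this, lsubst_var_ne (by split_ifs <;> omega)]
      simp only [Multiset.card_map]
      by_cases hu : u.card = 0
      · simp only [hu, if_true, Multiset.map_singleton, Multiset.singleton_inj]
        split_ifs <;> simp only [shift_var] <;> split_ifs <;> first | omega | (congr 1; omega) | rfl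
      · simp [hu]
  · intro s ih c d h u
    have := ih (c := c + 1) (d := d + 1) (by omega) (u.map fun s => s.shift 0)
    rw [lsubst_lam, shift_lam, lsubst_lam, Multiset.map_map, Multiset.map_map]
    simp only [Multiset.map_map, Function.comp_def, shift_lam] at this ⊢
    simp only [fun s : ResTerm => shift_shift s (Nat.zero_le c), ← this, Multiset.map_map,
      Function.comp_def]
  · intro s t ih ih' c d h u
    rw [shift_app, lsubst_app_eq_split, lsubst_app_eq_split, split_map, map_split]
    refine split_congr fun x y _ => ?_
    rw [← ih h, ← ih' h, map_bilin, bilin_map]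
    simp
  · intro c d h u
    simp only [lsubst_nil, shift_nil, Multiset.card_map]
    split_ifs <;> simp
  · intro s t ih ih' c d h u
    rw [shift_cons, lsubst_cons_eq_split, lsubst_cons_eq_split, split_map, map_split]
    refine split_congr fun x y _ => ?_
    rw [← ih h, ← ih' h, map_bilin, bilin_map]
    simp

/-! ## The substitution lemma -/

/-- Multilinear substitution in a monomial, seen as a multiset. -/
def msubst (t : Multiset ResTerm) (d : ℕ) (u : Multiset ResTerm) : Multiset (Multiset ResTerm) :=
  (lsubst (ofMultiset t) d u).map elems

theorem msubst_zero (d : ℕ) (u : Multiset ResTerm) :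
    msubst 0 d u = if u.card = 0 then {0} else 0 := by
  rw [msubst, ofMultiset_zero, lsubst_nil]
  split_ifs <;> simp

theorem msubst_cons (a : ResTerm) (t : Multiset ResTerm) (d : ℕ) (u : Multiset ResTerm) :
    msubst (a ::ₘ t) d u = split u fun x y => bilin (· ::ₘ ·) (lsubst a d x) (msubst t d y) := by
  rw [msubst, ofMultiset_cons, lsubst_cons_eq_split, map_split]
  refine split_congr fun x y _ => ?_
  rw [map_bilin, msubst, ← Multiset.map_id' (lsubst a d x), bilin_map]
  simp

theorem card_of_mem_msubst {t : Multiset ResTerm} {d : ℕ} {u t' : Multiset ResTerm}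
    (h : t' ∈ msubst t d u) : t'.card = t.card := by
  induction t using Multiset.induction_on generalizing u t' with
  | empty =>
    rw [msubst_zero] at h
    split_ifs at h <;> simp_all
  | cons a t ih =>
    rw [msubst_cons, mem_split] at h
    obtain ⟨x, y, -, h⟩ := h
    obtain ⟨b, -, t'', ht, rfl⟩ := mem_bilin.1 h
    simp [ih ht]

/-- Substitution preserves the number of elements of a monomial, so the cardinality tests on `t'`
hidden in `lsubst` become tests on `t`. -/
theorem bind_msubst_congr {β : Type*} {t : Multiset ResTerm} {d : ℕ} {u : Multiset ResTerm}
    {F G : Multiset ResTerm → Multiset β} (h : ∀ t', t'.card = t.card → F t' = G t') :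
    (msubst t d u).bind F = (msubst t d u).bind G :=
  Multiset.bind_congr fun _ ht' => h _ (card_of_mem_msubst ht')

theorem msubst_map_shift (t : Multiset ResTerm) {c d : ℕ} (h : c ≤ d) (u : Multiset ResTerm) :
    msubst (t.map (shift · c)) (d + 1) (u.map (shift · c)) =
      (msubst t d u).map (Multiset.map (shift · c)) := by
  rw [msubst, msubst, show ofMultiset (t.map (shift · c)) = shift (ofMultiset t) c from
    elems_injective (by rw [elems_ofMultiset, elems_shift, elems_ofMultiset]),
    ← map_shift_lsubst _ h, Multiset.map_map, Multiset.map_map]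
  simp only [Function.comp_def, elems_shift]

/-- Decompositions of the results of a substitution in a monomial. -/
theorem msubst_bind_split {β : Type*} (t : Multiset ResTerm) (d : ℕ) (u : Multiset ResTerm)
    (G : Multiset ResTerm → Multiset ResTerm → Multiset β) :
    ((msubst t d u).bind fun t' => split t' G) = split t fun t₁ t₂ => split u fun u₁ u₂ =>
      (msubst t₁ d u₁).bind fun t₁' => (msubst t₂ d u₂).bind fun t₂' => G t₁' t₂' := by
  induction t using Multiset.induction_on generalizing u G with
  | empty =>
    rw [split_zero, split_eq_right fun x y hx => by rw [msubst_zero, if_neg hx, Multiset.zero_bind]]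
    simp only [msubst_zero]
    simp only [Multiset.card_zero, if_true]
    split_ifs <;> simp [split_zero]
  | cons a t ih =>
    simp only [split_cons, msubst_cons, split_bind, bind_bilin, Multiset.bind_add, split_add]
    congr 1
    · simp only [ih, bind_split]
      rw [split_split_comm u t]
      refine split_congr fun t₁ t₂ _ => ?_
      rw [split_left_comm u fun x y z => (lsubst a d x).bind fun b => (msubst t₁ d y).bind fun t₁' =>
        (msubst t₂ d z).bind fun t₂' => G t₁' (b ::ₘ t₂')]
      refine split_congr fun x v _ => split_congr fun y z _ => ?_
      rw [Multiset.bind_bind]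
    · simp only [ih, bind_split]
      rw [split_split_comm u t]
      refine split_congr fun t₁ t₂ _ => ?_
      rw [split_assoc u fun x y z => (lsubst a d x).bind fun b => (msubst t₁ d y).bind fun t₁' =>
        (msubst t₂ d z).bind fun t₂' => G (b ::ₘ t₁') t₂']

/-- Substituting in a binary constructor applied to sums. -/
theorem bilin_bind_lsubst {k l j : Kind} {f : ResExpr k → ResExpr l → ResExpr j}
    (hf : ∀ s t d u, lsubst (f s t) d u =
      split u fun x y => bilin f (lsubst s d x) (lsubst t d y))
    (A : Multiset (ResExpr k)) (B : Multiset (ResExpr l)) (d : ℕ) (u : Multiset ResTerm) :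
    ((bilin f A B).bind fun e => lsubst e d u) = split u fun x y =>
      bilin f (A.bind fun s => lsubst s d x) (B.bind fun t => lsubst t d y) := by
  simp only [bind_bilin, hf, bilin_bind, bind_split]

/-- The inductive step common to application and `cons`. Both sides distribute `t` and `u` over the
two components; on the right, `u` is first shared between `e` and `t`, and `split_exchange` swaps
these two ways of cutting `u`. -/
theorem lsubst_lsubst_bin {k l j : Kind} {f : ResExpr k → ResExpr l → ResExpr j}
    (hf : ∀ s t d u, lsubst (f s t) d u =
      split u fun x y => bilin f (lsubst s d x) (lsubst t d y))
    {a : ResExpr k} {b : ResExpr l} {c d : ℕ}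
    (ha : ∀ t u : Multiset ResTerm, ((lsubst a c t).bind fun e => lsubst e d u) =
      split u fun x y => (lsubst a (d + 1) (x.map (shift · c))).bind fun e =>
        (msubst t d y).bind fun t' => lsubst e c t')
    (hb : ∀ t u : Multiset ResTerm, ((lsubst b c t).bind fun e => lsubst e d u) =
      split u fun x y => (lsubst b (d + 1) (x.map (shift · c))).bind fun e =>
        (msubst t d y).bind fun t' => lsubst e c t')
    (t u : Multiset ResTerm) :
    ((lsubst (f a b) c t).bind fun e => lsubst e d u) =
      split u fun x y => (lsubst (f a b) (d + 1) (x.map (shift · c))).bind fun e =>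
        (msubst t d y).bind fun t' => lsubst e c t' := by
  simp only [hf, split_bind, bilin_bind_lsubst hf, ha, hb, bilin_split, split_map, bind_bilin,
    msubst_bind_split, bind_split]
  rw [split_congr fun t₁ t₂ _ => split_exchange u fun p q z w => bilin f
    ((lsubst a (d + 1) (p.map (shift · c))).bind fun e => (msubst t₁ d q).bind fun t' =>
      lsubst e c t')
    ((lsubst b (d + 1) (z.map (shift · c))).bind fun e => (msubst t₂ d w).bind fun t' =>
      lsubst e c t'), split_split_comm t u]
  refine split_congr fun x y _ => ?_
  rw [split_split_comm t x]
  refine split_congr fun p q _ => split_congr fun t₁ t₂ _ => split_congr fun z w _ => ?_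
  simp only [bilin_bind]

/-- The substitution lemma for multilinear substitutions. -/
theorem lsubst_lsubst {k : Kind} (e : ResExpr k) : ∀ {c d : ℕ} (_ : c ≤ d)
    (t u : Multiset ResTerm), ((lsubst e c t).bind fun e => lsubst e d u) =
      split u fun x y => (lsubst e (d + 1) (x.map (shift · c))).bind fun e =>
        (msubst t d y).bind fun t' => lsubst e c t' := by
  apply induction_on (P := fun {k} e => ∀ {c d : ℕ} (_ : c ≤ d)
    (t u : Multiset ResTerm), ((lsubst e c t).bind fun e => lsubst e d u) =
      split u fun x y => (lsubst e (d + 1) (x.map (shift · c))).bind fun e =>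
        (msubst t d y).bind fun t' => lsubst e c t')
  · intro n c d h t u
    rcases eq_or_ne n c with rfl | hc
    -- The variable replaced first: `d + 1` does not occur, so all of `u` goes into `t`.
    · rw [split_eq_right fun x y hx => by
        rw [lsubst_var_ne (show n ≠ d + 1 by omega), if_neg (by simpa using hx),
          Multiset.zero_bind],
        lsubst_var_ne (show n ≠ d + 1 by omega), Multiset.map_zero, if_pos Multiset.card_zero,
        Multiset.singleton_bind, if_pos (show n < d + 1 by omega), lsubst_var_self,
        bind_msubst_congr (G := fun t' => if t.card = 1 then t' else 0) fun t' ht' => by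
          rw [lsubst_var_self, ht']]
      split_ifs with ht
      · obtain ⟨a, rfl⟩ := Multiset.card_eq_one.1 ht
        rw [← Multiset.cons_zero, msubst_cons, split_eq_left fun x y hy => by
          rw [msubst_zero, if_neg hy, bilin_zero_right], msubst_zero, if_pos Multiset.card_zero,
          bind_bilin]
        simp [bind_singleton_self]
      · simp
    · rw [lsubst_var_ne hc]
      rcases eq_or_ne n (d + 1) with rfl | hd
      -- The variable replaced second: an element of `u` takes its place. Being shifted at `c`, it
      -- has no occurrence of `c`, which forces `t` and `y` to be empty.
      · simp only [lsubst_var_self, Multiset.card_map]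
        rw [if_neg (show ¬ d + 1 < c by omega), Nat.add_sub_cancel]
        have key : ∀ x y : Multiset ResTerm, ((if x.card = 1 then x.map (shift · c) else 0).bind
            fun e => (msubst t d y).bind fun t' => lsubst e c t') =
            if t.card = 0 ∧ y.card = 0 then (if x.card = 1 then x else 0) else 0 := by
          intro x y
          rw [Multiset.bind_congr (g := fun e => (msubst t d y).bind fun t' =>
            if t.card = 0 then lsubst e c t' else 0)]
          · by_cases ht : t.card = 0
            · obtain rfl := Multiset.card_eq_zero.1 ht
              rw [msubst_zero]
              by_cases hy : y.card = 0
              · split_ifs <;> simp_all [Multiset.bind_map, lsubst_shift_self, bind_singleton_self]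
              · simp [hy]
            · simp [ht]
          · intro e he
            refine Multiset.bind_congr fun t' ht' => ?_
            by_cases ht : t.card = 0
            · rw [if_pos ht]
            · split_ifs at he
              · obtain ⟨a, ha, rfl⟩ := Multiset.mem_map.1 he
                rw [lsubst_shift_self, card_of_mem_msubst ht', if_neg ht, if_neg ht]
              · simp at he
        simp only [key]
        rw [split_eq_left fun x y hy => by rw [if_neg (by tauto)]]
        split_ifs <;> simp_all [lsubst_var_self]
      -- A variable that neither substitution touches: both `t` and `u` must be empty, and only the
      -- decrements remain to be compared.
      · rw [split_eq_right fun x y hx => by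
          rw [lsubst_var_ne hd, if_neg (by simpa using hx), Multiset.zero_bind],
          lsubst_var_ne hd, Multiset.map_zero, if_pos Multiset.card_zero, Multiset.singleton_bind]
        have e₁ : ∀ m : ℕ, (if n < m then var n else var (n - 1)) =
          var (if n < m then n else n - 1) := fun m => by split_ifs <;> rfl
        rw [e₁, e₁]
        rw [bind_msubst_congr (G := fun _ => if t.card = 0 then
          {var (if n < c then (if n < d + 1 then n else n - 1) else
            (if n < d + 1 then n else n - 1) - 1)} else 0) fun t' ht' => by
          rw [lsubst_var_ne (by split_ifs <;> omega), ht']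
          congr 2
          split_ifs <;> first | rfl | omega]
        by_cases ht : t.card = 0
        · obtain rfl := Multiset.card_eq_zero.1 ht
          rw [msubst_zero, if_pos ht, Multiset.singleton_bind,
            lsubst_var_ne (show (if n < c then n else n - 1) ≠ d by split_ifs <;> omega)]
          by_cases hu : u.card = 0
          · simp only [hu, ht, if_true, Multiset.singleton_bind, Multiset.singleton_inj]
            split_ifs <;> first | rfl | omega
          · simp [hu]
        · simp [ht]
  · intro s ih c d h t u
    have := ih (c := c + 1) (d := d + 1) (by omega) (t.map (shift · 0)) (u.map (shift · 0))
    simp only [split_map, msubst_map_shift t (Nat.zero_le d)] at this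
    simp only [lsubst_lam, Multiset.bind_map, Multiset.map_map, Function.comp_def] at this ⊢
    simp only [← Multiset.map_bind, this, map_split, fun s : ResTerm => shift_shift s (Nat.zero_le c)]
  · intro a b ha hb c d h t u
    exact lsubst_lsubst_bin lsubst_app_eq_split (ha h) (hb h) t u
  · intro c d h t u
    simp only [lsubst_nil, Multiset.card_map]
    rw [split_eq_right fun x y hx => by rw [if_neg hx, Multiset.zero_bind],
      if_pos Multiset.card_zero, Multiset.singleton_bind,
      bind_msubst_congr (G := fun _ => if t.card = 0 then {nil} else 0) fun t' ht' => by
        rw [lsubst_nil, ht']]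
    split_ifs with ht
    · obtain rfl := Multiset.card_eq_zero.1 ht
      rw [msubst_zero, Multiset.singleton_bind, lsubst_nil]
      split_ifs <;> simp
    · simp
  · intro a b ha hb c d h t u
    exact lsubst_lsubst_bin lsubst_cons_eq_split (ha h) (hb h) t u


/-! ## Bounded reduction of finite sums -/

theorem red_term_cases {e : ResTerm} {ε : Multiset ResTerm} (h : Red e ε) :
    (∃ s t, e = app (lam s) t ∧ ε = lsubst s 0 (elems t)) ∨
    (∃ s σ, Red s σ ∧ e = lam s ∧ ε = σ.map lam) ∨
    (∃ s σ t, Red s σ ∧ e = app s t ∧ ε = σ.map fun s' => app s' t) ∨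
    ∃ s t τ, Red t τ ∧ e = app s t ∧ ε = τ.map fun t' => app s t' := by
  cases h with
  | beta s t => exact .inl ⟨s, t, rfl, rfl⟩
  | lam h => exact .inr (.inl ⟨_, _, h, rfl, rfl⟩)
  | app_left t h => exact .inr (.inr (.inl ⟨_, _, _, h, rfl, rfl⟩))
  | app_right s h => exact .inr (.inr (.inr ⟨_, _, _, h, rfl, rfl⟩))

theorem red_mono_cases {e : ResMono} {ε : Multiset ResMono} (h : Red e ε) :
    ∃ s σ t, Red s σ ∧ e = cons s t ∧ ε = σ.map fun s' => cons s' t := by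
  cases h with
  | cons t h => exact ⟨_, _, _, h, rfl, rfl⟩

theorem red_lam_cases {s : ResTerm} {ε : Multiset ResTerm} (h : Red (lam s) ε) :
    ∃ σ, Red s σ ∧ ε = σ.map lam := by
  obtain ⟨s, t, h, -⟩ | ⟨s', σ, h, h', rfl⟩ | ⟨s, σ, t, -, h, -⟩ | ⟨s, t, τ, -, h, -⟩ :=
    red_term_cases h
  · simp at h
  · obtain rfl := lam_inj.1 h'
    exact ⟨σ, h, rfl⟩
  · simp at h
  · simp at h

theorem red_app_cases {s : ResTerm} {t : ResMono} {ε : Multiset ResTerm} (hr : Red (app s t) ε) :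
    (∃ s', s = lam s' ∧ ε = lsubst s' 0 (elems t)) ∨
    (∃ σ, Red s σ ∧ ε = σ.map fun s' => app s' t) ∨
    ∃ τ, Red t τ ∧ ε = τ.map fun t' => app s t' := by
  obtain ⟨s, t, h, rfl⟩ | ⟨s', σ, -, h, -⟩ | ⟨s, σ, t, h', h, rfl⟩ | ⟨s, t, τ, h', h, rfl⟩ :=
    red_term_cases hr
  · obtain ⟨rfl, rfl⟩ := app_inj.1 h
    exact .inl ⟨_, rfl, rfl⟩
  · simp at h
  · obtain ⟨rfl, rfl⟩ := app_inj.1 h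
    exact .inr (.inl ⟨_, h', rfl⟩)
  · obtain ⟨rfl, rfl⟩ := app_inj.1 h
    exact .inr (.inr ⟨_, h', rfl⟩)

theorem Red.cons_right (s : ResTerm) {t : ResMono} {τ : Multiset ResMono} (hr : Red t τ) :
    Red (ResExpr.cons s t) (τ.map (ResExpr.cons s)) := by
  obtain ⟨a, α, t, h, rfl, rfl⟩ := red_mono_cases hr
  rw [cons_swap, Multiset.map_map]
  simpa only [Function.comp_def, cons_swap s] using Red.cons (ResExpr.cons s t) h

theorem Red.size_lt {k : Kind} {e : ResExpr k} {ε : Multiset (ResExpr k)} (h : Red e ε) :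
    ∀ e' ∈ ε, size e' < size e := by
  induction h with
  | beta s t =>
    intro e' he
    have := size_of_mem_lsubst _ _ _ _ he
    rw [← size_eq_sum] at this
    simp
    omega
  | lam _ ih | app_left _ _ ih | app_right _ _ ih | cons _ _ ih =>
    intro e' he
    obtain ⟨a, ha, rfl⟩ := Multiset.mem_map.1 he
    have := ih a ha
    simp
    omega

/-- `MRed n ε ε'`: the sum `ε` reduces to `ε'` in any number of steps, reducing only
expressions of size less than `n`. -/
inductive MRed (n : ℕ) {k : Kind} : Multiset (ResExpr k) → Multiset (ResExpr k) → Prop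
  | refl (ε : Multiset (ResExpr k)) : MRed n ε ε
  | trans {ε ε' ε'' : Multiset (ResExpr k)} : MRed n ε ε' → MRed n ε' ε'' → MRed n ε ε''
  | add {ε ε' δ δ' : Multiset (ResExpr k)} : MRed n ε ε' → MRed n δ δ' →
      MRed n (ε + δ) (ε' + δ')
  | base {e : ResExpr k} {ε : Multiset (ResExpr k)} : Red e ε → size e < n → MRed n {e} ε

namespace MRed

variable {k l j : Kind} {n m : ℕ}

theorem bind {α : Type*} {ε : Multiset α} {f g : α → Multiset (ResExpr k)}
    (h : ∀ a ∈ ε, MRed n (f a) (g a)) : MRed n (ε.bind f) (ε.bind g) := by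
  induction ε using Multiset.induction_on with
  | empty => exact .refl _
  | cons a ε ih =>
    rw [Multiset.cons_bind, Multiset.cons_bind]
    exact .add (h a (Multiset.mem_cons_self a ε)) (ih fun b hb => h b (Multiset.mem_cons_of_mem hb))

theorem split {α : Type*} {u : Multiset α} {F G : Multiset α → Multiset α → Multiset (ResExpr k)}
    (h : ∀ x y, x + y = u → MRed n (F x y) (G x y)) : MRed n (split u F) (split u G) :=
  bind fun _ hp => h _ _ (Multiset.mem_antidiagonal.1 hp)

theorem map {f : ResExpr k → ResExpr l} (hf : ∀ e ε, Red e ε → Red (f e) (ε.map f))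
    (hs : ∀ e, size e < n → size (f e) < m) {ε ε' : Multiset (ResExpr k)} (h : MRed n ε ε') :
    MRed m (ε.map f) (ε'.map f) := by
  induction h with
  | refl => exact .refl _
  | trans _ _ ih ih' => exact ih.trans ih'
  | add _ _ ih ih' =>
    rw [Multiset.map_add, Multiset.map_add]
    exact ih.add ih'
  | base h h' => exact .base (hf _ _ h) (hs _ h')

theorem mono (h : n ≤ m) {ε ε' : Multiset (ResExpr k)} (hε : MRed n ε ε') : MRed m ε ε' := by
  simpa using hε.map (f := id) (fun e ε h => by simpa using h) fun e he => he.trans_le h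

theorem bilin_left {f : ResExpr k → ResExpr l → ResExpr j}
    (hf : ∀ e ε b, Red e ε → Red (f e b) (ε.map (f · b))) {A A' : Multiset (ResExpr k)}
    {B : Multiset (ResExpr l)} (hs : ∀ a, ∀ b ∈ B, size a < n → size (f a b) < m)
    (h : MRed n A A') : MRed m (bilin f A B) (bilin f A' B) := by
  have e : ∀ A, bilin f A B = B.bind fun b => A.map (f · b) := fun A => by
    simp only [bilin, ← Multiset.bind_singleton]
    exact Multiset.bind_bind _ _
  rw [e, e]
  exact bind fun b hb => h.map (fun e ε => hf e ε b) fun a => hs a b hb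

theorem bilin_right {f : ResExpr k → ResExpr l → ResExpr j}
    (hf : ∀ e ε a, Red e ε → Red (f a e) (ε.map (f a))) {A : Multiset (ResExpr k)}
    {B B' : Multiset (ResExpr l)} (hs : ∀ a ∈ A, ∀ b, size b < n → size (f a b) < m)
    (h : MRed n B B') : MRed m (bilin f A B) (bilin f A B') :=
  bind fun a ha => h.map (fun e ε => hf e ε a) fun b => hs a ha b

end MRed

/-! ## Reduction and substitution -/

/-- Companion of `map_shift_lsubst` for a fresh variable that is not below the substituted one. With
`d = 0`, it makes β-steps stable under renaming. -/
theorem map_shift_lsubst_of_le {k : Kind} (e : ResExpr k) : ∀ {c d : ℕ} (_ : d ≤ c)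
    (u : Multiset ResTerm), (lsubst e d u).map (shift · c) =
      lsubst (shift e (c + 1)) d (u.map (shift · c)) := by
  apply induction_on (P := fun {k} e => ∀ {c d : ℕ} (_ : d ≤ c) (u : Multiset ResTerm),
    (lsubst e d u).map (shift · c) = lsubst (shift e (c + 1)) d (u.map (shift · c)))
  · intro n c d h u
    rcases eq_or_ne n d with rfl | hn
    · rw [lsubst_var_self, shift_var, if_pos (show n < c + 1 by omega), lsubst_var_self]
      simp only [Multiset.card_map]
      split_ifs <;> simp
    · have : shift (var n) (c + 1) = var (if n < c + 1 then n else n + 1) := by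
        rw [shift_var]; split_ifs <;> rfl
      rw [lsubst_var_ne hn, this, lsubst_var_ne (by split_ifs <;> omega)]
      simp only [Multiset.card_map]
      by_cases hu : u.card = 0
      · simp only [hu, if_true, Multiset.map_singleton, Multiset.singleton_inj]
        split_ifs <;> simp only [shift_var] <;> split_ifs <;> first | omega | (congr 1; omega) | rfl
      · simp [hu]
  · intro s ih c d h u
    have := ih (c := c + 1) (d := d + 1) (by omega) (u.map fun s => s.shift 0)
    rw [lsubst_lam, shift_lam, lsubst_lam, Multiset.map_map, Multiset.map_map]
    simp only [Multiset.map_map, Function.comp_def, shift_lam] at this ⊢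
    simp only [fun s : ResTerm => shift_shift s (Nat.zero_le c), ← this, Multiset.map_map,
      Function.comp_def]
  · intro s t ih ih' c d h u
    rw [shift_app, lsubst_app_eq_split, lsubst_app_eq_split, split_map, map_split]
    refine split_congr fun x y _ => ?_
    rw [← ih h, ← ih' h, map_bilin, bilin_map]
    simp
  · intro c d h u
    simp only [lsubst_nil, shift_nil, Multiset.card_map]
    split_ifs <;> simp
  · intro s t ih ih' c d h u
    rw [shift_cons, lsubst_cons_eq_split, lsubst_cons_eq_split, split_map, map_split]
    refine split_congr fun x y _ => ?_
    rw [← ih h, ← ih' h, map_bilin, bilin_map]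
    simp

theorem Red.shift {k : Kind} {e : ResExpr k} {ε : Multiset (ResExpr k)} (h : Red e ε) (c : ℕ) :
    Red (e.shift c) (ε.map fun e => e.shift c) := by
  induction h generalizing c with
  | beta s t =>
    rw [map_shift_lsubst_of_le s (Nat.zero_le c), ← elems_shift, shift_app, shift_lam]
    exact .beta _ _
  | lam _ ih =>
    have := (ih (c + 1)).lam
    rw [Multiset.map_map] at this ⊢
    simpa only [Function.comp_def, shift_lam] using this
  | app_left t _ ih =>
    have := (ih c).app_left (t.shift c)
    rw [Multiset.map_map] at this ⊢
    simpa only [Function.comp_def, shift_app] using this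
  | app_right s _ ih =>
    have := (ih c).app_right (s.shift c)
    rw [Multiset.map_map] at this ⊢
    simpa only [Function.comp_def, shift_app] using this
  | cons t _ ih =>
    have := (ih c).cons (t.shift c)
    rw [Multiset.map_map] at this ⊢
    simpa only [Function.comp_def, shift_cons] using this

theorem sum_size_shift (u : Multiset ResTerm) (c : ℕ) :
    ((u.map fun s => s.shift c).map size).sum = (u.map size).sum := by
  rw [Multiset.map_map]
  simp only [Function.comp_def, size_shift]

theorem size_le_of_mem_lsubst {k : Kind} {e e' : ResExpr k} {d : ℕ} {u : Multiset ResTerm}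
    (h : e' ∈ lsubst e d u) : size e' ≤ size e + (u.map size).sum :=
  (Nat.le_add_right _ _).trans (size_of_mem_lsubst e d u e' h).le

/-- Reducing the expression in which one substitutes. -/
theorem Red.lsubst_left {k : Kind} {e : ResExpr k} {ε : Multiset (ResExpr k)} (h : Red e ε) :
    ∀ (d : ℕ) (u : Multiset ResTerm) (n : ℕ), size e + (u.map size).sum < n →
      MRed n (lsubst e d u) (ε.bind fun e => lsubst e d u) := by
  induction h with
  | beta s t =>
    intro d u n hn
    -- By the substitution lemma both sides are sums over the same splittings of `u`, and each redex
    -- produced on the left has its contractum on the right.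
    rw [lsubst_app_eq_split, lsubst_lsubst s (Nat.zero_le d)]
    refine MRed.split fun x y hxy => ?_
    subst hxy
    simp only [lsubst_lam, ofMultiset_elems, Multiset.bind_map, msubst, bilin]
    refine MRed.bind fun s' hs => ?_
    rw [← Multiset.bind_singleton]
    refine MRed.bind fun t' ht => .base (.beta _ _) ?_
    have h1 := size_le_of_mem_lsubst hs
    have h2 := size_le_of_mem_lsubst ht
    rw [sum_size_shift] at h1
    simp at hn ⊢
    omega
  | lam _ ih =>
    intro d u n hn
    simp only [lsubst_lam, Multiset.bind_map, ← Multiset.map_bind]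
    refine (ih (d + 1) (u.map fun s => s.shift 0) (n - 1) ?_).map (fun _ _ => .lam) ?_
    · rw [sum_size_shift]
      rw [size_lam] at hn
      omega
    · intro e he
      rw [size_lam]
      omega
  | @app_left s σ t _ ih =>
    intro d u n hn
    simp only [lsubst_app_eq_split, Multiset.bind_map, bind_split]
    refine MRed.split fun x y hxy => ?_
    subst hxy
    rw [show (σ.bind fun s => bilin app (lsubst s d x) (lsubst t d y)) =
      bilin app (σ.bind fun s => lsubst s d x) (lsubst t d y) by simp [bilin, Multiset.bind_assoc]]
    refine (ih d x _ (Nat.lt_succ_self _)).bilin_left (fun e ε b => .app_left b) ?_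
    intro a b hb ha
    have := size_le_of_mem_lsubst hb
    simp at hn ⊢
    omega
  | @app_right s t τ _ ih =>
    intro d u n hn
    simp only [lsubst_app_eq_split, Multiset.bind_map, bind_split]
    refine MRed.split fun x y hxy => ?_
    subst hxy
    rw [show (τ.bind fun t => bilin app (lsubst s d x) (lsubst t d y)) =
      bilin app (lsubst s d x) (τ.bind fun t => lsubst t d y) by
        simp only [bilin, Multiset.map_bind]
        exact Multiset.bind_bind _ _]
    refine (ih d y _ (Nat.lt_succ_self _)).bilin_right (fun e ε b => .app_right b) ?_
    intro a ha b hb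
    have := size_le_of_mem_lsubst ha
    simp at hn ⊢
    omega
  | @cons s σ t _ ih =>
    intro d u n hn
    simp only [lsubst_cons_eq_split, Multiset.bind_map, bind_split]
    refine MRed.split fun x y hxy => ?_
    subst hxy
    rw [show (σ.bind fun s => bilin ResExpr.cons (lsubst s d x) (lsubst t d y)) =
      bilin ResExpr.cons (σ.bind fun s => lsubst s d x) (lsubst t d y) by
        simp [bilin, Multiset.bind_assoc]]
    refine (ih d x _ (Nat.lt_succ_self _)).bilin_left (fun e ε b => .cons b) ?_
    intro a b hb ha
    have := size_le_of_mem_lsubst hb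
    simp at hn ⊢
    omega

theorem bilin_bind_left {α α' β γ : Type*} (f : α → β → γ) (A : Multiset α')
    (g : α' → Multiset α) (B : Multiset β) :
    bilin f (A.bind g) B = A.bind fun a => bilin f (g a) B := by
  simp [bilin, Multiset.bind_assoc]

theorem bilin_bind_right {α β β' γ : Type*} (f : α → β → γ) (A : Multiset α)
    (B : Multiset β') (g : β' → Multiset β) :
    bilin f A (B.bind g) = B.bind fun b => bilin f A (g b) := by
  simp only [bilin, Multiset.map_bind]
  exact Multiset.bind_bind _ _

/-- By multilinearity, `a` goes into exactly one of the two components, and only that component is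
reduced. The number `i` is the cost of the constructor: one for application, zero for `cons`. -/
theorem mred_lsubst_cons_bin {k l j : Kind} {f : ResExpr k → ResExpr l → ResExpr j}
    (hf : ∀ s t d u, lsubst (f s t) d u =
      split u fun x y => bilin f (lsubst s d x) (lsubst t d y))
    (hl : ∀ e ε b, Red e ε → Red (f e b) (ε.map (f · b)))
    (hr : ∀ e ε a, Red e ε → Red (f a e) (ε.map (f a)))
    {i : ℕ} (hs : ∀ a b, size (f a b) = size a + size b + i) {s : ResExpr k} {t : ResExpr l}
    {d : ℕ} {a : ResTerm} {α : Multiset ResTerm}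
    (ihs : ∀ (u : Multiset ResTerm) (n : ℕ), size s + size a + (u.map size).sum < n →
      MRed n (lsubst s d (a ::ₘ u)) (α.bind fun a' => lsubst s d (a' ::ₘ u)))
    (iht : ∀ (u : Multiset ResTerm) (n : ℕ), size t + size a + (u.map size).sum < n →
      MRed n (lsubst t d (a ::ₘ u)) (α.bind fun a' => lsubst t d (a' ::ₘ u)))
    (u : Multiset ResTerm) (n : ℕ) (hn : size (f s t) + size a + (u.map size).sum < n) :
    MRed n (lsubst (f s t) d (a ::ₘ u)) (α.bind fun a' => lsubst (f s t) d (a' ::ₘ u)) := by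
  simp only [hf, split_cons, Multiset.bind_add, bind_split, ← bilin_bind_left, ← bilin_bind_right]
  refine .add (MRed.split fun x y hxy => ?_) (MRed.split fun x y hxy => ?_) <;> subst hxy
  · refine (iht y _ (Nat.lt_succ_self _)).bilin_right hr ?_
    intro b hb c hc
    have := size_le_of_mem_lsubst hb
    rw [hs] at hn ⊢
    simp at hn
    omega
  · refine (ihs x _ (Nat.lt_succ_self _)).bilin_left hl ?_
    intro b c hc hb
    have := size_le_of_mem_lsubst hc
    rw [hs] at hn ⊢
    simp at hn
    omega

/-- Reducing one of the substituted terms. -/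
theorem mred_lsubst_cons {k : Kind} (e : ResExpr k) : ∀ (d : ℕ) {a : ResTerm}
    {α : Multiset ResTerm} (_ : Red a α) (u : Multiset ResTerm) (n : ℕ),
    size e + size a + (u.map size).sum < n →
      MRed n (lsubst e d (a ::ₘ u)) (α.bind fun a' => lsubst e d (a' ::ₘ u)) := by
  apply induction_on (P := fun {k} e => ∀ (d : ℕ) {a : ResTerm}
    {α : Multiset ResTerm} (_ : Red a α) (u : Multiset ResTerm) (n : ℕ),
    size e + size a + (u.map size).sum < n →
      MRed n (lsubst e d (a ::ₘ u)) (α.bind fun a' => lsubst e d (a' ::ₘ u)))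
  · intro i d a α h u n hn
    rcases eq_or_ne i d with rfl | hi
    · simp only [lsubst_var_self, Multiset.card_cons]
      by_cases hu : u = 0
      · subst hu
        simp only [Multiset.card_zero, if_true, Multiset.cons_zero, bind_singleton_self, zero_add]
        exact .base h (by omega)
      · simp [hu, MRed.refl]
    · simp [lsubst_var_ne hi, MRed.refl]
  · intro s ih d a α h u n hn
    simp only [lsubst_lam, Multiset.map_cons, ← Multiset.map_bind]
    have := ih (d + 1) (h.shift 0) (u.map fun s => s.shift 0) (n - 1) (by
      rw [sum_size_shift, size_shift]
      rw [size_lam] at hn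
      omega)
    rw [Multiset.bind_map] at this
    refine this.map (fun _ _ => .lam) ?_
    intro e he
    rw [size_lam]
    omega
  · intro s t ih ih' d a α h u n hn
    exact mred_lsubst_cons_bin lsubst_app_eq_split (fun e ε b => .app_left b) (fun e ε b => .app_right b)
      size_app (ih d h) (ih' d h) u n hn
  · intro d a α h u n hn
    simp [lsubst_nil, MRed.refl]
  · intro s t ih ih' d a α h u n hn
    exact mred_lsubst_cons_bin lsubst_cons_eq_split (fun e ε b => .cons b) (fun e ε b => .cons_right b)
      (i := 0) size_cons (ih d h) (ih' d h) u n hn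

/-! ## Local confluence -/

/-- Joinability by reductions of expressions of size less than `n`. -/
def Joinable (n : ℕ) {k : Kind} (ε δ : Multiset (ResExpr k)) : Prop :=
  ∃ η, MRed n ε η ∧ MRed n δ η

theorem Joinable.symm {n : ℕ} {k : Kind} {ε δ : Multiset (ResExpr k)} (h : Joinable n ε δ) :
    Joinable n δ ε :=
  let ⟨η, h, h'⟩ := h
  ⟨η, h', h⟩

theorem Joinable.map {k l : Kind} {n m : ℕ} {f : ResExpr k → ResExpr l}
    (hf : ∀ e ε, Red e ε → Red (f e) (ε.map f)) (hs : ∀ e, size e < n → size (f e) < m)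
    {ε ε' : Multiset (ResExpr k)} (h : Joinable n ε ε') : Joinable m (ε.map f) (ε'.map f) :=
  let ⟨_, h, h'⟩ := h
  ⟨_, h.map hf hs, h'.map hf hs⟩

/-- The common reduct substitutes `t` in every element of `σ`: one side reduces after substituting,
the other fires the β-redex that survives in each summand. -/
theorem joinable_beta_left {s : ResTerm} {t : ResMono} {σ : Multiset ResTerm} (h : Red s σ) :
    Joinable (size (app (lam s) t)) (lsubst s 0 (elems t)) (σ.map fun s' => app (lam s') t) := by
  refine ⟨_, h.lsubst_left 0 _ _ ?_, ?_⟩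
  · rw [← size_eq_sum, size_app, size_lam]
    omega
  · rw [← Multiset.bind_singleton]
    refine MRed.bind fun s' hs => .base (.beta _ _) ?_
    have := h.size_lt s' hs
    simp
    omega

theorem joinable_beta_right {s : ResTerm} {t : ResMono} {τ : Multiset ResMono} (hr : Red t τ) :
    Joinable (size (app (lam s) t)) (lsubst s 0 (elems t)) (τ.map fun t' => app (lam s) t') := by
  obtain ⟨a, α, t, h, rfl, rfl⟩ := red_mono_cases hr
  refine ⟨_, by
    rw [elems_cons]
    refine mred_lsubst_cons s 0 h _ _ ?_
    rw [← size_eq_sum]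
    simp
    omega, ?_⟩
  rw [Multiset.map_map, ← Multiset.bind_singleton]
  refine MRed.bind fun a' ha => .base ?_ ?_
  · simpa only [elems_cons, Function.comp_apply] using Red.beta s (cons a' t)
  · have := h.size_lt a' ha
    simp
    omega

/-- Reductions in disjoint positions commute, meeting in `bilin f σ τ`. Every step used starts from
a summand in which one component has already shrunk, hence the size bound. -/
theorem joinable_bin {k l j : Kind} {f : ResExpr k → ResExpr l → ResExpr j}
    (hl : ∀ e ε b, Red e ε → Red (f e b) (ε.map (f · b)))
    (hr : ∀ e ε a, Red e ε → Red (f a e) (ε.map (f a)))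
    {i : ℕ} (hs : ∀ a b, size (f a b) = size a + size b + i) {s : ResExpr k} {t : ResExpr l}
    {σ : Multiset (ResExpr k)} {τ : Multiset (ResExpr l)} (h : Red s σ) (h' : Red t τ) :
    Joinable (size (f s t)) (σ.map (f · t)) (τ.map (f s)) := by
  refine ⟨bilin f σ τ, ?_, ?_⟩
  · rw [← Multiset.bind_singleton]
    refine MRed.bind fun a ha => .base (hr _ _ _ h') ?_
    have := h.size_lt a ha
    simp only [hs]
    omega
  · rw [bilin, ← Multiset.bind_singleton]
    simp only [← Multiset.bind_singleton]
    rw [Multiset.bind_bind]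
    refine MRed.bind fun b hb => .base ?_ ?_
    · rw [Multiset.bind_singleton]
      exact hl _ _ _ h
    · have := h'.size_lt b hb
      simp only [hs]
      omega

/-- Local confluence, with the extra information that closing the diagram reduces only expressions
strictly smaller than `e`; this is what the uniqueness of normal forms needs. -/
theorem Red.joinable {k : Kind} {e : ResExpr k} {ε : Multiset (ResExpr k)} (h : Red e ε) :
    ∀ {δ : Multiset (ResExpr k)}, Red e δ → Joinable (size e) ε δ := by
  induction h with
  | beta s t =>
    intro δ hr
    obtain ⟨s', hs, rfl⟩ | ⟨σ, h, rfl⟩ | ⟨τ, h, rfl⟩ := red_app_cases hr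
    · obtain rfl := lam_inj.1 hs
      exact ⟨_, .refl _, .refl _⟩
    · obtain ⟨σ, h', rfl⟩ := red_lam_cases h
      rw [Multiset.map_map]
      exact joinable_beta_left h'
    · exact joinable_beta_right h
  | lam h ih =>
    intro δ hr
    obtain ⟨σ, h', rfl⟩ := red_lam_cases hr
    exact (ih h').map (fun _ _ => .lam) fun e he => by simpa using he
  | @app_left s σ t h ih =>
    intro δ hr
    obtain ⟨s', rfl, rfl⟩ | ⟨σ', h', rfl⟩ | ⟨τ, h', rfl⟩ := red_app_cases hr
    · obtain ⟨σ, h', rfl⟩ := red_lam_cases h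
      rw [Multiset.map_map]
      exact (joinable_beta_left h').symm
    · exact (ih h').map (fun _ _ => .app_left t) fun e he => by simpa using he
    · exact joinable_bin (fun e ε b => .app_left b) (fun e ε b => .app_right b) size_app h h'
  | @app_right s t τ h ih =>
    intro δ hr
    obtain ⟨s', rfl, rfl⟩ | ⟨σ', h', rfl⟩ | ⟨τ, h', rfl⟩ := red_app_cases hr
    · exact (joinable_beta_right h).symm
    · exact (joinable_bin (fun e ε b => .app_left b) (fun e ε b => .app_right b) size_app h' h).symm
    · exact (ih h').map (fun _ _ => .app_right s) fun e he => by simpa using he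
  | @cons s σ t h ih =>
    intro δ hr
    obtain ⟨s', σ', t', h', he, rfl⟩ := red_mono_cases hr
    have := congrArg elems he
    -- A monomial has no first element: either both reductions select equal elements, and induction
    -- applies, or they select different ones and are independent.
    rw [elems_cons, elems_cons, Multiset.cons_eq_cons] at this
    obtain ⟨rfl, ht⟩ | ⟨-, r, ht, ht'⟩ := this
    · obtain rfl := elems_injective ht
      exact (ih h').map (fun _ _ => .cons t) fun e he => by simpa using he
    · obtain rfl : t = ResExpr.cons s' (ofMultiset r) := elems_injective (by simpa using ht)
      obtain rfl : t' = ResExpr.cons s (ofMultiset r) := elems_injective (by simpa using ht')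
      have := joinable_bin (fun e ε b => Red.cons b) (fun e ε b => Red.cons_right b) (i := 0)
        size_cons h (h'.cons (ofMultiset r))
      simpa only [Multiset.map_map, Function.comp_def, cons_swap s] using this

/-! ## Normal forms -/

/-- A normal form of an expression, obtained by some maximal sequence of reductions. -/
noncomputable def nform {k : Kind} (e : ResExpr k) : Multiset (ResExpr k) :=
  open Classical in
  if h : ∃ ε, Red e ε then h.choose.attach.bind fun a => nform a.1 else {e}
termination_by size e
decreasing_by exact h.choose_spec.size_lt _ a.2

theorem nform_of_isNormal {k : Kind} {e : ResExpr k} (h : IsNormal e) : nform e = {e} := by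
  rw [nform, dif_neg]
  rintro ⟨ε, hε⟩
  exact h ε hε

theorem exists_red_nform {k : Kind} {e : ResExpr k} (h : ¬ IsNormal e) :
    ∃ ε, Red e ε ∧ nform e = ε.bind nform := by
  have h' : ∃ ε, Red e ε := by simpa [IsNormal] using h
  refine ⟨h'.choose, h'.choose_spec, ?_⟩
  rw [nform, dif_pos h']
  conv_rhs => rw [← Multiset.attach_map_val h'.choose, Multiset.bind_map]

theorem MRed.bind_nform {k : Kind} {n : ℕ}
    (hn : ∀ (e : ResExpr k) (ε : Multiset (ResExpr k)), size e < n → Red e ε →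
      nform e = ε.bind nform) {ε ε' : Multiset (ResExpr k)} (h : MRed n ε ε') :
    ε.bind nform = ε'.bind nform := by
  induction h with
  | refl => rfl
  | trans _ _ ih ih' => exact ih.trans ih'
  | add _ _ ih ih' => rw [Multiset.add_bind, Multiset.add_bind, ih, ih']
  | base h h' => rw [Multiset.singleton_bind, hn _ _ h' h]

/-- Newman's argument, by strong induction on size: `ε` and the reduct chosen by `nform` are joined
by reductions of expressions smaller than `e`, along which normal forms are invariant by the
induction hypothesis. -/
theorem Red.nform_eq {k : Kind} {e : ResExpr k} {ε : Multiset (ResExpr k)} (h : Red e ε) :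
    nform e = ε.bind nform := by
  induction hn : size e using Nat.strong_induction_on generalizing e ε with
  | _ n ih =>
    subst hn
    obtain ⟨δ, hδ, he⟩ := exists_red_nform fun hn : IsNormal e => hn ε h
    obtain ⟨η, h1, h2⟩ := h.joinable hδ
    have key : ∀ (e' : ResExpr k) (ε : Multiset (ResExpr k)), size e' < size e → Red e' ε →
        nform e' = ε.bind nform := fun e' ε h h' => ih _ h h' rfl
    rw [he, h1.bind_nform key, h2.bind_nform key]

theorem MRed.bind_nform_eq {k : Kind} {n : ℕ} {ε ε' : Multiset (ResExpr k)} (h : MRed n ε ε') :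
    ε.bind nform = ε'.bind nform :=
  h.bind_nform fun _ _ _ h => h.nform_eq

theorem isNormal_of_mem_nform {k : Kind} {e e' : ResExpr k} (h : e' ∈ nform e) : IsNormal e' := by
  induction hn : size e using Nat.strong_induction_on generalizing e with
  | _ n ih =>
    subst hn
    by_cases he : IsNormal e
    · rw [nform_of_isNormal he, Multiset.mem_singleton] at h
      rwa [h]
    · obtain ⟨ε, hε, h'⟩ := exists_red_nform he
      obtain ⟨a, ha, h⟩ := Multiset.mem_bind.1 (h' ▸ h)
      exact ih _ (hε.size_lt a ha) h rfl

theorem mred_nform {k : Kind} (e : ResExpr k) : MRed (size e + 1) {e} (nform e) := by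
  induction hn : size e using Nat.strong_induction_on generalizing e with
  | _ n ih =>
    subst hn
    by_cases he : IsNormal e
    · rw [nform_of_isNormal he]
      exact .refl _
    · obtain ⟨ε, hε, h'⟩ := exists_red_nform he
      rw [h']
      refine (MRed.base hε (Nat.lt_succ_self _)).trans ?_
      conv_lhs => rw [← bind_singleton_self ε]
      refine MRed.bind fun a ha => ?_
      have := hε.size_lt a ha
      exact (ih _ this a rfl).mono (by omega)

theorem bind_nform_of_isNormal {k : Kind} {ε : Multiset (ResExpr k)} (h : ∀ e ∈ ε, IsNormal e) :
    ε.bind nform = ε := by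
  rw [Multiset.bind_congr fun e he => nform_of_isNormal (h e he), bind_singleton_self]

theorem SumRed.add_right {k : Kind} {ε ε' : Multiset (ResExpr k)} (h : SumRed ε ε')
    (δ : Multiset (ResExpr k)) : SumRed (ε + δ) (ε' + δ) := by
  obtain ⟨e, η, P, h, hP, rfl, rfl⟩ := h
  -- The summands of `δ` are all kept, none is reduced.
  refine ⟨e, η, P + δ.map fun a => (a, {a}), h, ?_, ?_, ?_⟩
  · intro p hp
    rcases Multiset.mem_add.1 hp with hp | hp
    · exact hP p hp
    · obtain ⟨a, -, rfl⟩ := Multiset.mem_map.1 hp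
      exact .inl rfl
  · simp
  · simp [add_assoc, Multiset.map_map, Multiset.sum_map_singleton]

theorem MRed.reflTransGen {k : Kind} {n : ℕ} {ε ε' : Multiset (ResExpr k)} (h : MRed n ε ε') :
    Relation.ReflTransGen SumRed ε ε' := by
  induction h with
  | refl => exact .refl
  | trans _ _ ih ih' => exact ih.trans ih'
  | @add ε ε' δ δ' _ _ ih ih' =>
    refine (ih.lift (· + δ) fun _ _ h => h.add_right δ).trans ?_
    refine ih'.lift (ε' + ·) fun a b h => ?_
    simpa only [add_comm ε'] using h.add_right ε'
  | @base e ε h _ => exact .single ⟨e, ε, 0, h, by simp, by simp, by simp⟩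

theorem SumRed.bind_nform {k : Kind} {ε ε' : Multiset (ResExpr k)} (h : SumRed ε ε') :
    ε.bind nform = ε'.bind nform := by
  obtain ⟨e, η, P, h, hP, rfl, rfl⟩ := h
  rw [Multiset.cons_bind, Multiset.add_bind, h.nform_eq]
  congr 1
  induction P using Multiset.induction_on with
  | empty => simp
  | cons p P ih =>
    simp only [Multiset.map_cons, Multiset.sum_cons, Multiset.cons_bind, Multiset.add_bind]
    rw [ih fun q hq => hP q (Multiset.mem_cons_of_mem hq)]
    rcases hP p (Multiset.mem_cons_self p P) with hp | hp
    · rw [hp, Multiset.singleton_bind]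
    · rw [hp.nform_eq]

/-- The normal sum picked by `nf` is arbitrary, but `bind nform` is invariant along `SumRed` and is
the identity on normal sums, so there is only one candidate. -/
theorem nf_singleton {k : Kind} (e : ResExpr k) : nf {e} = nform e := by
  have h : ∃ ν, Relation.ReflTransGen SumRed {e} ν ∧ ∀ e' ∈ ν, IsNormal e' :=
    ⟨nform e, (mred_nform e).reflTransGen, fun _ => isNormal_of_mem_nform⟩
  rw [nf, dif_pos h]
  obtain ⟨h1, h2⟩ := h.choose_spec
  have : Multiset.bind {e} nform = h.choose.bind nform := by
    generalize h.choose = ν at h1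
    induction h1 with
    | refl => rfl
    | tail _ h ih => exact ih.trans h.bind_nform
  rw [← bind_nform_of_isNormal h2, ← this, Multiset.singleton_bind]

theorem Generates.trans_mred {k : Kind} {n : ℕ} {ε ε' : Multiset (ResExpr k)} (h : MRed n ε ε') :
    ∀ e' ∈ ε', ∃ e ∈ ε, Generates e e' := by
  induction h with
  | refl => exact fun e' he => ⟨e', he, .refl⟩
  | trans _ _ ih ih' =>
    intro e'' he
    obtain ⟨e', he', h'⟩ := ih' e'' he
    obtain ⟨e, he, h⟩ := ih e' he'
    exact ⟨e, he, Relation.ReflTransGen.trans h h'⟩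
  | add _ _ ih ih' =>
    intro e' he
    rcases Multiset.mem_add.1 he with he | he
    · obtain ⟨e, he, h⟩ := ih e' he
      exact ⟨e, Multiset.mem_add.2 (.inl he), h⟩
    · obtain ⟨e, he, h⟩ := ih' e' he
      exact ⟨e, Multiset.mem_add.2 (.inr he), h⟩
  | @base e ε h _ =>
    intro e' he
    exact ⟨e, Multiset.mem_singleton_self e, .single ⟨ε, h, he⟩⟩

theorem Generates.size_le {k : Kind} {e e' : ResExpr k} (h : Generates e e') :
    size e' ≤ size e := by
  induction h with
  | refl => exact le_rfl
  | tail _ h ih =>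
    obtain ⟨ε, h, h'⟩ := h
    exact (h.size_lt _ h').le.trans ih

theorem MRed.size_le {k : Kind} {n : ℕ} {e : ResExpr k} {ε : Multiset (ResExpr k)}
    (h : MRed n {e} ε) : ∀ e' ∈ ε, size e' ≤ size e := by
  intro e' he
  obtain ⟨a, ha, h⟩ := Generates.trans_mred h e' he
  rw [Multiset.mem_singleton.1 ha] at h
  exact h.size_le

theorem MRed.eq_of_isNormal {k : Kind} {n : ℕ} {ε ε' : Multiset (ResExpr k)}
    (h : MRed n ε ε') : (∀ e ∈ ε, IsNormal e) → ε' = ε := by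
  induction h with
  | refl => exact fun _ => rfl
  | trans _ _ ih ih' =>
    intro h
    have := ih h
    subst this
    exact ih' h
  | add _ _ ih ih' =>
    intro h
    rw [ih fun e he => h e (Multiset.mem_add.2 (.inl he)),
      ih' fun e he => h e (Multiset.mem_add.2 (.inr he))]
  | base h _ => exact fun h' => absurd h (h' _ (Multiset.mem_singleton_self _) _)

theorem generates_of_mem_nform {k : Kind} {e e' : ResExpr k} (h : e' ∈ nform e) :
    Generates e e' := by
  obtain ⟨a, ha, h⟩ := Generates.trans_mred (mred_nform e) e' h
  rwa [Multiset.mem_singleton.1 ha] at h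


/-! ## Parallel left reduction of resource expressions -/

theorem bilin_cons_left_comm (A B : Multiset ResTerm) (C : Multiset ResMono) :
    bilin cons A (bilin cons B C) = bilin cons B (bilin cons A C) := by
  simp only [bilin, Multiset.map_bind, Multiset.map_map, Function.comp_def]
  rw [Multiset.bind_bind]
  refine Multiset.bind_congr fun b _ => Multiset.bind_congr fun a _ => ?_
  simp only [cons_swap a b]

/-- Whether a resource term is a variable applied to some arguments (by convention, `true` for
monomials). -/
def headVar {k : Kind} (e : ResExpr k) : Bool :=
  fold (C := fun _ => Bool)
    { var := fun _ => true
      lam := fun _ => false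
      app := fun a _ => a
      nil := true
      cons := fun _ _ => true
      swap := fun _ _ _ => rfl } e

@[simp] theorem headVar_var (n : ℕ) : headVar (var n) = true := rfl

@[simp] theorem headVar_lam (s : ResTerm) : headVar (lam s) = false := by
  induction s using Quotient.inductionOn
  rfl

@[simp] theorem headVar_app (s : ResTerm) (t : ResMono) : headVar (app s t) = headVar s := by
  induction s using Quotient.inductionOn
  induction t using Quotient.inductionOn
  rfl

@[simp] theorem headVar_cons (s : ResTerm) (t : ResMono) : headVar (cons s t) = true := by
  induction s using Quotient.inductionOn
  induction t using Quotient.inductionOn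
  rfl

@[simp] theorem headVar_nil : headVar nil = true := rfl

/-- The left reduct of an application, from its components and their left reducts. -/
def leftApp (s : ResTerm) (σ : Multiset ResTerm) (t : ResMono) (τ : Multiset ResMono) :
    Multiset ResTerm :=
  match view s with
  | .lam s => lsubst s 0 (elems t)
  -- Arguments are reduced only under a head variable; otherwise the head redex lies in `s`.
  | _ => bilin app σ (if headVar s then τ else {t})

/-- The data computing `left`. -/
def leftData : FoldData fun k => ResExpr k × Multiset (ResExpr k) where
  var n := (var n, {var n})
  lam a := (lam a.1, a.2.map lam)
  app a b := (app a.1 b.1, leftApp a.1 a.2 b.1 b.2)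
  nil := (nil, {nil})
  cons a b := (cons a.1 b.1, bilin cons a.2 b.2)
  swap _ _ _ := Prod.ext (cons_swap _ _ _) (bilin_cons_left_comm _ _ _)

theorem fold_leftData_fst {k : Kind} (e : ResExpr k) : (fold leftData e).1 = e := by
  induction e using Quotient.inductionOn with
  | h a =>
    induction a with
    | var n => rfl
    | nil => rfl
    | lam a ih => exact congrArg lam ih
    | app a b ih ih' => exact congrArg₂ app ih ih'
    | cons a b ih ih' => exact congrArg₂ cons ih ih'

/-- The parallel left reduct of a resource expression. -/
def left {k : Kind} (e : ResExpr k) : Multiset (ResExpr k) := (fold leftData e).2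

@[simp] theorem left_var (n : ℕ) : left (var n) = {var n} := rfl

@[simp] theorem left_nil : left nil = {nil} := rfl

theorem left_lam (s : ResTerm) : left (lam s) = (left s).map lam := by
  induction s using Quotient.inductionOn
  rfl

theorem left_cons (s : ResTerm) (t : ResMono) :
    left (cons s t) = bilin cons (left s) (left t) := by
  induction s using Quotient.inductionOn
  induction t using Quotient.inductionOn
  rfl

theorem left_app (s : ResTerm) (t : ResMono) :
    left (app s t) = leftApp s (left s) t (left t) := by
  conv_rhs => rw [← fold_leftData_fst s, ← fold_leftData_fst t]
  rw [fold_leftData_fst s, fold_leftData_fst t]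
  have h : left (app s t) =
      leftApp (fold leftData s).1 (left s) (fold leftData t).1 (left t) := by
    induction s using Quotient.inductionOn
    induction t using Quotient.inductionOn
    rfl
  rw [h, fold_leftData_fst, fold_leftData_fst]

theorem left_beta (s : ResTerm) (t : ResMono) : left (app (lam s) t) = lsubst s 0 (elems t) := by
  rw [left_app, leftApp, view_lam]

theorem left_app_of_ne_lam {s : ResTerm} (h : ∀ s', s ≠ lam s') (t : ResMono) :
    left (app s t) = bilin app (left s) (if headVar s then left t else {t}) := by
  obtain ⟨n, rfl⟩ | ⟨s, rfl⟩ | ⟨s, u, rfl⟩ := term_cases s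
  · rw [left_app, leftApp, view_var]
  · exact absurd rfl (h s)
  · rw [left_app, leftApp, view_app]

theorem ne_lam_of_headVar {s : ResTerm} (h : headVar s = true) (s' : ResTerm) : s ≠ lam s' := by
  rintro rfl
  simp at h

/-! ### Normal expressions -/

theorem isNormal_var (n : ℕ) : IsNormal (var n) := by
  intro ε h
  obtain ⟨s, t, h, -⟩ | ⟨s, σ, -, h, -⟩ | ⟨s, σ, t, -, h, -⟩ | ⟨s, t, τ, -, h, -⟩ :=
    red_term_cases h <;> simp at h

theorem isNormal_nil : IsNormal nil := by
  intro ε h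
  obtain ⟨s, σ, t, -, h, -⟩ := red_mono_cases h
  simpa using congrArg elems h

theorem IsNormal.lam {s : ResTerm} (h : IsNormal s) : IsNormal (lam s) := by
  intro ε hr
  obtain ⟨σ, hr, -⟩ := red_lam_cases hr
  exact h σ hr

theorem IsNormal.app {s : ResTerm} {t : ResMono} (hs : ∀ s', s ≠ ResExpr.lam s') (h : IsNormal s)
    (h' : IsNormal t) : IsNormal (app s t) := by
  intro ε hr
  obtain ⟨s', rfl, -⟩ | ⟨σ, hr, -⟩ | ⟨τ, hr, -⟩ := red_app_cases hr
  · exact hs s' rfl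
  · exact h _ hr
  · exact h' _ hr

theorem IsNormal.cons {s : ResTerm} {t : ResMono} (h : IsNormal s) (h' : IsNormal t) :
    IsNormal (cons s t) := by
  intro ε hr
  obtain ⟨s', σ', t', hr', he, rfl⟩ := red_mono_cases hr
  have := congrArg elems he
  rw [elems_cons, elems_cons, Multiset.cons_eq_cons] at this
  obtain ⟨rfl, -⟩ | ⟨-, r, ht, -⟩ := this
  · exact h _ hr'
  · obtain rfl : t = ResExpr.cons s' (ofMultiset r) := elems_injective (by simpa using ht)
    exact h' _ (hr'.cons _)

/-! ### Left reduction normalizes -/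

/-- A parallel left step is a sequence of ordinary steps, the function being reduced before the
argument. The bound must allow `e` itself to be reduced, hence the `+ 1`. -/
theorem mred_left {k : Kind} (e : ResExpr k) : MRed (size e + 1) {e} (left e) := by
  apply induction_on (P := fun {k} e => MRed (size e + 1) {e} (left e))
  · intro n
    exact .refl _
  · intro s ih
    rw [left_lam, ← Multiset.map_singleton]
    exact ih.map (fun _ _ => .lam) fun e he => by simpa using he
  · intro s t ih ih'
    by_cases hs : ∃ s', s = lam s'
    · obtain ⟨s', rfl⟩ := hs
      rw [left_beta]
      exact .base (.beta _ _) (Nat.lt_succ_self _)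
    · push Not at hs
      rw [left_app_of_ne_lam hs, ← bilin_singleton]
      refine (ih.bilin_left (fun e ε b => .app_left b) (m := size (app s t) + 1) ?_).trans ?_
      · intro a b hb ha
        obtain rfl := Multiset.mem_singleton.1 hb
        simp
        omega
      · split_ifs
        · refine ih'.bilin_right (fun e ε b => .app_right b) ?_
          intro a ha b hb
          have := ih.size_le a ha
          simp
          omega
        · exact .refl _
  · exact .refl _
  · intro s t ih ih'
    rw [left_cons, ← bilin_singleton]
    refine (ih.bilin_left (fun e ε b => .cons b) (m := size (cons s t) + 1) ?_).trans ?_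
    · intro a b hb ha
      obtain rfl := Multiset.mem_singleton.1 hb
      simp
      omega
    · refine ih'.bilin_right (fun e ε b => .cons_right b) ?_
      intro a ha b hb
      have := ih.size_le a ha
      simp
      omega

/-- The second half strengthens the induction: when the head is not a variable the argument is left
untouched, so the decrease must come from the function, which is not an abstraction and so contains
the head redex. Heterogeneous equality is there because `e` ranges over both kinds. -/
theorem left_eq_or_size_lt {k : Kind} (e : ResExpr k) :
    ((left e = {e} ∧ IsNormal e) ∨ ∀ e' ∈ left e, size e' < size e) ∧
      (headVar e = false → (∃ s, lam s ≍ e) ∨ ∀ e' ∈ left e, size e' < size e) := by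
  apply induction_on (P := fun {k} e =>
    ((left e = {e} ∧ IsNormal e) ∨ ∀ e' ∈ left e, size e' < size e) ∧
      (headVar e = false → (∃ s, lam s ≍ e) ∨ ∀ e' ∈ left e, size e' < size e))
  · intro n
    exact ⟨.inl ⟨rfl, isNormal_var n⟩, by simp⟩
  · intro s ih
    refine ⟨?_, fun _ => .inl ⟨s, .rfl⟩⟩
    rw [left_lam]
    refine ih.1.imp (fun h => ⟨by simp [h.1], h.2.lam⟩) fun h e' he => ?_
    obtain ⟨a, ha, rfl⟩ := Multiset.mem_map.1 he
    simpa using h a ha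
  · rintro s t ⟨ih, ihs⟩ ⟨ih', -⟩
    by_cases hs : ∃ s', s = lam s'
    · obtain ⟨s', rfl⟩ := hs
      have : ∀ e' ∈ left (app (lam s') t), size e' < size (app (lam s') t) := by
        rw [left_beta]
        exact (Red.beta s' t).size_lt
      exact ⟨.inr this, fun _ => .inr this⟩
    · push Not at hs
      rw [left_app_of_ne_lam hs]
      cases hv : headVar s with
      | true =>
        refine ⟨?_, by simp [hv]⟩
        rw [if_pos rfl]
        obtain ⟨h, hn⟩ | h := ih
        · obtain ⟨h', hn'⟩ | h' := ih'
          · exact .inl ⟨by rw [h, h', bilin_singleton], hn.app hs hn'⟩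
          · right
            intro e' he
            obtain ⟨a, ha, b, hb, rfl⟩ := mem_bilin.1 he
            have := h' b hb
            obtain rfl : a = s := by simpa [h] using ha
            simpa using this
        · right
          intro e' he
          obtain ⟨a, ha, b, hb, rfl⟩ := mem_bilin.1 he
          have h1 := h a ha
          have h2 : size b ≤ size t := by
            obtain ⟨h', -⟩ | h' := ih'
            · rw [h', Multiset.mem_singleton] at hb
              rw [hb]
            · exact (h' b hb).le
          simp
          omega
      | false =>
        have : ∀ e' ∈ bilin app (left s) (if false = true then left t else {t}),
            size e' < size (app s t) := by
          intro e' he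
          obtain ⟨a, ha, b, hb, rfl⟩ := mem_bilin.1 he
          obtain rfl : b = t := by simpa using hb
          obtain ⟨s', h⟩ | h := ihs hv
          · exact absurd (eq_of_heq h).symm (hs s')
          · simpa using h a ha
        exact ⟨.inr this, fun _ => .inr this⟩
  · exact ⟨.inl ⟨rfl, isNormal_nil⟩, by simp⟩
  · rintro s t ⟨ih, -⟩ ⟨ih', -⟩
    refine ⟨?_, by simp⟩
    rw [left_cons]
    obtain ⟨h, hn⟩ | h := ih
    · obtain ⟨h', hn'⟩ | h' := ih'
      · exact .inl ⟨by rw [h, h', bilin_singleton], hn.cons hn'⟩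
      · right
        intro e' he
        obtain ⟨a, ha, b, hb, rfl⟩ := mem_bilin.1 he
        have := h' b hb
        obtain rfl : a = s := by simpa [h] using ha
        simpa using this
    · right
      intro e' he
      obtain ⟨a, ha, b, hb, rfl⟩ := mem_bilin.1 he
      have h1 := h a ha
      have h2 : size b ≤ size t := by
        obtain ⟨h', -⟩ | h' := ih'
        · rw [h', Multiset.mem_singleton] at hb
          rw [hb]
        · exact (h' b hb).le
      simp
      omega

/-- Iterated left reduction. -/
def leftIter {k : Kind} (e : ResExpr k) : ℕ → Multiset (ResExpr k)
  | 0 => {e}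
  | n + 1 => (leftIter e n).bind left

theorem leftIter_bind_nform {k : Kind} (e : ResExpr k) (n : ℕ) :
    (leftIter e n).bind nform = nform e := by
  induction n with
  | zero => exact Multiset.singleton_bind _ _
  | succ n ih =>
    rw [leftIter, Multiset.bind_assoc, ← ih]
    refine Multiset.bind_congr fun a _ => ?_
    rw [← (mred_left a).bind_nform_eq, Multiset.singleton_bind]

/-- Normal elements are fixed, and the others lose at least one unit of size at each step, so none
can survive beyond `size e` steps. -/
theorem isNormal_or_size_of_mem_leftIter {k : Kind} (e : ResExpr k) (n : ℕ) :
    ∀ e' ∈ leftIter e n, IsNormal e' ∨ size e' + n ≤ size e := by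
  induction n with
  | zero => simp [leftIter]
  | succ n ih =>
    intro e' he
    obtain ⟨a, ha, he⟩ := Multiset.mem_bind.1 he
    by_cases hn : IsNormal a
    · rw [(mred_left a).eq_of_isNormal (by simpa using hn), Multiset.mem_singleton] at he
      exact .inl (he ▸ hn)
    · have h := ((left_eq_or_size_lt a).1.resolve_left fun h => hn h.2) e' he
      have := (ih a ha).resolve_left hn
      right
      omega

theorem leftIter_eq_nform {k : Kind} {e : ResExpr k} {n : ℕ} (hn : size e < n) :
    leftIter e n = nform e := by
  rw [← leftIter_bind_nform e n, bind_nform_of_isNormal]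
  intro e' he
  obtain h | h := isNormal_or_size_of_mem_leftIter e n e' he
  · exact h
  · omega

theorem generates_of_mem_leftIter {k : Kind} {e e' : ResExpr k} {n : ℕ} (h : e' ∈ leftIter e n) :
    Generates e e' := by
  induction n generalizing e' with
  | zero =>
    rw [Multiset.mem_singleton.1 h]
    exact .refl
  | succ n ih =>
    obtain ⟨a, ha, h⟩ := Multiset.mem_bind.1 h
    obtain ⟨b, hb, h⟩ := Generates.trans_mred (mred_left a) e' h
    rw [Multiset.mem_singleton.1 hb] at h
    exact (ih ha).trans h

end ResExpr

namespace Vec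

open ResExpr (bilin split)

/-! ## Finitary linear maps given by kernels -/

section Push

variable {S : Type u} [CommSemiring S] {X Y Z W : Type*}

/-- Each element is produced by finitely many inputs of the kernel. -/
def Finitary (K : X → Multiset Y) : Prop := ∀ y, {x | y ∈ K x}.Finite

/-- The image `∑ₓ σₓ · K x` of a vector by the linear extension of a kernel. -/
noncomputable def push (K : X → Multiset Y) (σ : X → S) : Y → S :=
  open Classical in fun y => ∑ᶠ x, σ x * ((K x).count y : S)

theorem push_apply [DecidableEq Y] (K : X → Multiset Y) (σ : X → S) (y : Y) :
    push K σ y = ∑ᶠ x, σ x * ((K x).count y : S) := by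
  rw [push]
  congr!

/-- Any finite set containing the fibre of `y` can serve as index set, so several images can be
computed over a common one. -/
theorem push_eq_sum [DecidableEq Y] {K : X → Multiset Y} (σ : X → S) {y : Y} {F : Finset X}
    (h : ∀ x, y ∈ K x → x ∈ F) : push K σ y = ∑ x ∈ F, σ x * ((K x).count y : S) := by
  rw [push_apply]
  refine finsum_eq_sum_of_support_subset _ fun x hx => h x ?_
  by_contra hy
  exact hx (by simp [Multiset.count_eq_zero_of_notMem hy])

theorem push_eq_single [DecidableEq Y] {K : X → Multiset Y} (σ : X → S) {y : Y} (x₀ : X)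
    (h : ∀ x, y ∈ K x → x = x₀) : push K σ y = σ x₀ * ((K x₀).count y : S) := by
  rw [push_eq_sum (F := {x₀}) σ fun x hx => by simpa using h x hx, Finset.sum_singleton]

theorem push_eq_zero {K : X → Multiset Y} (σ : X → S) {y : Y} (h : ∀ x, y ∉ K x) :
    push K σ y = 0 := by
  classical
  rw [push_eq_sum (F := ∅) σ fun x hx => absurd hx (h x), Finset.sum_empty]

theorem push_congr {K K' : X → Multiset Y} {σ : X → S} (h : ∀ x, σ x ≠ 0 → K x = K' x) :
    push K σ = push K' σ := by
  funext y
  refine finsum_congr fun x => ?_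
  by_cases hx : σ x = 0
  · simp [hx]
  · rw [h x hx]

theorem push_zero (K : X → Multiset Y) : push K (0 : X → S) = 0 := by
  funext y
  simp [push]

theorem push_smul {K : X → Multiset Y} (hK : Finitary K) (a : S) (σ : X → S) :
    push K (a • σ) = a • push K σ := by
  classical
  funext y
  have h : ∀ x, y ∈ K x → x ∈ (hK y).toFinset := fun x hx => by simpa using hx
  simp only [Pi.smul_apply, smul_eq_mul]
  rw [push_eq_sum _ h, push_eq_sum _ h, Finset.mul_sum]
  simp [mul_assoc]

theorem push_add {K : X → Multiset Y} (hK : Finitary K) (σ τ : X → S) :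
    push K (σ + τ) = push K σ + push K τ := by
  classical
  funext y
  have h : ∀ x, y ∈ K x → x ∈ (hK y).toFinset := fun x hx => by simpa using hx
  rw [Pi.add_apply, push_eq_sum _ h, push_eq_sum _ h, push_eq_sum _ h, ← Finset.sum_add_distrib]
  simp [add_mul]

theorem Finitary.bind {K : X → Multiset Y} {K' : Y → Multiset Z} (hK : Finitary K)
    (hK' : Finitary K') : Finitary fun x => (K x).bind K' := by
  intro z
  refine ((hK' z).biUnion fun y _ => hK y).subset ?_
  intro x hx
  obtain ⟨y, hy, hz⟩ := Multiset.mem_bind.1 hx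
  exact Set.mem_biUnion (show y ∈ {y | z ∈ K' y} from hz) hy

/-- A finite Fubini argument: only the `y` producing `z`, and the `x` producing one of these `y`,
contribute. -/
theorem push_push {K : X → Multiset Y} {K' : Y → Multiset Z} (hK : Finitary K)
    (hK' : Finitary K') (σ : X → S) :
    push K' (push K σ) = push (fun x => (K x).bind K') σ := by
  classical
  funext z
  set G := (hK' z).toFinset with hG
  set F := G.biUnion fun y => (hK y).toFinset with hF
  have hFG : ∀ y ∈ G, ∀ x, y ∈ K x → x ∈ F := fun y hy x hx =>
    Finset.mem_biUnion.2 ⟨y, hy, by simpa using hx⟩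
  rw [push_eq_sum (F := G) _ fun y hy => by simpa [hG] using hy,
    push_eq_sum (F := F) _ fun x hx => by
      obtain ⟨y, hy, hz⟩ := Multiset.mem_bind.1 hx
      exact hFG y (by simpa [hG] using hz) x hy,
    Finset.sum_congr rfl fun y hy => by rw [push_eq_sum (F := F) σ (hFG y hy), Finset.sum_mul],
    Finset.sum_comm]
  refine Finset.sum_congr rfl fun x _ => ?_
  have key : ((K x).bind K').count z = ∑ y ∈ G, (K x).count y * (K' y).count z := by
    rw [Multiset.count_bind, Finset.sum_multiset_map_count]
    simp only [smul_eq_mul]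
    rw [← Finset.sum_subset (Finset.inter_subset_left (s₁ := (K x).toFinset) (s₂ := G)),
      ← Finset.sum_subset (Finset.inter_subset_right (s₁ := (K x).toFinset) (s₂ := G))]
    · intro y _ hy
      rw [Multiset.count_eq_zero_of_notMem fun h => hy (by simp_all), zero_mul]
    · intro y _ hy
      rw [Multiset.count_eq_zero_of_notMem (s := K' y) fun h => hy (by simp_all), mul_zero]
  rw [key, Nat.cast_sum, Finset.mul_sum]
  simp [mul_assoc]

theorem finitary_map {f : X → Y} (hf : Function.Injective f) : Finitary fun x => {f x} := by
  intro y
  refine Set.Subsingleton.finite fun a ha b hb => hf ?_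
  exact (Multiset.mem_singleton.1 ha).symm.trans (Multiset.mem_singleton.1 hb)

theorem finitary_singleton : Finitary fun x : X => {x} := finitary_map Function.injective_id

theorem push_map_apply {f : X → Y} (hf : Function.Injective f) (σ : X → S) (x : X) :
    push (fun x => {f x}) σ (f x) = σ x := by
  classical
  rw [push_eq_single σ x fun x' h => (hf (Multiset.mem_singleton.1 h)).symm]
  simp

theorem push_singleton (σ : X → S) : push (fun x => {x}) σ = σ :=
  funext fun x => push_map_apply Function.injective_id σ x

/-- The vector of products of coefficients. -/
def tensor (σ : X → S) (τ : Y → S) : X × Y → S := fun p => σ p.1 * τ p.2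

/-- The parallel composition of kernels. -/
def prodKernel (K : X → Multiset Z) (K' : Y → Multiset W) : X × Y → Multiset (Z × W) :=
  fun p => bilin Prod.mk (K p.1) (K' p.2)

theorem Finitary.prodKernel {K : X → Multiset Z} {K' : Y → Multiset W} (hK : Finitary K)
    (hK' : Finitary K') : Finitary (prodKernel K K') := by
  intro ⟨z, w⟩
  refine ((hK z).prod (hK' w)).subset ?_
  intro p hp
  obtain ⟨a, ha, b, hb, h⟩ := ResExpr.mem_bilin.1 hp
  obtain ⟨rfl, rfl⟩ := Prod.mk.inj h
  exact ⟨ha, hb⟩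

theorem count_bilin_mk [DecidableEq X] [DecidableEq Y] [DecidableEq (X × Y)] (A : Multiset X) (B : Multiset Y) (x : X) (y : Y) :
    (bilin Prod.mk A B).count (x, y) = A.count x * B.count y := by
  induction A using Multiset.induction_on with
  | empty => simp [bilin]
  | cons a A ih =>
    rw [bilin, Multiset.cons_bind, Multiset.count_add, ← bilin, ih, Multiset.count_cons]
    split_ifs with h
    · subst h
      rw [Multiset.count_map_eq_count' _ _ (Prod.mk_right_injective x), add_mul, one_mul, add_comm]
    · rw [Multiset.count_eq_zero_of_notMem (by simp [Ne.symm h]), zero_add, add_zero]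

theorem push_prodKernel {K : X → Multiset Z} {K' : Y → Multiset W} (hK : Finitary K)
    (hK' : Finitary K') (σ : X → S) (τ : Y → S) :
    push (prodKernel K K') (tensor σ τ) = tensor (push K σ) (push K' τ) := by
  classical
  funext ⟨z, w⟩
  have h : ∀ x, z ∈ K x → x ∈ (hK z).toFinset := fun x hx => by simpa using hx
  have h' : ∀ x, w ∈ K' x → x ∈ (hK' w).toFinset := fun x hx => by simpa using hx
  rw [tensor, push_eq_sum σ h, push_eq_sum τ h', Finset.sum_mul_sum, ← Finset.sum_product',
    push_eq_sum (F := (hK z).toFinset ×ˢ (hK' w).toFinset)]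
  · refine Finset.sum_congr rfl fun p _ => ?_
    rw [prodKernel, count_bilin_mk, Nat.cast_mul, tensor]
    ring
  · intro p hp
    obtain ⟨a, ha, b, hb, h''⟩ := ResExpr.mem_bilin.1 hp
    obtain ⟨rfl, rfl⟩ := Prod.mk.inj h''
    exact Finset.mem_product.2 ⟨h _ ha, h' _ hb⟩

theorem push_prodKernel_left {K : X → Multiset Z} (hK : Finitary K) (σ : X → S) (τ : Y → S) :
    tensor (push K σ) τ = push (fun p => (K p.1).map fun z => (z, p.2)) (tensor σ τ) := by
  have := push_prodKernel hK finitary_singleton σ τ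
  rw [push_singleton] at this
  rw [← this]
  congr 1
  funext p
  simp [prodKernel, bilin]

theorem Finitary.prodKernel_left {K : X → Multiset Z} (hK : Finitary K) :
    Finitary fun p : X × Y => (K p.1).map fun z => (z, p.2) := by
  have := hK.prodKernel (finitary_singleton (X := Y))
  convert this using 2 with p
  simp [Vec.prodKernel, bilin]

end Push

/-! ## Exponential vectors -/

section Exp

variable {S : Type u} [CommSemiring S] {α β : Type*}

/-- All the ways of extracting an element from a multiset. -/
noncomputable def extract (m : Multiset α) : Multiset (α × Multiset α) :=
  open Classical in m.map fun a => (a, m.erase a)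

theorem extract_zero : extract (0 : Multiset α) = 0 := rfl

theorem extract_cons (a : α) (m : Multiset α) :
    extract (a ::ₘ m) = (a, m) ::ₘ (extract m).map fun p => (p.1, a ::ₘ p.2) := by
  classical
  simp only [extract, Multiset.map_cons, Multiset.map_map, Function.comp_def]
  congr 1
  · rw [Multiset.erase_cons_head]
  · refine Multiset.map_congr rfl fun b hb => ?_
    rw [Multiset.erase_cons_tail_of_mem hb]

theorem mem_extract {m m' : Multiset α} {a : α} : (a, m') ∈ extract m ↔ m = a ::ₘ m' := by
  classical
  simp only [extract, Multiset.mem_map, Prod.mk.injEq]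
  constructor
  · rintro ⟨b, hb, rfl, rfl⟩
    exact (Multiset.cons_erase hb).symm
  · rintro rfl
    exact ⟨a, Multiset.mem_cons_self _ _, rfl, Multiset.erase_cons_head _ _⟩

theorem finitary_extract : Finitary (extract (α := α)) := by
  rintro ⟨a, m⟩
  refine (Set.finite_singleton (a ::ₘ m)).subset fun m' hm => ?_
  exact mem_extract.1 hm

theorem count_extract [DecidableEq α] [DecidableEq (α × Multiset α)] (a : α) (m : Multiset α) :
    (extract (a ::ₘ m)).count (a, m) = m.count a + 1 := by
  rw [extract, Multiset.count_map, ← Multiset.count_cons_self, ← Multiset.countP_eq_card_filter,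
    Multiset.count]
  refine Multiset.countP_congr rfl fun b _ => propext ⟨fun h => (Prod.mk.inj h).1, ?_⟩
  rintro rfl
  exact congrArg (Prod.mk a) (by convert (Multiset.erase_cons_head a m).symm)

theorem push_extract [DecidableEq α] (V : Multiset α → S) (a : α) (m : Multiset α) :
    push extract V (a, m) = V (a ::ₘ m) * ((m.count a + 1 : ℕ) : S) := by
  rw [push_eq_single V (a ::ₘ m) fun m' => mem_extract.1, count_extract]

/-- `V = ∑ₙ (1 / n!) · [σ, …, σ]` is characterized by its derivatives. -/
structure IsExp (σ : α → S) (V : Multiset α → S) : Prop where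
  zero : V 0 = 1
  push_extract : push extract V = tensor σ V

theorem IsExp.cons [DecidableEq α] {σ : α → S} {V : Multiset α → S} (h : IsExp σ V) (a : α)
    (m : Multiset α) :
    V (a ::ₘ m) * ((m.count a + 1 : ℕ) : S) = σ a * V m := by
  rw [← Vec.push_extract, h.push_extract, tensor]

theorem IsExp.of_cons [DecidableEq α] {σ : α → S} {V : Multiset α → S} (h₀ : V 0 = 1)
    (h : ∀ a m, V (a ::ₘ m) * ((m.count a + 1 : ℕ) : S) = σ a * V m) : IsExp σ V := by
  refine ⟨h₀, ?_⟩
  funext ⟨a, m⟩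
  rw [Vec.push_extract, h, tensor]

/-- The derivative determines `V (a ::ₘ m)` from `V m` up to the factor `m.count a + 1`, which is
invertible. -/
theorem IsExp.unique (hS : HasFractions S) {σ : α → S} {V V' : Multiset α → S} (h : IsExp σ V)
    (h' : IsExp σ V') : V = V' := by
  classical
  funext m
  induction m using Multiset.induction_on with
  | empty => rw [h.zero, h'.zero]
  | cons a m ih =>
    rw [← (hS (m.count a + 1) (Nat.succ_ne_zero _)).mul_left_inj, h.cons, h'.cons, ih]

/-- Extracting an element from the left part of a decomposition is extracting it from `u` and then
decomposing the rest. -/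
theorem split_bind_extract (u : Multiset α) {γ : Type*}
    (F : α → Multiset α → Multiset α → Multiset γ) :
    (split u fun x y => (extract x).bind fun p => F p.1 p.2 y) =
      (extract u).bind fun p => split p.2 fun x y => F p.1 x y := by
  induction u using Multiset.induction_on generalizing F with
  | empty => simp [ResExpr.split_zero, extract_zero]
  | cons a u ih =>
    have h1 := ih fun b x y => F b x (a ::ₘ y)
    have h2 := ih fun b x y => F b (a ::ₘ x) y
    simp only [ResExpr.split_cons, extract_cons, Multiset.cons_bind, Multiset.bind_map,
      ResExpr.split_add, Multiset.bind_add, h1, h2]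
    abel

/-- Double counting: compare the multiplicities of `(a, x, y)` on the two sides of
`split_bind_extract`. On each side a single term contributes. -/
theorem count_antidiagonal_cons [DecidableEq α] [DecidableEq (Multiset α × Multiset α)] (a : α) (x y u : Multiset α) :
    (a ::ₘ u).antidiagonal.count (a ::ₘ x, y) * (x.count a + 1) =
      (u.count a + 1) * u.antidiagonal.count (x, y) := by
  classical
  have h := congrArg (Multiset.count (a, x, y))
    (split_bind_extract (a ::ₘ u) fun b x y => {(b, x, y)})
  rw [split, Multiset.count_bind, Multiset.count_bind, Finset.sum_multiset_map_count,
    Finset.sum_multiset_map_count] at h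
  rw [Finset.sum_eq_single (a ::ₘ x, y), Finset.sum_eq_single (a, u)] at h
  · rw [count_extract, smul_eq_mul, smul_eq_mul] at h
    convert h using 2
    · rw [← count_extract a x]
      simp only
      rw [Multiset.bind_singleton]
      exact (Multiset.count_map_eq_count' (fun p : α × Multiset α => (p.1, p.2, y)) _
        (fun p q h => by simp_all [Prod.ext_iff]) (a, x)).symm
    · simp only [split]
      rw [Multiset.bind_singleton]
      exact (Multiset.count_map_eq_count' (fun p : Multiset α × Multiset α => (a, p.1, p.2)) _
        (fun p q h => by simp_all [Prod.ext_iff]) (x, y)).symm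
  · rintro ⟨b, v⟩ hb hne
    rw [Multiset.count_eq_zero_of_notMem (a := (a, x, y)), smul_eq_mul, mul_zero]
    intro hmem
    obtain ⟨x', y', -, h⟩ := ResExpr.mem_split.1 hmem
    simp only [Multiset.mem_singleton, Prod.mk.injEq] at h
    obtain ⟨rfl, -⟩ := h
    have := mem_extract.1 (Multiset.mem_toFinset.1 hb)
    exact hne (by rw [Multiset.cons_inj_right] at this; rw [this])
  · intro h
    refine absurd ?_ h
    rw [Multiset.mem_toFinset, mem_extract]
  · rintro ⟨p, q⟩ - hne
    rw [Multiset.count_eq_zero_of_notMem (a := (a, x, y)), smul_eq_mul, mul_zero]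
    intro hmem
    obtain ⟨⟨b, x'⟩, hb, h⟩ := Multiset.mem_bind.1 hmem
    simp only [Multiset.mem_singleton, Prod.mk.injEq] at h
    obtain ⟨rfl, rfl, rfl⟩ := h
    exact hne (congrArg (·, y) (mem_extract.1 hb))
  · intro h
    rw [Multiset.count_eq_zero_of_notMem (fun h' => h (Multiset.mem_toFinset.2 h')), zero_smul]

/-- Exponential vectors are group-like. -/
theorem IsExp.mul_count_antidiagonal [DecidableEq (Multiset α × Multiset α)] (hS : HasFractions S) {σ : α → S} {V : Multiset α → S}
    (h : IsExp σ V) (x y : Multiset α) :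
    V (x + y) * ((x + y).antidiagonal.count (x, y) : S) = V x * V y := by
  classical
  induction x using Multiset.induction_on with
  | empty =>
    rw [zero_add, h.zero, one_mul]
    have : y.antidiagonal.count (0, y) = 1 := by
      induction y using Multiset.induction_on with
      | empty => simp
      | cons a y ih =>
        rw [Multiset.antidiagonal_cons, Multiset.count_add]
        have h1 := Multiset.count_map_eq_count' (Prod.map id (Multiset.cons a)) y.antidiagonal
          (Function.injective_id.prodMap (fun p q h => by simpa using h)) (0, y)
        simp only [Prod.map_apply, id] at h1
        rw [h1, ih, Multiset.count_eq_zero_of_notMem (by simp)]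
    rw [this, Nat.cast_one, mul_one]
  | cons a x ih =>
    rw [← (hS (x.count a + 1) (Nat.succ_ne_zero _)).mul_left_inj, mul_assoc, ← Nat.cast_mul,
      Multiset.cons_add, count_antidiagonal_cons, Nat.cast_mul, ← mul_assoc, h.cons, mul_assoc, ih,
      mul_right_comm, h.cons, mul_assoc]

/-- Distribution of a multiset over two components. -/
def distribute {X Y : Type*} (p : (X × Y) × Multiset α) :
    Multiset ((X × Multiset α) × (Y × Multiset α)) :=
  split p.2 fun x y => {((p.1.1, x), (p.1.2, y))}

theorem mem_distribute {X Y : Type*} {p : (X × Y) × Multiset α}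
    {q : (X × Multiset α) × (Y × Multiset α)} :
    q ∈ distribute p ↔ p = ((q.1.1, q.2.1), q.1.2 + q.2.2) := by
  obtain ⟨⟨a, b⟩, u⟩ := p
  obtain ⟨⟨a', x⟩, b', y⟩ := q
  simp only [distribute, ResExpr.mem_split, Multiset.mem_singleton, Prod.mk.injEq]
  constructor
  · rintro ⟨x', y', rfl, ⟨rfl, rfl⟩, rfl, rfl⟩
    exact ⟨⟨rfl, rfl⟩, rfl⟩
  · rintro ⟨⟨rfl, rfl⟩, rfl⟩
    exact ⟨x, y, rfl, ⟨rfl, rfl⟩, rfl, rfl⟩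

theorem finitary_distribute {X Y : Type*} : Finitary (distribute (α := α) (X := X) (Y := Y)) := by
  intro q
  exact (Set.finite_singleton ((q.1.1, q.2.1), q.1.2 + q.2.2)).subset fun p => mem_distribute.1

/-- The kernel form of group-likeness: splitting one copy of `V` between two components yields two
independent copies. -/
theorem IsExp.push_distribute (hS : HasFractions S) {ν : α → S} {V : Multiset α → S}
    (h : IsExp ν V) {X Y : Type*} (σ : X → S) (τ : Y → S) :
    push distribute (tensor (tensor σ τ) V) = tensor (tensor σ V) (tensor τ V) := by
  classical
  funext ⟨⟨a, x⟩, b, y⟩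
  rw [push_eq_single _ ((a, b), x + y) fun p => mem_distribute.1]
  have : (distribute ((a, b), x + y)).count ((a, x), (b, y)) =
      (x + y).antidiagonal.count (x, y) := by
    simp only [distribute, split]
    rw [Multiset.bind_singleton]
    exact Multiset.count_map_eq_count' (fun p : Multiset α × Multiset α => ((a, p.1), (b, p.2))) _
      (fun p q h => by simp_all [Prod.ext_iff]) (x, y)
  rw [this]
  simp only [tensor]
  rw [mul_assoc, h.mul_count_antidiagonal hS]
  ring

/-- Exponential vectors are preserved by the extension of a kernel to multisets. -/
theorem IsExp.push {K : α → Multiset β} {L : Multiset α → Multiset (Multiset β)}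
    (hK : Finitary K) (hL : Finitary L) (h₀ : L 0 = {0})
    (hc : ∀ a m, L (a ::ₘ m) = bilin (· ::ₘ ·) (K a) (L m)) {σ : α → S} {V : Multiset α → S}
    (h : IsExp σ V) : IsExp (push K σ) (push L V) := by
  classical
  have hL₀ : ∀ m, 0 ∈ L m → m = 0 := by
    intro m hm
    induction m using Multiset.induction_on with
    | empty => rfl
    | cons a m _ =>
      rw [hc, ResExpr.mem_bilin] at hm
      obtain ⟨b, -, c, -, h⟩ := hm
      exact absurd h (Multiset.cons_ne_zero)
  refine ⟨?_, ?_⟩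
  · rw [push_eq_single V 0 hL₀, h.zero, h₀]
    simp
  -- Both sides become images of `V`, so the derivative equation reduces to a commutation of `L`
  -- with extraction, on each finite multiset.
  · rw [push_push hL finitary_extract, ← push_prodKernel hK hL, ← h.push_extract,
      push_push finitary_extract (hK.prodKernel hL)]
    congr 1
    funext m
    induction m using Multiset.induction_on with
    | empty => simp [h₀, extract_zero]
    | cons a m ih =>
      simp only [hc, ResExpr.bind_bilin, extract_cons, Multiset.cons_bind, Multiset.bind_map]
      simp only [Multiset.bind_cons, Multiset.bind_add, ← Multiset.map_bind, ih]
      congr 1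
      simp only [Multiset.map_bind, prodKernel]
      rw [Multiset.bind_bind]
      refine Multiset.bind_congr fun p _ => ?_
      simp only [hc, bilin, Multiset.map_bind, Multiset.map_map, Function.comp_def]
      rw [Multiset.bind_bind]

theorem split_bind_bind_split {γ δ ι : Type*} (u : Multiset γ) (k : Multiset γ → Multiset α)
    (E : Multiset ι) (F : α → ι → Multiset γ → Multiset γ → Multiset δ) :
    (split u fun x v => (k x).bind fun b => E.bind fun p => split v (F b p)) =
      E.bind fun p => split u fun x v => split v fun y z => (k x).bind fun b => F b p y z := by
  simp only [ResExpr.bind_split]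
  refine ResExpr.split_congr fun x v _ => ResExpr.split_congr fun y z _ => ?_
  rw [Multiset.bind_bind]

/-- Exponential vectors are preserved by kernels distributing a multiset. -/
theorem IsExp.push_tensor (hS : HasFractions S) {γ : Type*} {K : α × Multiset γ → Multiset β}
    {L : Multiset α × Multiset γ → Multiset (Multiset β)}
    (hK : Finitary K) (hL : Finitary L) (h₀ : ∀ u, L (0, u) = if u.card = 0 then {0} else 0)
    (hc : ∀ a m u, L (a ::ₘ m, u) = split u fun x y => bilin (· ::ₘ ·) (K (a, x)) (L (m, y)))
    {σ : α → S} {V : Multiset α → S} {τ : γ → S} {W : Multiset γ → S}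
    (h : IsExp σ V) (h' : IsExp τ W) :
    IsExp (Vec.push K (tensor σ W)) (Vec.push L (tensor V W)) := by
  classical
  have hL₀ : ∀ p, 0 ∈ L p → p = (0, 0) := by
    rintro ⟨m, u⟩ hm
    induction m using Multiset.induction_on with
    | empty =>
      rw [h₀] at hm
      split_ifs at hm with hu
      · rw [Multiset.card_eq_zero.1 hu]
      · simp at hm
    | cons a m _ =>
      rw [hc, ResExpr.mem_split] at hm
      obtain ⟨x, y, -, hm⟩ := hm
      obtain ⟨b, -, c, -, h⟩ := ResExpr.mem_bilin.1 hm
      exact absurd h (Multiset.cons_ne_zero)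
  refine ⟨?_, ?_⟩
  · rw [push_eq_single _ (0, 0) hL₀, tensor, h.zero, h'.zero, h₀]
    simp
  -- Both sides become images of `tensor V W`: on the right, the two copies of `W` merge into one,
  -- shared between the extracted element and the rest.
  · rw [push_push hL finitary_extract, ← push_prodKernel hK hL, ← h'.push_distribute hS,
      ← h.push_extract, push_prodKernel_left finitary_extract,
      push_push finitary_extract.prodKernel_left finitary_distribute,
      push_push (finitary_extract.prodKernel_left.bind finitary_distribute) (hK.prodKernel hL)]
    congr 1
    funext ⟨m, u⟩
    simp only [Multiset.bind_map, distribute, Multiset.bind_assoc, ResExpr.split_bind,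
      Multiset.singleton_bind]
    induction m using Multiset.induction_on generalizing u with
    | empty =>
      rw [h₀]
      split_ifs <;> simp [extract_zero]
    | cons a m ih =>
      simp only [hc, ResExpr.split_bind, ResExpr.bind_bilin, extract_cons, Multiset.cons_bind,
        Multiset.bind_map]
      simp only [Multiset.bind_cons, Multiset.bind_add, ← Multiset.map_bind, ih, ResExpr.split_add]
      congr 1
      simp only [Multiset.map_bind, ResExpr.map_split, prodKernel]
      rw [split_bind_bind_split]
      refine Multiset.bind_congr fun p _ => ?_
      rw [ResExpr.split_left_comm]
      refine ResExpr.split_congr fun x v _ => ?_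
      simp only [hc, bilin, ResExpr.map_split, ResExpr.bind_split]
      refine ResExpr.split_congr fun y z _ => ?_
      simp only [Multiset.map_bind, Multiset.map_map, Function.comp_def]
      rw [Multiset.bind_bind]

end Exp

end Vec

/-! ## The coefficients of promotions -/

section Enumerations

variable {α : Type*}

/-- The enumerations of a multiset. -/
abbrev Enumeration (n : ℕ) (m : Multiset α) : Type _ :=
  {f : Fin n → α // (List.ofFn f : Multiset α) = m}

theorem coe_ofFn_eq_map {n : ℕ} (f : Fin n → α) :
    (List.ofFn f : Multiset α) = (Finset.univ : Finset (Fin n)).val.map f := by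
  rw [List.ofFn_eq_map]
  rfl

instance (n : ℕ) (m : Multiset α) : Finite (Enumeration n m) := by
  classical
  refine Finite.of_injective (β := Fin n → {a // a ∈ m}) (fun f i => ⟨f.1 i, ?_⟩) ?_
  · have : f.1 i ∈ (List.ofFn f.1 : Multiset α) := by simp
    rwa [f.2] at this
  · intro f g h
    refine Subtype.ext (funext fun i => ?_)
    simpa using congrFun h i

theorem Enumeration.card_eq {n : ℕ} {m : Multiset α} (f : Enumeration n m) : m.card = n := by
  rw [← f.2, Multiset.coe_card, List.length_ofFn]

theorem coe_ofFn_succAbove {n : ℕ} (f : Fin (n + 1) → α) (i : Fin (n + 1)) :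
    (List.ofFn f : Multiset α) = f i ::ₘ (List.ofFn fun j => f (i.succAbove j) : Multiset α) := by
  rw [coe_ofFn_eq_map, coe_ofFn_eq_map, Fin.univ_succAbove n i, Finset.cons_val,
    Multiset.map_cons, Finset.map_val, Multiset.map_map]
  rfl

/-- Enumerations with a distinguished occurrence of `a`. -/
def enumerationConsEquiv (n : ℕ) (a : α) (m : Multiset α) :
    (Σ f : Enumeration (n + 1) (a ::ₘ m), {i // f.1 i = a}) ≃ Fin (n + 1) × Enumeration n m where
  toFun p := (p.2.1, ⟨fun j => p.1.1 (p.2.1.succAbove j), by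
    have := p.1.2
    rw [coe_ofFn_succAbove _ p.2.1, p.2.2, Multiset.cons_inj_right] at this
    exact this⟩)
  invFun p := ⟨⟨p.1.insertNth a p.2.1, by
    rw [coe_ofFn_succAbove _ p.1]
    simp [p.2.2]⟩, p.1, by simp⟩
  left_inv := by
    rintro ⟨⟨f, hf⟩, i, hi⟩
    change f i = a at hi
    subst hi
    have : i.insertNth (f i) (fun j => f (i.succAbove j)) = f := Fin.insertNth_self_removeNth i f
    -- Generalizing over `g` makes the equality eliminable despite the proofs that depend on it.
    have h : ∀ g, g = f → ∀ (h₁ : (List.ofFn g : Multiset α) = f i ::ₘ m) (h₂ : g i = f i),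
        (⟨⟨g, h₁⟩, ⟨i, h₂⟩⟩ : Σ f' : Enumeration (n + 1) (f i ::ₘ m), {j // f'.1 j = f i}) =
          ⟨⟨f, hf⟩, ⟨i, rfl⟩⟩ := by
      rintro _ rfl _ _
      rfl
    exact h _ this _ _
  right_inv := by
    rintro ⟨i, f, hf⟩
    simp

/-- Count the enumerations with a marked occurrence of `a` in two ways: by enumeration, or by the
position of the mark and what remains. -/
theorem card_enumeration_cons [DecidableEq α] (n : ℕ) (a : α) (m : Multiset α) :
    Nat.card (Enumeration (n + 1) (a ::ₘ m)) * (m.count a + 1) =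
      (n + 1) * Nat.card (Enumeration n m) := by
  have h := Nat.card_congr (enumerationConsEquiv n a m)
  have := Fintype.ofFinite (Enumeration (n + 1) (a ::ₘ m))
  rw [Nat.card_prod, Nat.card_fin, Nat.card_sigma] at h
  rw [← h, Finset.sum_congr rfl (g := fun _ => m.count a + 1), Finset.sum_const, smul_eq_mul,
    Finset.card_univ, Nat.card_eq_fintype_card]
  rintro ⟨f, hf⟩ -
  change Nat.card {i // f i = a} = _
  rw [Nat.card_eq_fintype_card, Fintype.card_subtype, ← Multiset.count_cons_self, ← hf,
    coe_ofFn_eq_map, Multiset.count_map]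
  simp [Finset.card, eq_comm]

end Enumerations

/-! ### Promotions are exponential vectors -/

namespace ResVec

open ResExpr Vec

variable {S : Type u} [CommSemiring S]

/-- All the enumerations of `m` contribute the same product of coefficients. -/
theorem pow_apply (σ : ResTerm → S) (n : ℕ) (m : Multiset ResTerm) :
    pow σ n (ofMultiset m) = (Nat.card (Enumeration n m) : S) * (m.map σ).prod := by
  classical
  have hf : ∀ f : Fin n → ResTerm,
      ofMultiset m = ofMultiset (List.ofFn f) ↔ (List.ofFn f : Multiset ResTerm) = m :=
    fun f => ofMultiset_injective.eq_iff.trans eq_comm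
  have hE : {f : Fin n → ResTerm | (List.ofFn f : Multiset ResTerm) = m}.Finite :=
    inferInstanceAs (Finite (Enumeration n m))
  rw [pow, vsum, finsum_eq_sum_of_support_subset (s := hE.toFinset),
    Finset.sum_congr rfl (g := fun _ => (m.map σ).prod), Finset.sum_const, nsmul_eq_mul,
    ← Set.ncard_eq_toFinset_card _ hE]
  · rfl
  · intro f h
    have h : (List.ofFn f : Multiset ResTerm) = m := by simpa using h
    rw [Pi.smul_apply, basis, ofList_eq, if_pos ((hf f).2 h), smul_eq_mul, mul_one, ← h,
      coe_ofFn_eq_map, Multiset.map_map]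
    rfl
  · intro f h
    by_contra h'
    refine h ?_
    have h' : ¬ (List.ofFn f : Multiset ResTerm) = m := by simpa using h'
    simp only [Pi.smul_apply, basis, ofList_eq]
    rw [if_neg fun h => h' ((hf f).1 h), smul_zero]

theorem prom_apply (σ : ResTerm → S) (m : Multiset ResTerm) :
    prom σ (ofMultiset m) = Ring.inverse (m.card.factorial : S) *
      ((Nat.card (Enumeration m.card m) : S) * (m.map σ).prod) := by
  rw [prom, vsum, finsum_eq_single _ m.card]
  · rw [Pi.smul_apply, pow_apply, smul_eq_mul]
  · intro n hn
    have : IsEmpty (Enumeration n m) := ⟨fun f => hn f.card_eq.symm⟩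
    rw [Pi.smul_apply, pow_apply, Nat.card_of_isEmpty, Nat.cast_zero, zero_mul, smul_zero]

/-- The promotion of a vector, as a vector of multisets. -/
noncomputable def expVec (σ : ResTerm → S) : Multiset ResTerm → S := fun m => prom σ (ofMultiset m)

/-- The factor `m.card + 1` produced by counting enumerations cancels against the quotient of
consecutive factorials. From here on the closed formula is needed only to locate supports. -/
theorem isExp_expVec (hS : HasFractions S) (σ : ResTerm → S) : IsExp σ (expVec σ) := by
  classical
  refine .of_cons ?_ fun a m => ?_
  · have : Nat.card (Enumeration 0 (0 : Multiset ResTerm)) = 1 := by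
      have : Unique (Enumeration 0 (0 : Multiset ResTerm)) :=
        { default := ⟨Fin.elim0, rfl⟩
          uniq := fun f => Subtype.ext (funext fun i => i.elim0) }
      exact Nat.card_unique
    rw [expVec, prom_apply, Multiset.card_zero, this]
    simp
  · rw [expVec, prom_apply, expVec, prom_apply, Multiset.card_cons, Multiset.map_cons,
      Multiset.prod_cons]
    have h1 : Ring.inverse ((m.card + 1).factorial : S) * ((m.card + 1 : ℕ) : S) =
        Ring.inverse (m.card.factorial : S) := by
      rw [Nat.factorial_succ, Nat.cast_mul, Ring.mul_inverse_rev, mul_assoc,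
        Ring.inverse_mul_cancel _ (hS _ (Nat.succ_ne_zero _)), mul_one]
    have h2 := congrArg (Nat.cast (R := S)) (card_enumeration_cons m.card a m)
    rw [Nat.cast_mul, Nat.cast_mul] at h2
    calc _ = Ring.inverse ((m.card + 1).factorial : S) *
          ((Nat.card (Enumeration (m.card + 1) (a ::ₘ m)) : S) * ((m.count a + 1 : ℕ) : S)) *
            (σ a * (m.map σ).prod) := by ring
      _ = (Ring.inverse ((m.card + 1).factorial : S) * ((m.card + 1 : ℕ) : S)) *
          (Nat.card (Enumeration m.card m) : S) * (σ a * (m.map σ).prod) := by rw [h2]; ring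
      _ = _ := by rw [h1]; ring

theorem expVec_ne_zero {σ : ResTerm → S} {m : Multiset ResTerm} (h : expVec σ m ≠ 0) :
    ∀ s ∈ m, σ s ≠ 0 := by
  intro s hs h'
  rw [expVec, prom_apply, Multiset.prod_eq_zero (Multiset.mem_map.2 ⟨s, hs, h'⟩), mul_zero,
    mul_zero] at h
  exact h rfl

/-- Application to a multiset. -/
def appM (p : ResTerm × Multiset ResTerm) : ResTerm := ResExpr.app p.1 (ofMultiset p.2)

theorem appM_injective : Function.Injective appM := by
  rintro ⟨s, m⟩ ⟨s', m'⟩ h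
  obtain ⟨rfl, h⟩ := app_inj.1 h
  exact congrArg _ (ofMultiset_injective h)

theorem lam_eq_push (σ : ResTerm → S) : lam σ = push (fun s => {ResExpr.lam s}) σ := by
  classical
  funext y
  rw [lam, vsum, push_apply]
  refine finsum_congr fun s => ?_
  simp [basis, Multiset.count_singleton]

theorem app_eq_push (σ : ResTerm → S) (τ : ResMono → S) :
    app σ τ = push (fun p => {appM p}) (tensor σ fun m => τ (ofMultiset m)) := by
  classical
  funext y
  rw [app, vsum, push_apply, ← finsum_comp_equiv ((Equiv.refl ResTerm).prodCongr monoEquiv)]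
  refine finsum_congr fun s => ?_
  simp [basis, Multiset.count_singleton, appM, tensor, monoEquiv]

end ResVec

namespace ResExpr

/-! ## Finiteness of the fibres of substitution and left reduction -/

/-- A size measure taking the indices of variables into account, so that finitely many expressions
have a given weight. -/
def weight {k : Kind} (e : ResExpr k) : ℕ :=
  fold (C := fun _ => ℕ)
    { var := fun n => n + 1
      lam := fun a => a + 1
      app := fun a b => a + b + 1
      nil := 0
      cons := fun a b => a + b + 1
      swap := fun a a' b => by omega } e

section Weight

variable (s : ResTerm) (t : ResMono) (n : ℕ)

@[simp] theorem weight_var : weight (var n) = n + 1 := rfl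

@[simp] theorem weight_lam : weight (lam s) = weight s + 1 := by
  induction s using Quotient.inductionOn
  rfl

@[simp] theorem weight_app : weight (app s t) = weight s + weight t + 1 := by
  induction s using Quotient.inductionOn
  induction t using Quotient.inductionOn
  rfl

@[simp] theorem weight_nil : weight nil = 0 := rfl

@[simp] theorem weight_cons : weight (cons s t) = weight s + weight t + 1 := by
  induction s using Quotient.inductionOn
  induction t using Quotient.inductionOn
  rfl

theorem weight_pos : 0 < weight s := by
  obtain ⟨n, rfl⟩ | ⟨s, rfl⟩ | ⟨s, t, rfl⟩ := term_cases s <;> simp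

/-- Each `cons` adds one unit, charged to its element, whose weight is positive; hence the factor
two. -/
theorem weight_ofMultiset_le (u : Multiset ResTerm) :
    weight (ofMultiset u) ≤ 2 * (u.map weight).sum := by
  induction u using Multiset.induction_on with
  | empty => simp
  | cons a u ih =>
    have := weight_pos a
    simp
    omega

end Weight

theorem finite_weight_le (N : ℕ) :
    {s : ResTerm | weight s ≤ N}.Finite ∧ {t : ResMono | weight t ≤ N}.Finite := by
  induction N with
  | zero =>
    constructor
    · refine Set.finite_empty.subset fun s hs => ?_
      have := weight_pos s
      exact absurd (show weight s ≤ 0 from hs) (by omega)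
    · refine (Set.finite_singleton nil).subset fun t ht => ?_
      obtain rfl | ⟨s, t, rfl⟩ := mono_cases t
      · rfl
      · simp at ht
  | succ N ih =>
    obtain ⟨h, h'⟩ := ih
    constructor
    · refine (((Set.finite_le_nat N).image var).union ((h.image lam).union
        (h.image2 app h'))).subset fun s hs => ?_
      obtain ⟨n, rfl⟩ | ⟨s, rfl⟩ | ⟨s, t, rfl⟩ := term_cases s
      · exact .inl ⟨n, by simpa using hs, rfl⟩
      · exact .inr (.inl ⟨s, by simpa using hs, rfl⟩)
      · have hs : weight s + weight t ≤ N := by simpa using hs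
        exact .inr (.inr ⟨s, show _ ≤ N by omega, t, show _ ≤ N by omega, rfl⟩)
    · refine ((Set.finite_singleton nil).union (h.image2 cons h')).subset fun t ht => ?_
      obtain rfl | ⟨s, t, rfl⟩ := mono_cases t
      · exact .inl rfl
      · have ht : weight s + weight t ≤ N := by simpa using ht
        exact .inr ⟨s, show _ ≤ N by omega, t, show _ ≤ N by omega, rfl⟩

theorem finite_sum_weight_le (N : ℕ) : {u : Multiset ResTerm | (u.map weight).sum ≤ N}.Finite := by
  refine ((finite_weight_le (2 * N)).2.image fun t => elems t).subset fun u hu => ?_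
  have hu : (u.map weight).sum ≤ N := hu
  have := weight_ofMultiset_le u
  exact ⟨ofMultiset u, show _ ≤ 2 * N by omega, elems_ofMultiset u⟩

theorem weight_le_weight_shift {k : Kind} (e : ResExpr k) :
    ∀ c, weight e ≤ weight (shift e c) := by
  apply induction_on (P := fun {k} e => ∀ c, weight e ≤ weight (shift e c))
  · intro n c
    rw [shift_var]
    split_ifs <;> simp
  · intro s ih c
    simpa using ih (c + 1)
  · intro s t ih ih' c
    have := ih c
    have := ih' c
    simp
    omega
  · intro c
    exact le_rfl
  · intro s t ih ih' c
    have := ih c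
    have := ih' c
    simp
    omega

/-- Nothing is erased: every element of `u` survives in `e'`, up to shifts that never lower weights.
The factor `d + weight e' + 1` allows for variable leaves of `e` lost in `e'`, since the index `d`
grows by one under each abstraction, and abstractions remain in `e'`. -/
theorem weight_le_of_mem_lsubst {k : Kind} (e : ResExpr k) : ∀ (d : ℕ) (u : Multiset ResTerm),
    ∀ e' ∈ lsubst e d u, weight e ≤ (d + weight e' + 1) * weight e' ∧
      (u.map weight).sum ≤ weight e' := by
  apply induction_on (P := fun {k} e => ∀ (d : ℕ) (u : Multiset ResTerm),
    ∀ e' ∈ lsubst e d u, weight e ≤ (d + weight e' + 1) * weight e' ∧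
      (u.map weight).sum ≤ weight e')
  · intro n d u e' he
    rcases eq_or_ne n d with rfl | hn
    · rw [lsubst_var_self] at he
      split_ifs at he with h
      · obtain ⟨a, rfl⟩ := Multiset.card_eq_one.1 h
        obtain rfl := Multiset.mem_singleton.1 he
        have := weight_pos e'
        simp only [weight_var, Multiset.map_singleton, Multiset.sum_singleton]
        exact ⟨by nlinarith, le_rfl⟩
      · simp at he
    · rw [lsubst_var_ne hn] at he
      split_ifs at he with h h'
      · obtain rfl := Multiset.card_eq_zero.1 h
        obtain rfl := Multiset.mem_singleton.1 he
        simp only [weight_var, Multiset.map_zero, Multiset.sum_zero]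
        exact ⟨by nlinarith, Nat.zero_le _⟩
      · obtain rfl := Multiset.card_eq_zero.1 h
        obtain rfl := Multiset.mem_singleton.1 he
        simp only [weight_var, Multiset.map_zero, Multiset.sum_zero]
        obtain ⟨m, rfl⟩ : ∃ m, n = m + 1 := ⟨n - 1, by omega⟩
        exact ⟨by rw [Nat.add_sub_cancel]; nlinarith, Nat.zero_le _⟩
      · simp at he
  · intro s ih d u e' he
    rw [lsubst_lam, Multiset.mem_map] at he
    obtain ⟨a, ha, rfl⟩ := he
    obtain ⟨h1, h2⟩ := ih _ _ _ ha
    rw [Multiset.map_map] at h2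
    have h3 : (u.map weight).sum ≤ (u.map (weight ∘ fun s => s.shift 0)).sum :=
      Multiset.sum_map_le_sum_map _ _ fun s _ => weight_le_weight_shift s 0
    rw [weight_lam, weight_lam]
    exact ⟨by nlinarith, by omega⟩
  · intro s t ih ih' d u e' he
    rw [lsubst_app, mem_lsubst_bin] at he
    obtain ⟨u₁, u₂, rfl, s', hs, t', ht, rfl⟩ := he
    obtain ⟨h1, h2⟩ := ih _ _ _ hs
    obtain ⟨h3, h4⟩ := ih' _ _ _ ht
    rw [weight_app, weight_app, Multiset.map_add, Multiset.sum_add]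
    exact ⟨by nlinarith [Nat.zero_le (weight s' * weight t')], by omega⟩
  · intro d u e' he
    rw [lsubst_nil] at he
    split_ifs at he with h
    · obtain rfl := Multiset.card_eq_zero.1 h
      simp
    · simp at he
  · intro s t ih ih' d u e' he
    rw [lsubst_cons, mem_lsubst_bin] at he
    obtain ⟨u₁, u₂, rfl, s', hs, t', ht, rfl⟩ := he
    obtain ⟨h1, h2⟩ := ih _ _ _ hs
    obtain ⟨h3, h4⟩ := ih' _ _ _ ht
    rw [weight_cons, weight_cons, Multiset.map_add, Multiset.sum_add]
    exact ⟨by nlinarith [Nat.zero_le (weight s' * weight t')], by omega⟩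

/-- The polynomial is dictated by the β case: with `w = weight e'`, the body costs `(w + 1) * w`,
the monomial `2 * w`, and the two constructors `2`, which is at most `2 * w` because `w` is
positive. -/
theorem weight_le_of_mem_left {k : Kind} (e : ResExpr k) :
    ∀ e' ∈ left e, weight e ≤ weight e' * weight e' + 5 * weight e' := by
  apply induction_on (P := fun {k} e =>
    ∀ e' ∈ left e, weight e ≤ weight e' * weight e' + 5 * weight e')
  · intro n e' he
    obtain rfl := Multiset.mem_singleton.1 he
    nlinarith [Nat.zero_le (weight (var n))]
  · intro s ih e' he
    rw [left_lam] at he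
    obtain ⟨a, ha, rfl⟩ := Multiset.mem_map.1 he
    have := ih a ha
    rw [weight_lam, weight_lam]
    nlinarith
  · intro s t ih ih' e' he
    by_cases hs : ∃ s', s = lam s'
    · obtain ⟨s, rfl⟩ := hs
      rw [left_beta] at he
      obtain ⟨h1, h2⟩ := weight_le_of_mem_lsubst _ _ _ _ he
      have h3 := weight_ofMultiset_le (elems t)
      rw [ofMultiset_elems] at h3
      have := weight_pos e'
      rw [weight_app, weight_lam]
      nlinarith
    · push Not at hs
      rw [left_app_of_ne_lam hs] at he
      obtain ⟨a, ha, b, hb, rfl⟩ := mem_bilin.1 he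
      have h1 := ih a ha
      have h2 : weight t ≤ weight b * weight b + 5 * weight b := by
        split_ifs at hb
        · exact ih' b hb
        · obtain rfl := Multiset.mem_singleton.1 hb
          nlinarith
      rw [weight_app, weight_app]
      nlinarith [Nat.zero_le (weight a * weight b)]
  · intro e' he
    exact Nat.zero_le _
  · intro s t ih ih' e' he
    rw [left_cons] at he
    obtain ⟨a, ha, b, hb, rfl⟩ := mem_bilin.1 he
    have h1 := ih a ha
    have h2 := ih' b hb
    rw [weight_cons, weight_cons]
    nlinarith [Nat.zero_le (weight a * weight b)]

open Vec

theorem finitary_shift (c : ℕ) : Finitary fun s : ResTerm => {shift s c} := by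
  intro y
  refine (finite_weight_le (weight y)).1.subset fun s hs => ?_
  obtain rfl := Multiset.mem_singleton.1 hs
  exact weight_le_weight_shift s c

theorem finitary_map_shift (c : ℕ) :
    Finitary fun m : Multiset ResTerm => {m.map (shift · c)} := by
  intro y
  refine (finite_sum_weight_le (y.map weight).sum).subset fun m hm => ?_
  obtain rfl := Multiset.mem_singleton.1 hm
  rw [Multiset.map_map]
  exact Multiset.sum_map_le_sum_map _ _ fun s _ => weight_le_weight_shift s c

theorem finitary_lsubst (d : ℕ) :
    Finitary fun p : ResTerm × Multiset ResTerm => lsubst p.1 d p.2 := by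
  intro y
  refine ((finite_weight_le ((d + weight y + 1) * weight y)).1.prod
    (finite_sum_weight_le (weight y))).subset fun p hp => ?_
  exact weight_le_of_mem_lsubst _ _ _ _ hp

theorem finitary_msubst (d : ℕ) :
    Finitary fun p : Multiset ResTerm × Multiset ResTerm => msubst p.1 d p.2 := by
  intro y
  set w := weight (ofMultiset y)
  refine (((finite_weight_le ((d + w + 1) * w)).2.image fun t => elems t).prod
    (finite_sum_weight_le w)).subset fun p hp => ?_
  obtain ⟨t, ht, rfl⟩ := Multiset.mem_map.1 hp
  obtain ⟨h1, h2⟩ := weight_le_of_mem_lsubst _ _ _ _ ht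
  rw [show t = ofMultiset (elems t) from (ofMultiset_elems t).symm] at h1 h2
  exact ⟨⟨_, h1, elems_ofMultiset _⟩, h2⟩

theorem finitary_left : Finitary (left : ResTerm → Multiset ResTerm) := fun _ =>
  (finite_weight_le _).1.subset fun s hs => weight_le_of_mem_left s _ hs

/-- Left reduction of the elements of a multiset. -/
def leftM (m : Multiset ResTerm) : Multiset (Multiset ResTerm) := (left (ofMultiset m)).map elems

theorem leftM_zero : leftM 0 = {0} := by simp [leftM]

theorem leftM_cons (a : ResTerm) (m : Multiset ResTerm) :
    leftM (a ::ₘ m) = bilin (· ::ₘ ·) (left a) (leftM m) := by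
  rw [leftM, ofMultiset_cons, left_cons, map_bilin, leftM, ← Multiset.map_id' (left a), bilin_map]
  simp

theorem finitary_leftM : Finitary leftM := by
  intro y
  set w := weight (ofMultiset y)
  refine ((finite_weight_le (w * w + 5 * w)).2.image fun t => elems t).subset fun m hm => ?_
  obtain ⟨t, ht, rfl⟩ := Multiset.mem_map.1 hm
  have h := weight_le_of_mem_left _ _ ht
  rw [show t = ofMultiset (elems t) from (ofMultiset_elems t).symm] at h
  exact ⟨_, h, elems_ofMultiset _⟩

theorem finitary_leftIter (n : ℕ) : Finitary fun s : ResTerm => leftIter s n := by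
  induction n with
  | zero => exact finitary_singleton
  | succ n ih => exact ih.bind finitary_left

end ResExpr

/-! ## Taylor expansion, substitution and left reduction -/

section Taylor

open ResExpr Vec ResVec

/-! ### Linearity and transport of tensors -/

section Tensor

variable {S : Type u} [CommSemiring S] {X Y Z : Type*}

theorem Vec.tensor_zero_left (τ : Y → S) : tensor (0 : X → S) τ = 0 := by
  funext p
  simp [tensor]

theorem Vec.tensor_smul_left (a : S) (σ : X → S) (τ : Y → S) :
    tensor (a • σ) τ = a • tensor σ τ := by
  funext p
  simp [tensor, mul_assoc]

theorem Vec.tensor_add_left (σ σ' : X → S) (τ : Y → S) :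
    tensor (σ + σ') τ = tensor σ τ + tensor σ' τ := by
  funext p
  simp [tensor, add_mul]

theorem Vec.push_tensor_basis (K : X × Y → Multiset Z) (x : X) (V : Y → S) :
    push K (tensor (basis S x) V) = push (fun y => K (x, y)) V := by
  classical
  funext z
  rw [push_apply, push_apply]
  have h := finsum_mem_range (f := fun p => tensor (basis S x) V p * ((K p).count z : S))
    (Prod.mk_right_injective (β := Y) x)
  rw [finsum_mem_def, Set.indicator_eq_self.2] at h
  · rw [h]
    simp [tensor, basis]
  · rintro ⟨a, b⟩ hp
    by_contra hx
    refine hp ?_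
    have : a ≠ x := fun h => hx ⟨b, by rw [h]⟩
    simp [tensor, basis, this]

theorem Vec.push_tensor_push_right {W : Type*} {K : Y → Multiset W} (hK : Finitary K)
    {L : X × W → Multiset Z} (hL : Finitary L) (σ : X → S) (τ : Y → S) :
    push L (tensor σ (push K τ)) = push (fun p => (K p.2).bind fun w => L (p.1, w)) (tensor σ τ) := by
  have := push_prodKernel finitary_singleton hK σ τ
  rw [push_singleton] at this
  rw [← this, push_push (finitary_singleton.prodKernel hK) hL]
  congr 1
  funext p
  simp [prodKernel, bilin, Multiset.bind_map]

theorem Vec.push_tensor_push_left {W : Type*} {K : X → Multiset W} (hK : Finitary K)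
    {L : W × Y → Multiset Z} (hL : Finitary L) (σ : X → S) (τ : Y → S) :
    push L (tensor (push K σ) τ) = push (fun p => (K p.1).bind fun w => L (w, p.2)) (tensor σ τ) := by
  rw [push_prodKernel_left hK, push_push hK.prodKernel_left hL]
  simp only [Multiset.bind_map]

end Tensor

variable {S : Type u} [CommSemiring S]

theorem finitary_lam : Finitary fun s : ResTerm => {ResExpr.lam s} :=
  finitary_map fun _ _ => lam_inj.1

theorem finitary_appM : Finitary fun p => {appM p} := finitary_map appM_injective

theorem expVec_push (hS : HasFractions S) {K : ResTerm → Multiset ResTerm}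
    {L : Multiset ResTerm → Multiset (Multiset ResTerm)}
    (hK : Finitary K) (hL : Finitary L) (h₀ : L 0 = {0})
    (hc : ∀ a m, L (a ::ₘ m) = bilin (· ::ₘ ·) (K a) (L m)) (σ : ResTerm → S) :
    expVec (push K σ) = push L (expVec σ) :=
  (isExp_expVec hS _).unique hS ((isExp_expVec hS σ).push hK hL h₀ hc)

theorem expVec_shift (hS : HasFractions S) (σ : ResTerm → S) (c : ℕ) :
    expVec (push (fun s => {ResExpr.shift s c}) σ) =
      push (fun m => {m.map fun s => ResExpr.shift s c}) (expVec σ) :=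
  expVec_push hS (finitary_shift c) (finitary_map_shift c) (by simp)
    (fun a m => by rw [bilin_singleton, Multiset.map_cons]) σ

/-- Both sides are exponentials of the same vector, by `IsExp.push_tensor` for the right one, so
uniqueness identifies them. -/
theorem expVec_lsubst (hS : HasFractions S) (d : ℕ) (σ τ : ResTerm → S) :
    expVec (push (fun p => lsubst p.1 d p.2) (tensor σ (expVec τ))) =
      push (fun p => msubst p.1 d p.2) (tensor (expVec σ) (expVec τ)) :=
  (isExp_expVec hS _).unique hS ((isExp_expVec hS σ).push_tensor hS (finitary_lsubst d)
    (finitary_msubst d) (fun u => msubst_zero d u) (fun a m u => msubst_cons a m d u)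
    (isExp_expVec hS τ))

theorem expVec_left (hS : HasFractions S) (σ : ResTerm → S) :
    expVec (push left σ) = push leftM (expVec σ) :=
  expVec_push hS finitary_left finitary_leftM leftM_zero leftM_cons σ

theorem lsubst_appM (s : ResTerm) (m : Multiset ResTerm) (d : ℕ) (u : Multiset ResTerm) :
    lsubst (appM (s, m)) d u = split u fun x y =>
      (bilin Prod.mk (lsubst s d x) (msubst m d y)).map appM := by
  rw [appM, lsubst_app_eq_split]
  refine split_congr fun x y _ => ?_
  rw [map_bilin, msubst, ← Multiset.map_id' (lsubst s d x), bilin_map]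
  simp [appM]

/-! ### Taylor expansion of raw terms: renaming, substitution, linearity, support -/

namespace RawTerm

theorem taylor_app (M N : RawTerm S) :
    (app M N).taylor = push (fun p => {appM p}) (tensor M.taylor (expVec N.taylor)) :=
  app_eq_push _ _

theorem taylor_lam (M : RawTerm S) :
    (lam M).taylor = push (fun s => {ResExpr.lam s}) M.taylor :=
  lam_eq_push _

theorem push_basis {X Y : Type*} (K : X → Multiset Y) (x : X) :
    push K (basis S x) = ofSum S (K x) := by
  classical
  funext y
  rw [push_apply, finsum_eq_single _ x]
  · simp only [basis, ofSum, if_true, one_mul]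
  · intro x' h
    simp [basis, h]

theorem ofSum_singleton {X : Type*} (x : X) : ofSum S {x} = basis S x := by
  classical
  funext y
  simp only [basis, ofSum, Multiset.count_singleton]
  split_ifs <;> simp

theorem taylor_shift (hS : HasFractions S) (M : RawTerm S) (c : ℕ) :
    (M.shift c).taylor = push (fun s => {ResExpr.shift s c}) M.taylor := by
  induction M generalizing c with
  | var n =>
    rw [shift, taylor, push_basis, ofSum_singleton, ResExpr.shift_var]
    split_ifs <;> rfl
  | lam M ih =>
    rw [shift, taylor_lam, taylor_lam, ih, push_push (finitary_shift _) finitary_lam,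
      push_push finitary_lam (finitary_shift _)]
    simp
  | app M N ih ih' =>
    rw [shift, taylor_app, taylor_app, ih, ih', expVec_shift hS,
      ← push_prodKernel (finitary_shift c) (finitary_map_shift c),
      push_push ((finitary_shift c).prodKernel (finitary_map_shift c)) finitary_appM,
      push_push finitary_appM (finitary_shift _)]
    congr 1
    funext p
    simp only [prodKernel, bilin_singleton, Multiset.singleton_bind, appM, ResExpr.shift_app,
      Multiset.singleton_inj, app_inj, true_and]
    exact elems_injective (by rw [elems_ofMultiset, elems_shift, elems_ofMultiset])
  | zero => exact (push_zero _).symm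
  | smul a M ih =>
    rw [shift, taylor, taylor, push_smul (finitary_shift c), ih]
  | add M N ih ih' =>
    rw [shift, taylor, taylor, push_add (finitary_shift c), ih, ih']

/-- The Taylor expansion of a substitution is a multilinear substitution. -/
theorem taylor_subst (hS : HasFractions S) (M : RawTerm S) (d : ℕ) (N : RawTerm S) :
    (M.subst d N).taylor =
      push (fun p => lsubst p.1 d p.2) (tensor M.taylor (expVec N.taylor)) := by
  classical
  induction M generalizing d N with
  | var n =>
    rw [taylor, push_tensor_basis]
    have hV := isExp_expVec hS N.taylor
    rcases eq_or_ne n d with rfl | hn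
    · rw [subst, if_neg (lt_irrefl n), if_pos rfl]
      funext y
      -- Only the one-element monomial `{y}` can yield `y`; the derivative at the empty multiset
      -- says that its coefficient is that of `y` in the expansion of `N`.
      rw [push_eq_single _ {y}]
      · have := hV.cons y 0
        simp only [lsubst_var_self, Multiset.card_singleton, if_true, Multiset.count_singleton_self]
        rw [hV.zero, Multiset.count_zero, zero_add, mul_one, Multiset.cons_zero] at this
        exact this.symm
      · intro u hu
        rw [lsubst_var_self] at hu
        split_ifs at hu with h
        · obtain ⟨a, rfl⟩ := Multiset.card_eq_one.1 h
          rw [Multiset.mem_singleton.1 hu]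
        · simp at hu
    · have h : (var n : RawTerm S).subst d N = var (if n < d then n else n - 1) := by
        rw [subst, if_neg hn]
        split_ifs <;> rfl
      have h' : (if n < d then ResExpr.var n else ResExpr.var (n - 1)) =
        ResExpr.var (if n < d then n else n - 1) := by split_ifs <;> rfl
      rw [h, taylor, ← ofSum_singleton]
      funext y
      -- Without an occurrence of `d`, only the empty monomial contributes, with coefficient one.
      rw [push_eq_single _ 0]
      · rw [lsubst_var_ne hn, if_pos Multiset.card_zero, hV.zero, one_mul, h', ofSum]
      · intro u hu
        rw [lsubst_var_ne hn] at hu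
        split_ifs at hu with h1 h2 <;> first | exact Multiset.card_eq_zero.1 h1 | simp at hu
  | lam M ih =>
    rw [subst, taylor_lam, taylor_lam, ih, taylor_shift hS, expVec_shift hS,
      push_push (finitary_lsubst _) finitary_lam,
      push_tensor_push_right (finitary_map_shift 0) ((finitary_lsubst _).bind finitary_lam),
      push_tensor_push_left finitary_lam (finitary_lsubst _)]
    simp [lsubst_lam, Multiset.bind_singleton]
  | app M P ih ih' =>
    have hA : Finitary (prodKernel (fun p : ResTerm × Multiset ResTerm => lsubst p.1 d p.2)
      fun p : Multiset ResTerm × Multiset ResTerm => msubst p.1 d p.2) :=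
      (finitary_lsubst d).prodKernel (finitary_msubst d)
    -- The promotion of `N` appears once in the function and once in the argument; `push_distribute`
    -- replaces the two copies by one that is split, as `lsubst` does on applications.
    rw [subst, taylor_app, taylor_app, ih, ih', expVec_lsubst hS,
      ← push_prodKernel (finitary_lsubst d) (finitary_msubst d),
      push_push hA finitary_appM,
      ← (isExp_expVec hS N.taylor).push_distribute hS,
      push_push finitary_distribute (hA.bind finitary_appM),
      push_tensor_push_left finitary_appM (finitary_lsubst _)]
    congr 1
    funext ⟨⟨s, m⟩, u⟩
    simp only [Multiset.singleton_bind, lsubst_appM, distribute, split_bind, prodKernel,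
      Multiset.bind_singleton]
  | zero =>
    rw [subst, taylor, tensor_zero_left, push_zero]
  | smul a M ih =>
    rw [subst, taylor, taylor, tensor_smul_left, push_smul (finitary_lsubst d), ih]
  | add M P ih ih' =>
    rw [subst, taylor, taylor, tensor_add_left, push_add (finitary_lsubst d), ih, ih']

/-- Abstraction, and application in its function, are linear on vectors. Hence the expansion of a
left reduct can be computed before returning to canonical form. -/
theorem CanEq.taylor_eq {M N : RawTerm S} (h : CanEq M N) : M.taylor = N.taylor := by
  induction h with
  | refl => rfl
  | symm _ ih => exact ih.symm
  | trans _ _ ih ih' => exact ih.trans ih'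
  | lam _ ih => rw [taylor, taylor, ih]
  | app _ _ ih ih' => rw [taylor, taylor, ih, ih']
  | smul a _ ih => rw [taylor, taylor, ih]
  | add _ _ ih ih' => rw [taylor, taylor, ih, ih']
  | lam_zero => rw [taylor_lam, taylor, push_zero]
  | lam_smul a M => rw [taylor_lam, taylor, taylor, push_smul finitary_lam, taylor_lam]
  | lam_add M N => rw [taylor_lam, taylor, taylor, push_add finitary_lam, taylor_lam, taylor_lam]
  | app_zero P => rw [taylor_app, taylor, tensor_zero_left, push_zero]
  | app_smul a M P =>
    rw [taylor_app, taylor, taylor, tensor_smul_left, push_smul finitary_appM, taylor_app]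
  | app_add M N P =>
    rw [taylor_app, taylor, taylor, tensor_add_left, push_add finitary_appM, taylor_app, taylor_app]

theorem exists_of_taylor_app_ne_zero {M N : RawTerm S} {y : ResTerm}
    (h : (app M N).taylor y ≠ 0) :
    ∃ s m, y = appM (s, m) ∧ M.taylor s ≠ 0 ∧ expVec N.taylor m ≠ 0 := by
  by_cases hy : ∃ p, y = appM p
  · obtain ⟨⟨s, m⟩, rfl⟩ := hy
    rw [taylor_app, push_map_apply appM_injective, tensor] at h
    exact ⟨s, m, rfl, left_ne_zero_of_mul h, right_ne_zero_of_mul h⟩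
  · refine absurd ?_ h
    rw [taylor_app]
    exact push_eq_zero _ fun p hp => hy ⟨p, Multiset.mem_singleton.1 hp⟩

theorem exists_of_taylor_lam_ne_zero {M : RawTerm S} {y : ResTerm} (h : (lam M).taylor y ≠ 0) :
    ∃ s, y = ResExpr.lam s ∧ M.taylor s ≠ 0 := by
  by_cases hy : ∃ s, y = ResExpr.lam s
  · obtain ⟨s, rfl⟩ := hy
    rw [taylor_lam, push_map_apply fun _ _ => lam_inj.1] at h
    exact ⟨s, rfl, h⟩
  · refine absurd ?_ h
    rw [taylor_lam]
    exact push_eq_zero _ fun p hp => hy ⟨p, Multiset.mem_singleton.1 hp⟩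

/-- Only this inclusion holds in general: coefficients may vanish or cancel in `S`, while
`taylorSup` ignores them. -/
theorem mem_taylorSup_of_taylor_ne_zero {M : RawTerm S} {y : ResTerm} (h : M.taylor y ≠ 0) :
    y ∈ M.taylorSup := by
  induction M generalizing y with
  | var n =>
    by_contra h'
    exact h (if_neg h')
  | lam M ih =>
    obtain ⟨s, rfl, hs⟩ := exists_of_taylor_lam_ne_zero h
    exact ⟨s, ih hs, rfl⟩
  | app M N ih ih' =>
    obtain ⟨s, m, rfl, hs, hm⟩ := exists_of_taylor_app_ne_zero h
    refine ⟨s, ih hs, ofMultiset m, fun v hv => ih' (expVec_ne_zero hm v ?_), rfl⟩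
    rwa [elems_ofMultiset] at hv
  | zero => exact h rfl
  | smul a M ih => exact ih (right_ne_zero_of_mul h)
  | add M N ih ih' =>
    by_cases hM : M.taylor y = 0
    · refine .inr (ih' fun hN => h ?_)
      rw [taylor, Pi.add_apply, hM, hN, add_zero]
    · exact .inl (ih hM)

end RawTerm

/-! ### Left reduction commutes with Taylor expansion -/

namespace Canon

/-- A simple term has a single head, shared by all the resource terms in its expansion, so the terms
and their approximants make the same choice about reducing arguments. -/
theorem headVar_of_taylor_ne_zero {c : CanonClass} (M : Canon S c) (hc : c = .simple)
    {s : ResTerm} (hs : M.toRaw.taylor s ≠ 0) : ResExpr.headVar s = M.headVar := by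
  induction M generalizing s with
  | var n =>
    obtain rfl := RawTerm.mem_taylorSup_of_taylor_ne_zero hs
    rfl
  | lam M ih =>
    obtain ⟨s, rfl, -⟩ := RawTerm.exists_of_taylor_lam_ne_zero hs
    exact ResExpr.headVar_lam s
  | app M N ih ih' =>
    obtain ⟨s, m, rfl, hs, -⟩ := RawTerm.exists_of_taylor_app_ne_zero hs
    exact (ResExpr.headVar_app s _).trans (ih rfl hs)
  | ofSimple | zero | smul | add => cases hc

theorem left_appM_of_headVar {p : ResTerm × Multiset ResTerm} (h : ResExpr.headVar p.1 = true) :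
    left (appM p) = (prodKernel left leftM p).bind fun q => {appM q} := by
  rw [appM, left_app_of_ne_lam (ne_lam_of_headVar h), if_pos h, prodKernel, leftM, bind_bilin, bilin]
  simp [Multiset.bind_singleton, appM]

/-- Left reduction of terms and of resource terms agree through Taylor expansion. -/
theorem taylor_leftReduct (hS : HasFractions S) {c : CanonClass} (M : Canon S c) :
    M.leftReduct.taylor = push left M.toRaw.taylor := by
  -- Applications that are not redexes: no approximant of the function is an abstraction, so `left`
  -- acts componentwise on approximants.
  have happ : ∀ (M : Canon S .simple) (N : Canon S .general),
      (∀ s : ResTerm, M.toRaw.taylor s ≠ 0 → ∀ s', s ≠ ResExpr.lam s') →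
      M.leftReduct.taylor = push left M.toRaw.taylor →
      N.leftReduct.taylor = push left N.toRaw.taylor →
      (RawTerm.app M.leftReduct (if M.headVar then N.leftReduct else N.toRaw)).taylor =
        push left (app M N).toRaw.taylor := by
    intro M N hM ih ih'
    rw [toRaw, RawTerm.taylor_app, RawTerm.taylor_app, push_push finitary_appM finitary_left, ih]
    simp only [Multiset.singleton_bind]
    cases hv : M.headVar with
    | true =>
      rw [if_pos rfl, ih', expVec_left hS, ← push_prodKernel finitary_left finitary_leftM,
        push_push (finitary_left.prodKernel finitary_leftM) finitary_appM]
      refine push_congr fun p hp => ?_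
      rw [left_appM_of_headVar]
      rw [headVar_of_taylor_ne_zero M rfl (left_ne_zero_of_mul hp), hv]
    | false =>
      rw [if_neg (by simp), push_tensor_push_left finitary_left finitary_appM]
      refine push_congr fun p hp => ?_
      have hp := left_ne_zero_of_mul hp
      rw [appM, left_app_of_ne_lam (hM _ hp), headVar_of_taylor_ne_zero M rfl hp, hv, bilin,
        if_neg (by simp)]
      simp [appM, Multiset.bind_singleton]
  induction M with
  | var n => rw [leftReduct, toRaw, RawTerm.taylor, RawTerm.push_basis, left_var,
      RawTerm.ofSum_singleton]
  | lam M ih =>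
    rw [leftReduct, toRaw, RawTerm.taylor_lam, RawTerm.taylor_lam, ih,
      push_push finitary_left finitary_lam, push_push finitary_lam finitary_left]
    simp [left_lam, Multiset.bind_singleton]
  | app M N ih ih' =>
    cases M with
    | var n =>
      have := happ (var n) N (fun s hs s' => ne_lam_of_headVar
        (headVar_of_taylor_ne_zero (var n) rfl hs) s') ih ih'
      simpa only [leftReduct, headVar, if_true] using this
    | lam M =>
      -- Head redex: `taylor_subst` yields the multilinear substitution into which `left_beta`
      -- contracts each approximant.
      rw [leftReduct, RawTerm.taylor_subst hS, toRaw, RawTerm.taylor_app, toRaw, RawTerm.taylor_lam,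
        push_push finitary_appM finitary_left]
      rw [push_tensor_push_left finitary_lam (finitary_appM.bind finitary_left)]
      simp [appM, left_beta]
    | app M P =>
      have := happ (app M P) N (fun s hs s' => ?_) ih ih'
      · rwa [headVar] at this
      · obtain ⟨s, m, rfl, -⟩ := RawTerm.exists_of_taylor_app_ne_zero hs
        exact app_ne_lam _ _ _
  | ofSimple M ih => exact ih
  | zero => exact (push_zero _).symm
  | smul a M ih => rw [leftReduct, toRaw, RawTerm.taylor, RawTerm.taylor, push_smul finitary_left, ih]
  | add M N ih ih' =>
    rw [leftReduct, toRaw, RawTerm.taylor, RawTerm.taylor, push_add finitary_left, ih, ih']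

end Canon

/-! ### Normalizability and convergence for algebraic terms -/

namespace AlgTerm

theorem TaylorNormalizable.finite_generates {S : Type u} {M : AlgTerm S} (hM : M.TaylorNormalizable)
    {e : ResTerm} (he : IsNormal e) : {s | s ∈ M.taylorSup ∧ Generates s e}.Finite :=
  (hM.1 _ ⟨e, he, rfl⟩).subset fun _ hs => ⟨hs.2, hs.1⟩

theorem taylor_leftReduct (hS : HasFractions S) (M : AlgTerm S) :
    M.leftReduct.taylor = push left M.taylor := by
  rw [taylor, taylor, ← Canon.taylor_leftReduct hS]
  exact (RawTerm.canEq_canon _).taylor_eq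

theorem taylor_leftReduct_iterate (hS : HasFractions S) (M : AlgTerm S) (n : ℕ) :
    (leftReduct^[n] M).taylor = push (fun s => leftIter s n) M.taylor := by
  induction n with
  | zero => exact (push_singleton _).symm
  | succ n ih =>
    rw [Function.iterate_succ_apply', taylor_leftReduct hS, ih,
      push_push (finitary_leftIter n) finitary_left]
    rfl

theorem support_taylor_subset (M : AlgTerm S) : Function.support M.taylor ⊆ M.taylorSup :=
  fun _ h => RawTerm.mem_taylorSup_of_taylor_ne_zero h

/-- Both finiteness conditions pass from the Taylor support to the smaller support of the vector,
because an element of a normal form is generated by its source. -/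
theorem TaylorNormalizable.normalizable_taylor {M : AlgTerm S} (hM : M.TaylorNormalizable) :
    Normalizable M.taylor := by
  refine ⟨?_, ?_⟩
  · refine Set.Finite.subset hM.2 ?_
    exact Set.biUnion_subset_biUnion_left M.support_taylor_subset
  · intro e
    have hmem : ∀ s : Function.support M.taylor,
        ofSum ℕ (nf {(s : ResTerm)}) e ≠ 0 → e ∈ nform (s : ResTerm) := by
      intro s hs
      rw [nf_singleton] at hs
      by_contra h
      exact hs (by simp [ofSum, h])
    by_cases he : IsNormal e
    · refine Set.Finite.of_finite_image (f := Subtype.val) ((hM.finite_generates he).subset ?_)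
        Subtype.val_injective.injOn
      rintro _ ⟨s, hs, rfl⟩
      exact ⟨M.support_taylor_subset s.2, generates_of_mem_nform (hmem s hs)⟩
    · refine Set.finite_empty.subset fun s hs => ?_
      exact he (isNormal_of_mem_nform (hmem s hs))

/-- The Taylor expansions of the iterated left reducts converge to the normal form. -/
theorem TaylorNormalizable.convergesTo_normalForm (hS : HasFractions S) {M : AlgTerm S}
    (hM : M.TaylorNormalizable) :
    ConvergesTo (fun n : ℕ => normRestr (leftReduct^[n] M).taylor) (normalForm M.taylor) := by
  classical
  intro e
  have hNF : normalForm M.taylor e = ∑ᶠ s, M.taylor s * ((nform s).count e : S) := by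
    rw [normalForm, vsum]
    refine finsum_congr fun s => ?_
    rw [nf_singleton, Pi.smul_apply, smul_eq_mul, ofSum]
  by_cases he : IsNormal e
  -- `B` bounds the sizes of the finitely many terms of the Taylor support that generate `e`; after
  -- `B + 1` left steps all of them are normalized.
  · obtain ⟨B, hB⟩ := ((hM.finite_generates he).image size).bddAbove
    refine ⟨B + 1, fun n hn => ?_⟩
    simp only [normRestr, if_pos he]
    rw [hNF, taylor_leftReduct_iterate hS, push_apply]
    refine finsum_congr fun s => ?_
    by_cases hs : M.taylor s = 0
    · rw [hs, zero_mul, zero_mul]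
    · have hs := M.support_taylor_subset hs
      congr 2
      -- A term that does not generate `e` contributes zero on both sides, whatever its size.
      by_cases hg : Generates s e
      · have := hB ⟨s, ⟨hs, hg⟩, rfl⟩
        rw [leftIter_eq_nform (by omega)]
      · rw [Multiset.count_eq_zero_of_notMem fun h => hg (generates_of_mem_leftIter h),
          Multiset.count_eq_zero_of_notMem fun h => hg (generates_of_mem_nform h)]
  · refine ⟨0, fun n _ => ?_⟩
    simp only [normRestr, if_neg he]
    rw [hNF, finsum_eq_zero_of_forall_eq_zero]
    intro s
    rw [Multiset.count_eq_zero_of_notMem fun h => he (isNormal_of_mem_nform h), Nat.cast_zero,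
      mul_zero]

end AlgTerm

end Taylor

theorem theorem7p11 {S : Type*} [CommSemiring S] (hS : HasFractions S) (M : AlgTerm S)
    (hM : M.TaylorNormalizable) :
    ResVec.Normalizable M.taylor ∧
      Vec.ConvergesTo (fun k : ℕ => ResVec.normRestr (AlgTerm.leftReduct^[k] M).taylor)
        (ResVec.normalForm M.taylor) :=
  ⟨hM.normalizable_taylor, hM.convergesTo_normalForm hS⟩
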